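/- Let $f(x)=x^4+ax^2+bx+c\in\mathbb Z[x]$ be irreducible, let $\theta$ be a root of $f$, $K=\mathbb Q(\theta)$, and $\Delta=v_3(\operatorname{disc}(f))$, where $v_3$ is the $3$-adic valuation and $v_3(0)=\infty$. Suppose that $a\equiv 3\pmod 9$, $3\nmid b$ and $3\mid c$. Terminology. For an integer $s$ let $f(x)=\sum_{k=0}^4 a_k(x-s)^k$ be the Taylor development of $f$ at $s$. The $(x-s)$-Newton polygon of $f$ is the lower convex envelope of the points $(k,v_3(a_k))$ with $a_k\neq0$, and $N_{x-s}^-(f)$ is the union of its sides of negative slope. If a side of $N_{x-s}^-(f)$ has end points with abscissas $i<j$ and slope $-h/e$ with $h,e$ positive and coprime, its residual polynomial is $\sum_{t=0}^{d}c_{i+te}\,y^t\in\mathbb F_3[y]$, where $d=(j-i)/e$, and $c_k$ is the class of $a_k/3^{v_3(a_k)}$ modulo $3$ if $a_k\neq 0$ and $(k,v_3(a_k))$ lies on the side, and $c_k=0$ otherwise. The integer $s$ is regular if the residual polynomial of every side of $N_{x-s}^-(f)$ is separable, and irregular otherwise. A step of the iteration method leads from an irregular $s$ to $t=s+y3^{\delta}$,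 where $-\delta$ is the slope, assumed to be an integer, of a side with inseparable residual polynomial, and $y$ is any integer whose class modulo $3$ is a multiple root of this residual polynomial. A $3$-integral basis of $K$ is a family of algebraic integers of $K$ which is a basis of $\mathbb Z_K\otimes\mathbb Z_{(3)}$ over $\mathbb Z_{(3)}$, where $\mathbb Z_K$ is the ring of integers of $K$ and $\mathbb Z_{(3)}$ is the localization of $\mathbb Z$ at $3$. Let $s_0$ be an integer with $s_0\equiv -b\pmod 3$ and $v_3(a+6s_0^2)>\Delta/6$. Put $u_0=v_3(f(s_0))$, $u_1=v_3(f'(s_0))$ and $\sigma_0=f(s_0)/3^{u_0}$. 1. The integer $s_0$ is irregular if and only if $2u_0<3u_1$ and $3\mid u_0$. 2. If $s_0$ is regular, take $s=s_0$. If $s_0$ is irregular, let $s_1=s_0+y\,3^{u_0/3}$, where $y=1$ if $\sigma_0\equiv b\pmod 3$ and $y=-1$ otherwise. If $s_1$ is regular, take $s=s_1$. If $s_1$ is irregular, then the iteration method started at $s_1$, whatever choices are made in it, can be continued from each irregular integer that it reaches and arrives after finitely many steps at a regular integer; take for $s$ any regular integer obtained in this way. Then $$1,\quad \theta,\quad \frac{\theta^2+2s\theta+3s^2+a}{3^{\nu_2}},\quad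 \frac{\theta^3+s\theta^2+(s^2+a)\theta+s^3+as+b}{3^{\nu_1}}$$ is a $3$-integral basis of $K$, where, for $i=1,2$, $\nu_i=\lfloor y_i\rfloor$ and $y_i$ is the ordinate of the point of abscissa $i$ on $N_{x-s}^-(f)$. Moreover, exactly one row of the following table applies, and it gives the values of $\nu_1$ and $\nu_2$ (an empty entry is no condition). $$\begin{array}{|c|c|c|c|c|}\hline u_0,\,u_1&v_3(f(s_1))&v_3(f'(s_1))&\nu_1&\nu_2\\\hline 2u_0\ge 3u_1&&&u_1&\lfloor u_1/2\rfloor\\\hline 2u_0<3u_1,\ 3\nmid u_0&&&\lfloor 2u_0/3\rfloor&\lfloor u_0/3\rfloor\\\hline 2u_0<3u_1,\ 3\mid u_0&u_0+1&&2u_0/3&u_0/3\\\hline 2u_0<3u_1,\ 3\mid u_0&>u_0+1&(2u_0/3)+1&(2u_0/3)+1&u_0/3\\\hline 2u_0<3u_1,\ 3\mid u_0&u_0+2&>(2u_0/3)+1&(2u_0/3)+1&u_0/3\\\hline 2u_0<3u_1,\ 3\mid u_0&>u_0+2&>(2u_0/3)+1&\lfloor \Delta/2\rfloor-(u_0/3)-1&(u_0/3)+1\\\hline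 \end{array}$$ -/

import Mathlib

open Polynomial

noncomputable section

/-- The quartic polynomial `x ^ 4 + a x ^ 2 + b x + c`. -/
def quartic (a b c : ℤ) : ℤ[X] := X ^ 4 + C a * X ^ 2 + C b * X + C c

/-- The `p`-adic value of an integer, with value `⊤` at `0`. -/
def vp (p : ℕ) (n : ℤ) : ℕ∞ := emultiplicity (p : ℤ) n

/-! ### Newton polygons with respect to `x - s`

`p` is a prime number, `F` a polynomial with integer coefficients and `s` an integer. -/

/-- The coefficient `a_k` of the `(x - s)`-adic development `F = ∑ a_k (x - s) ^ k`. -/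
def devCoeff (F : ℤ[X]) (s : ℤ) (k : ℕ) : ℤ := (taylor s F).coeff k

/-- The value `u_k = v_p(a_k)` as an integer; it is used only for `a_k ≠ 0`. -/
def devVal (p : ℕ) (F : ℤ[X]) (s : ℤ) (k : ℕ) : ℤ := (padicValInt p (devCoeff F s k) : ℤ)

/-- The points `(i, u_i)` and `(j, u_j)`, `i < j`, are the end points of a side of the
`(x - s)`-Newton polygon of `F`, the lower convex envelope of the points `(k, u_k)` with `a_k ≠ 0`:
the line through them has no point of this set below it, and every point of the set which lies
on the line has its abscissa in `[i, j]`. -/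
structure IsSide (p : ℕ) (F : ℤ[X]) (s : ℤ) (i j : ℕ) : Prop where
  lt : i < j
  left_ne : devCoeff F s i ≠ 0
  right_ne : devCoeff F s j ≠ 0
  above : ∀ k, devCoeff F s k ≠ 0 →
    (devVal p F s j - devVal p F s i) * ((k : ℤ) - i) ≤
      (devVal p F s k - devVal p F s i) * ((j : ℤ) - i)
  strictly_above : ∀ k, devCoeff F s k ≠ 0 → (k < i ∨ j < k) →
    (devVal p F s j - devVal p F s i) * ((k : ℤ) - i) <
      (devVal p F s k - devVal p F s i) * ((j : ℤ) - i)

/-- A side of negative slope, that is, a side of the principal polygon `N⁻`. -/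
def IsPrincipalSide (p : ℕ) (F : ℤ[X]) (s : ℤ) (i j : ℕ) : Prop :=
  IsSide p F s i j ∧ devVal p F s j < devVal p F s i

/-- The point `(x, y)` lies on the principal polygon, the union of the sides of negative slope. -/
def OnPrincipalPolygon (p : ℕ) (F : ℤ[X]) (s : ℤ) (x y : ℚ) : Prop :=
  ∃ i j : ℕ, IsPrincipalSide p F s i j ∧ (i : ℚ) ≤ x ∧ x ≤ j ∧
    (y - devVal p F s i) * ((j : ℚ) - i) = (devVal p F s j - devVal p F s i) * (x - i)

open Classical in
/-- The residual coefficient `c_k` at an abscissa `k` of the side with end points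
`(i, u_i)`, `(j, u_j)`: the class of `a_k / p ^ u_k` in `𝔽_p` if the point `(k, u_k)` lies on the
side, and `0` otherwise. -/
def residualCoeff (p : ℕ) (F : ℤ[X]) (s : ℤ) (i j k : ℕ) : ZMod p :=
  if devCoeff F s k ≠ 0 ∧
      (devVal p F s k - devVal p F s i) * ((j : ℤ) - i) =
        (devVal p F s j - devVal p F s i) * ((k : ℤ) - i) then
    ((devCoeff F s k / (p : ℤ) ^ padicValInt p (devCoeff F s k) : ℤ) : ZMod p)
  else 0

/-- The degree `d` of a side: if `-h / e` is its slope in lowest terms, then `d = (j - i) / e`,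
which is the greatest common divisor of its length and its height. -/
def sideDegree (p : ℕ) (F : ℤ[X]) (s : ℤ) (i j : ℕ) : ℕ :=
  Int.gcd ((j : ℤ) - i) (devVal p F s j - devVal p F s i)

/-- The residual polynomial `c_i + c_{i+e} y + ⋯ + c_{i+de} y ^ d` of a side, where
`e = (j - i) / d` is its ramification index. -/
def residualPoly (p : ℕ) (F : ℤ[X]) (s : ℤ) (i j : ℕ) : (ZMod p)[X] :=
  ∑ t ∈ Finset.range (sideDegree p F s i j + 1),
    C (residualCoeff p F s i j (i + t * ((j - i) / sideDegree p F s i j))) * X ^ t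

/-- The integer `s` is regular: the residual polynomials of all the sides of negative slope of the
`(x - s)`-Newton polygon of `F` are separable. -/
def IsRegularAt (p : ℕ) (F : ℤ[X]) (s : ℤ) : Prop :=
  ∀ i j : ℕ, IsPrincipalSide p F s i j → (residualPoly p F s i j).Separable

/-- One step `s ↦ t = s + y p ^ δ` of the iteration method: `-δ` is the (integer) slope of a side
with inseparable residual polynomial, and `y` is any integer whose class modulo `p` is a multiple
root of that residual polynomial. There is no step from a regular integer. -/
def IterStep (p : ℕ) (F : ℤ[X]) (s t : ℤ) : Prop :=
  ∃ (i j δ : ℕ) (y : ℤ), IsPrincipalSide p F s i j ∧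
    ¬ (residualPoly p F s i j).Separable ∧
    devVal p F s i - devVal p F s j = (δ : ℤ) * ((j : ℤ) - i) ∧
    (X - C (y : ZMod p)) ^ 2 ∣ residualPoly p F s i j ∧
    t = s + y * (p : ℤ) ^ δ

/-- `t` is obtained from `s` by a finite number (possibly zero) of steps of the iteration. -/
def IterReaches (p : ℕ) (F : ℤ[X]) (s t : ℤ) : Prop :=
  Relation.ReflTransGen (IterStep p F) s t

/-- The iteration method started at `s` always ends, after finitely many steps, at a regular
integer: it never gets stuck at an irregular one, and it cannot go on forever, whatever the choices
made along the way. -/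
def IterSucceeds (p : ℕ) (F : ℤ[X]) (s : ℤ) : Prop :=
  (∀ t : ℤ, IterReaches p F s t → ¬ IsRegularAt p F t → ∃ t' : ℤ, IterStep p F t t') ∧
    ¬ ∃ r : ℕ → ℤ, r 0 = s ∧ ∀ n, IterStep p F (r n) (r (n + 1))

/-! ### Integral bases -/

/-- `v` is a `p`-integral basis of the number field `K`: its members are algebraic integers, they
are linearly independent, and they generate the ring of integers of `K` after localization at `p`:
every algebraic integer of `K` is a combination of them with coefficients in `ℤ_(p)`. -/
structure IsPIntegralBasis {K : Type*} [Field K] [NumberField K] (p : ℕ) {n : ℕ}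
    (v : Fin n → K) : Prop where
  integral : ∀ i, IsIntegral ℤ (v i)
  linearIndependent : LinearIndependent ℚ v
  span : ∀ z : K, IsIntegral ℤ z →
    ∃ r : Fin n → ℚ, (∀ i, ¬ p ∣ (r i).den) ∧ z = ∑ i, (r i : K) * v i

/-- The family `1, θ, q₂(θ) / p ^ ν₂, q₁(θ) / p ^ ν₁`, where `q₁`, `q₂` are the first two quotients
of the `(x - s)`-adic development of `x ^ 4 + a x ^ 2 + b x + c`. -/
def tripleBasis {K : Type*} [Field K] (p : ℕ) (a b s : ℤ) (θ : K) (ν₁ ν₂ : ℕ) : Fin 4 → K :=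
  ![1, θ,
    (θ ^ 2 + 2 * (s : K) * θ + 3 * (s : K) ^ 2 + (a : K)) / (p : K) ^ ν₂,
    (θ ^ 3 + (s : K) * θ ^ 2 + ((s : K) ^ 2 + (a : K)) * θ + (s : K) ^ 3 + (a : K) * (s : K)
      + (b : K)) / (p : K) ^ ν₁]

end

/-! Write a_0, a_1, a_2, a_3 for the lower Taylor coefficients at an integer `s` prime to 3. Since
a_3 = 4s is a 3-adic unit, the principal polygon lies over the abscissas 0 to 3 and describes a
cubic factor of f over ℤ_3; the remaining factor is linear. A side is either of degree one, hence
harmless, or it has length 2 or 3, integer slope and a residual polynomial of degree 2 or 3 over 𝔽_3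
(`IsCubicAt.side_cases`). When such a polynomial is inseparable, it has a multiple root in 𝔽_3, so a
step of the iteration is always available. The discriminant of f is a_3² (a_1² a_2² - 4 a_2³ a_0 - 4
a_3 a_1³) plus terms that are more divisible by 3 (`discPoly`, `pow_dvd_discRest`), and modulo 3 the
bracket is the discriminant of a cubic. This ties separability of residual polynomials to the exact
value of Δ.

Three shapes occur at a regular integer. If a_1 gives a point on the polygon and a_2 is negligible,
then Δ = 3u_1 (`disc_of_vertex_one`). If the polygon is one side of height u_0 prime to 3, the cubic
factor is totally ramified. If the polygon passes through a point (2, n) of the development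
(`IsDoubleAt`), then Δ = 2n + μ, where ⌊μ/2⌋ = ν_1 and n = ν_2 (`IsDoubleAt.exists_data`). In the
first and third shapes the discriminant of the proposed family has 3-adic value 0 or 1, and this
forces maximality (`isPIntegralBasis_of_discr`). In the second shape ramification is wild and the
discriminant test cannot apply; there the last two members have valuations 1/3 and 2/3 of that of 3,
and a trace takes care of the linear factor (`saturated_of_one_side`).

The hypothesis on a + 6s_0² is exploited by a bootstrap: if u_0 and u_1 were large compared with Δ,
too high a power of 3 would divide the discriminant. Hence a_2 lies above the rest of the polygon at
s_0, and s_0 is irregular exactly when the residual polynomial is a cube (`dvd_two_of_vertex_one`,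
`dvd_two_of_one_side`). After the shift to s_1 either one of the first two shapes appears, or
v_3(a_2) is exactly u_0/3 + 1 and `IsDoubleAt` holds. That condition survives every step with n
fixed and m increased by one (`IsDoubleAt.of_iterStep`), while 3^(6n+m) divides the nonzero
discriminant (`IsDoubleAt.pow_dvd_discPoly`); so the iteration stops. -/

instance : Fact (Nat.Prime 3) := ⟨Nat.prime_three⟩

/-! ### Cubic polynomials over the field with three elements -/

/-- An inseparable polynomial of degree 2 or 3 over 𝔽_3 has its multiple root in 𝔽_3. The derivative
has lost its cubic term in characteristic 3. The condition on c₂, c₃ is needed because the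
expression vanishes identically on linear polynomials. -/
theorem exists_common_root_of_disc_eq_zero :
    ∀ c₀ c₁ c₂ c₃ : ZMod 3, (c₂ ≠ 0 ∨ c₃ ≠ 0) → c₁ ^ 2 * c₂ ^ 2 - c₁ ^ 3 * c₃ - c₀ * c₂ ^ 3 = 0 →
      ∃ y : ZMod 3, c₀ + c₁ * y + c₂ * y ^ 2 + c₃ * y ^ 3 = 0 ∧ c₁ + 2 * c₂ * y = 0 := by
  decide

/-- The general polynomial of degree at most three. -/
noncomputable def cubicPoly (c₀ c₁ c₂ c₃ : ZMod 3) : (ZMod 3)[X] :=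
  C c₀ + C c₁ * X + C c₂ * X ^ 2 + C c₃ * X ^ 3

theorem three_eq_zero_poly : (3 : (ZMod 3)[X]) = 0 := by
  have : (3 : (ZMod 3)[X]) = C (3 : ZMod 3) := (map_ofNat C 3).symm
  rw [this, show (3 : ZMod 3) = 0 from rfl, C_0]

theorem derivative_cubicPoly (c₀ c₁ c₂ c₃ : ZMod 3) :
    derivative (cubicPoly c₀ c₁ c₂ c₃) = C c₁ + 2 * C c₂ * X := by
  have h := three_eq_zero_poly
  simp only [cubicPoly, derivative_add, derivative_mul, derivative_C, derivative_X,
    derivative_X_pow, map_natCast]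
  push_cast
  linear_combination C c₃ * X ^ 2 * h

theorem sq_dvd_cubicPoly {c₀ c₁ c₂ c₃ y : ZMod 3}
    (h₀ : c₀ + c₁ * y + c₂ * y ^ 2 + c₃ * y ^ 3 = 0) (h₁ : c₁ + 2 * c₂ * y = 0) :
    (X - C y) ^ 2 ∣ cubicPoly c₀ c₁ c₂ c₃ := by
  have h := three_eq_zero_poly
  have e₁ : c₁ = -(2 * c₂ * y) := by linear_combination h₁
  have e₀ : c₀ = c₂ * y ^ 2 - c₃ * y ^ 3 := by rw [e₁] at h₀; linear_combination h₀
  -- The quotient found by long division by X² - 2yX + y².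
  refine ⟨C c₃ * X + (C c₂ + 2 * C c₃ * C y), ?_⟩
  subst e₁ e₀
  simp only [cubicPoly, C_sub, C_mul, C_pow, C_neg, map_ofNat]
  linear_combination (-C c₃ * C y ^ 3 + C c₃ * C y ^ 2 * X) * h

theorem eval_eq_zero_of_sq_dvd_cubicPoly {c₀ c₁ c₂ c₃ y : ZMod 3}
    (h : (X - C y) ^ 2 ∣ cubicPoly c₀ c₁ c₂ c₃) :
    c₀ + c₁ * y + c₂ * y ^ 2 + c₃ * y ^ 3 = 0 ∧ c₁ + 2 * c₂ * y = 0 := by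
  obtain ⟨g, hg⟩ := h
  constructor
  · have := congrArg (eval y) hg
    simpa only [cubicPoly, eval_add, eval_mul, eval_C, eval_X, eval_pow, eval_sub, sub_self,
      ne_eq, OfNat.ofNat_ne_zero, not_false_eq_true, zero_pow, zero_mul] using this
  · have := congrArg (fun f => eval y (derivative f)) hg
    rw [derivative_cubicPoly] at this
    simpa [derivative_mul, derivative_pow] using this

/-- In characteristic 3 the derivative is c₁ - c₂X. Evaluating the polynomial at its root c₁/c₂ and
clearing c₂³ gives minus the discriminant, so the discriminant is, up to sign, a resultant. -/
theorem separable_cubicPoly_iff {c₀ c₁ c₂ c₃ : ZMod 3} (h : c₂ ≠ 0 ∨ c₃ ≠ 0) :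
    (cubicPoly c₀ c₁ c₂ c₃).Separable ↔ c₁ ^ 2 * c₂ ^ 2 - c₁ ^ 3 * c₃ - c₀ * c₂ ^ 3 ≠ 0 := by
  have h3 := three_eq_zero_poly
  constructor
  · intro hs hd
    obtain ⟨y, h₀, h₁⟩ := exists_common_root_of_disc_eq_zero c₀ c₁ c₂ c₃ h hd
    obtain ⟨u, v, huv⟩ := hs
    have := congrArg (eval y) huv
    rw [derivative_cubicPoly] at this
    simp only [cubicPoly, eval_add, eval_mul, eval_C, eval_X, eval_pow, eval_ofNat, h₀, h₁,
      mul_zero, add_zero, eval_one, zero_ne_one] at this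
  · intro hd
    set d := c₁ ^ 2 * c₂ ^ 2 - c₁ ^ 3 * c₃ - c₀ * c₂ ^ 3 with hdef
    -- Bézout coefficients: c₂³ times the polynomial is -d modulo c₁ - c₂X, and the second cofactor
    -- is the quotient of that division. The identity remains valid for c₂ = 0.
    refine ⟨-C d⁻¹ * C c₂ ^ 3, -C d⁻¹ * (C c₃ * (C c₂ ^ 2 * X ^ 2 + C c₂ * X * C c₁ + C c₁ ^ 2)
      + C c₂ ^ 2 * (C c₂ * X + C c₁) + C c₂ ^ 2 * C c₁), ?_⟩
    have e : C d⁻¹ * C d = 1 := by rw [← C_mul, inv_mul_cancel₀ hd, C_1]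
    rw [derivative_cubicPoly, ← e, hdef]
    simp only [cubicPoly, C_sub, C_mul, C_pow]
    linear_combination (-C d⁻¹ * (C c₂ ^ 2 * C c₁ ^ 2 + C c₂ * X * (C c₃ * (C c₂ ^ 2 * X ^ 2
      + C c₂ * X * C c₁ + C c₁ ^ 2) + C c₂ ^ 2 * (C c₂ * X + C c₁) + C c₂ ^ 2 * C c₁))) * h3

/-! ### Valuations -/

theorem padicValInt_three_eq {a x : ℤ} {m : ℕ} (h : a = 3 ^ m * x) (hx : ¬ (3 : ℤ) ∣ x) :
    padicValInt 3 a = m := by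
  have ha : a ≠ 0 := by
    rintro rfl
    rcases mul_eq_zero.mp h.symm with h | h
    · exact absurd h (by positivity)
    · exact hx (h ▸ dvd_zero 3)
  apply le_antisymm
  · by_contra! hlt
    have := (padicValInt_dvd_iff (p := 3) (m + 1) a).mpr (Or.inr hlt)
    rw [h] at this
    push_cast at this
    rw [pow_succ] at this
    exact hx (Int.dvd_of_mul_dvd_mul_left (by positivity) this)
  · exact ((padicValInt_dvd_iff (p := 3) m a).mp ⟨x, by exact_mod_cast h⟩).resolve_left ha

theorem le_padicValInt_three {a : ℤ} {m : ℕ} (h : (3 : ℤ) ^ m ∣ a) (ha : a ≠ 0) :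
    m ≤ padicValInt 3 a :=
  ((padicValInt_dvd_iff (p := 3) m a).mp (by exact_mod_cast h)).resolve_left ha

theorem exists_eq_three_pow_mul {a : ℤ} (ha : a ≠ 0) :
    ∃ x : ℤ, a = 3 ^ padicValInt 3 a * x ∧ ¬ (3 : ℤ) ∣ x := by
  obtain ⟨x, hx⟩ := (padicValInt_dvd_iff (p := 3) (padicValInt 3 a) a).mpr (Or.inr le_rfl)
  refine ⟨x, by exact_mod_cast hx, ?_⟩
  rintro ⟨y, rfl⟩
  have : ((3 : ℕ) : ℤ) ^ (padicValInt 3 a + 1) ∣ a := ⟨y, by rw [pow_succ, mul_assoc]; exact hx⟩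
  have := ((padicValInt_dvd_iff (p := 3) _ a).mp this).resolve_left ha
  omega

theorem zmod_three_ne_zero {x : ℤ} : (x : ZMod 3) ≠ 0 ↔ ¬ (3 : ℤ) ∣ x := by
  rw [Ne, ZMod.intCast_zmod_eq_zero_iff_dvd]; rfl

theorem zmod_three_eq_zero {x : ℤ} : (x : ZMod 3) = 0 ↔ (3 : ℤ) ∣ x := by
  rw [ZMod.intCast_zmod_eq_zero_iff_dvd]; rfl

section NewtonPolygon

variable {F : ℤ[X]} {s : ℤ}

theorem devVal_eq {k m : ℕ} {x : ℤ} (h : devCoeff F s k = 3 ^ m * x) (hx : ¬ (3 : ℤ) ∣ x) :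
    devVal 3 F s k = m := by
  rw [devVal, padicValInt_three_eq h hx]

theorem le_devVal {k m : ℕ} (h : (3 : ℤ) ^ m ∣ devCoeff F s k) (h0 : devCoeff F s k ≠ 0) :
    (m : ℤ) ≤ devVal 3 F s k :=
  Int.ofNat_le.mpr (le_padicValInt_three h h0)

/-- The case distinction in `residualCoeff` disappears once m is the height of the side over k: if 3
divides x, the coefficient vanishes or its point is strictly above the side, and both the residual
coefficient and the class of x are zero. -/
theorem residualCoeff_eq {i j k m : ℕ} {x : ℤ} (hij : i < j)
    (h : devCoeff F s k = 3 ^ m * x)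
    (hm : ((m : ℤ) - devVal 3 F s i) * ((j : ℤ) - i) =
      (devVal 3 F s j - devVal 3 F s i) * ((k : ℤ) - i)) :
    residualCoeff 3 F s i j k = (x : ZMod 3) := by
  unfold residualCoeff
  by_cases hx : (3 : ℤ) ∣ x
  · rw [zmod_three_eq_zero.mpr hx, if_neg]
    rintro ⟨h0, hk⟩
    have hlt : ((m + 1 : ℕ) : ℤ) ≤ devVal 3 F s k := by
      refine le_devVal ?_ h0
      rw [h, pow_succ]
      exact mul_dvd_mul_left _ hx
    rw [← hm] at hk
    have := mul_right_cancel₀ (by omega : ((j : ℤ) - i) ≠ 0) hk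
    push_cast at hlt
    omega
  · have hv := devVal_eq h hx
    have hv' : padicValInt 3 (devCoeff F s k) = m := padicValInt_three_eq h hx
    rw [if_pos]
    · rw [hv', h]
      push_cast
      rw [Int.mul_ediv_cancel_left _ (by positivity)]
    · refine ⟨?_, by rw [hv, hm]⟩
      rw [h]
      intro h0
      rcases mul_eq_zero.mp h0 with h0 | h0
      · exact absurd h0 (by positivity)
      · exact hx (h0 ▸ dvd_zero 3)

/-- The residual polynomial of a side of degree one is separable. -/
theorem residualPoly_separable_of_sideDegree_eq_one {i j : ℕ} (h : IsPrincipalSide 3 F s i j)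
    (hd : sideDegree 3 F s i j = 1) : (residualPoly 3 F s i j).Separable := by
  have hij := h.1.lt
  have key : ∀ k, devCoeff F s k ≠ 0 → (k = i ∨ k = j) → residualCoeff 3 F s i j k ≠ 0 := by
    intro k hk hk'
    obtain ⟨x, hx, hx'⟩ := exists_eq_three_pow_mul hk
    rw [residualCoeff_eq hij hx]
    · exact zmod_three_ne_zero.mpr hx'
    · rcases hk' with rfl | rfl <;> simp [devVal]
  have hj := key j h.1.right_ne (Or.inr rfl)
  have : residualPoly 3 F s i j =
      C (residualCoeff 3 F s i j j) * X + C (residualCoeff 3 F s i j i) := by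
    simp only [residualPoly, hd, Finset.sum_range_succ, Finset.sum_range_zero]
    simp [show i + (j - i) = j by omega, add_comm]
  rw [this]
  refine ⟨0, C (residualCoeff 3 F s i j j)⁻¹, ?_⟩
  simp [← C_mul, inv_mul_cancel₀ hj]

/-- The integer `s` is close to the roots of a factor of degree three of `F`, over `ℤ_3`. -/
structure IsCubicAt (F : ℤ[X]) (s : ℤ) : Prop where
  four : devCoeff F s 4 = 1
  high : ∀ k, 4 < k → devCoeff F s k = 0
  three : ¬ (3 : ℤ) ∣ devCoeff F s 3
  ne_zero : devCoeff F s 0 ≠ 0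
  dvd_zero : (3 : ℤ) ∣ devCoeff F s 0
  dvd_one : (3 : ℤ) ∣ devCoeff F s 1
  dvd_two : (3 : ℤ) ∣ devCoeff F s 2

namespace IsCubicAt

theorem devVal_three (h : IsCubicAt F s) : devVal 3 F s 3 = 0 := by
  simpa using devVal_eq (m := 0) (x := devCoeff F s 3) (by simp) h.three

theorem devVal_four (h : IsCubicAt F s) : devVal 3 F s 4 = 0 := by
  simpa using devVal_eq (m := 0) (x := 1) (by simpa using h.four) (by norm_num)

theorem three_ne (h : IsCubicAt F s) : devCoeff F s 3 ≠ 0 := fun h0 => h.three (h0 ▸ _root_.dvd_zero 3)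

/-- A line descending to (4, 0) would leave the point (3, 0) below it. -/
theorem le_three (h : IsCubicAt F s) {i j : ℕ} (hs : IsPrincipalSide 3 F s i j) : j ≤ 3 := by
  obtain ⟨hs, hlt⟩ := hs
  by_contra! hj
  have hj4 : j = 4 := by
    by_contra hne
    exact hs.right_ne (h.high j (by omega))
  subst hj4
  have h3 := h.devVal_three
  have h4 := h.devVal_four
  have hi := hs.lt
  have ab := hs.above 3 h.three_ne
  rw [h3, h4] at ab
  rw [h4] at hlt
  interval_cases i <;> norm_num at ab hlt h3 <;> omega

/-- Abscissas beyond 3 need no check: a line of negative slope that does not pass above (3, 0) is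
strictly below (4, 0). -/
theorem isPrincipalSide (h : IsCubicAt F s) {i j : ℕ} (hij : i < j) (hj : j ≤ 3)
    (hi0 : devCoeff F s i ≠ 0) (hj0 : devCoeff F s j ≠ 0) (hv : devVal 3 F s j < devVal 3 F s i)
    (hin : ∀ k, i < k → k < j → devCoeff F s k ≠ 0 →
      (devVal 3 F s j - devVal 3 F s i) * ((k : ℤ) - i) ≤
        (devVal 3 F s k - devVal 3 F s i) * ((j : ℤ) - i))
    (hout : ∀ k, k ≤ 3 → (k < i ∨ j < k) → devCoeff F s k ≠ 0 →
      (devVal 3 F s j - devVal 3 F s i) * ((k : ℤ) - i) <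
        (devVal 3 F s k - devVal 3 F s i) * ((j : ℤ) - i)) :
    IsPrincipalSide 3 F s i j := by
  have h3 := h.devVal_three
  have h4 := h.devVal_four
  have hst : ∀ k, devCoeff F s k ≠ 0 → (k < i ∨ j < k) →
      (devVal 3 F s j - devVal 3 F s i) * ((k : ℤ) - i) <
        (devVal 3 F s k - devVal 3 F s i) * ((j : ℤ) - i) := by
    intro k hk hk'
    rcases le_or_gt k 3 with h' | h'
    · exact hout k h' hk' hk
    have hk4 : k = 4 := by
      by_contra hne
      exact hk (h.high k (by omega))
    subst hk4
    rw [h4]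
    rcases hj.lt_or_eq with hj | rfl
    · have ho := hout 3 le_rfl (Or.inr hj) h.three_ne
      rw [h3] at ho
      push_cast at ho ⊢
      linarith
    · rw [h3] at hv ⊢
      push_cast
      linarith
  refine ⟨⟨hij, hi0, hj0, ?_, hst⟩, hv⟩
  intro k hk
  rcases lt_trichotomy k i with h' | rfl | h'
  · exact (hst k hk (Or.inl h')).le
  · simp
  rcases lt_trichotomy k j with h'' | rfl | h''
  · exact hin k h' h'' hk
  · exact le_rfl
  · exact (hst k hk (Or.inr h'')).le

theorem residualPoly_zero_two {m δ : ℕ} {x₀ x₁ x₂ : ℤ}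
    (h₀ : devCoeff F s 0 = 3 ^ (m + 2 * δ) * x₀) (h₁ : devCoeff F s 1 = 3 ^ (m + δ) * x₁)
    (h₂ : devCoeff F s 2 = 3 ^ m * x₂) (hx₀ : ¬ (3 : ℤ) ∣ x₀) (hx₂ : ¬ (3 : ℤ) ∣ x₂) :
    residualPoly 3 F s 0 2 = cubicPoly x₀ x₁ x₂ 0 := by
  have v₀ := devVal_eq h₀ hx₀
  have v₂ := devVal_eq h₂ hx₂
  have hd : sideDegree 3 F s 0 2 = 2 := by
    rw [sideDegree, v₀, v₂, Int.gcd_eq_iff]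
    exact ⟨by norm_num, ⟨-δ, by push_cast; ring⟩, fun c hc _ => by simpa using hc⟩
  simp only [residualPoly, hd, Finset.sum_range_succ, Finset.sum_range_zero]
  rw [residualCoeff_eq (k := 0 + 0 * ((2 - 0) / 2)) (by norm_num) (by simpa using h₀),
    residualCoeff_eq (k := 0 + 1 * ((2 - 0) / 2)) (by norm_num) (by simpa using h₁),
    residualCoeff_eq (k := 0 + 2 * ((2 - 0) / 2)) (by norm_num) (by simpa using h₂)]
  · simp [cubicPoly]
  all_goals (simp only [v₀, v₂] <;> push_cast <;> ring)

theorem residualPoly_one_three {δ : ℕ} {x₁ x₂ : ℤ} (h : IsCubicAt F s)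
    (h₁ : devCoeff F s 1 = 3 ^ (2 * δ) * x₁) (h₂ : devCoeff F s 2 = 3 ^ δ * x₂)
    (hx₁ : ¬ (3 : ℤ) ∣ x₁) :
    residualPoly 3 F s 1 3 = cubicPoly x₁ x₂ (devCoeff F s 3) 0 := by
  have v₁ := devVal_eq h₁ hx₁
  have v₃ := h.devVal_three
  have hd : sideDegree 3 F s 1 3 = 2 := by
    rw [sideDegree, v₁, v₃, Int.gcd_eq_iff]
    exact ⟨by norm_num, ⟨-δ, by push_cast; ring⟩, fun c hc _ => by simpa using hc⟩
  simp only [residualPoly, hd, Finset.sum_range_succ, Finset.sum_range_zero]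
  rw [residualCoeff_eq (k := 1 + 0 * ((3 - 1) / 2)) (by norm_num) (by simpa using h₁),
    residualCoeff_eq (k := 1 + 1 * ((3 - 1) / 2)) (by norm_num) (by simpa using h₂),
    residualCoeff_eq (k := 1 + 2 * ((3 - 1) / 2)) (m := 0) (x := devCoeff F s 3)
      (by norm_num) (by simp)]
  · simp [cubicPoly]
  all_goals (simp only [v₁, v₃]; push_cast; ring)

theorem residualPoly_zero_three {δ : ℕ} {x₀ x₁ x₂ : ℤ} (h : IsCubicAt F s)
    (h₀ : devCoeff F s 0 = 3 ^ (3 * δ) * x₀) (h₁ : devCoeff F s 1 = 3 ^ (2 * δ) * x₁)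
    (h₂ : devCoeff F s 2 = 3 ^ δ * x₂) (hx₀ : ¬ (3 : ℤ) ∣ x₀) :
    residualPoly 3 F s 0 3 = cubicPoly x₀ x₁ x₂ (devCoeff F s 3) := by
  have v₀ := devVal_eq h₀ hx₀
  have v₃ := h.devVal_three
  have hd : sideDegree 3 F s 0 3 = 3 := by
    rw [sideDegree, v₀, v₃, Int.gcd_eq_iff]
    exact ⟨by norm_num, ⟨-δ, by push_cast; ring⟩, fun c hc _ => by simpa using hc⟩
  simp only [residualPoly, hd, Finset.sum_range_succ, Finset.sum_range_zero]
  rw [residualCoeff_eq (k := 0 + 0 * ((3 - 0) / 3)) (by norm_num) (by simpa using h₀),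
    residualCoeff_eq (k := 0 + 1 * ((3 - 0) / 3)) (by norm_num) (by simpa using h₁),
    residualCoeff_eq (k := 0 + 2 * ((3 - 0) / 3)) (by norm_num) (by simpa using h₂),
    residualCoeff_eq (k := 0 + 3 * ((3 - 0) / 3)) (m := 0) (x := devCoeff F s 3)
      (by norm_num) (by simp)]
  · simp [cubicPoly]
  all_goals (simp only [v₀, v₃]; push_cast; ring)

theorem exists_of_le_devVal {k m : ℕ} (h : devCoeff F s k ≠ 0 → (m : ℤ) ≤ devVal 3 F s k) :
    ∃ x : ℤ, devCoeff F s k = 3 ^ m * x := by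
  have := (padicValInt_dvd_iff (p := 3) m (devCoeff F s k)).mpr
    (or_iff_not_imp_left.mpr fun h0 => Int.ofNat_le.mp (h h0))
  exact_mod_cast this

theorem exists_of_devVal {k m : ℕ} (h0 : devCoeff F s k ≠ 0) (h : devVal 3 F s k = m) :
    ∃ x : ℤ, devCoeff F s k = 3 ^ m * x ∧ ¬ (3 : ℤ) ∣ x := by
  have := exists_eq_three_pow_mul h0
  rwa [Int.ofNat_inj.mp h] at this

/-- The sides of negative slope of degree greater than one, with their residual polynomials. -/
theorem side_cases (h : IsCubicAt F s) {i j : ℕ} (hs : IsPrincipalSide 3 F s i j) :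
    sideDegree 3 F s i j = 1 ∨
    (i = 0 ∧ j = 2 ∧ ∃ (m δ : ℕ) (x₀ x₁ x₂ : ℤ), m < δ ∧
      devCoeff F s 0 = 3 ^ (m + 2 * δ) * x₀ ∧ devCoeff F s 1 = 3 ^ (m + δ) * x₁ ∧
      devCoeff F s 2 = 3 ^ m * x₂ ∧ ¬ (3 : ℤ) ∣ x₀ ∧ ¬ (3 : ℤ) ∣ x₂ ∧
      residualPoly 3 F s i j = cubicPoly x₀ x₁ x₂ 0) ∨
    (i = 1 ∧ j = 3 ∧ ∃ (δ : ℕ) (x₀ x₁ x₂ : ℤ),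
      devCoeff F s 0 = 3 ^ (3 * δ + 1) * x₀ ∧ devCoeff F s 1 = 3 ^ (2 * δ) * x₁ ∧
      devCoeff F s 2 = 3 ^ δ * x₂ ∧ ¬ (3 : ℤ) ∣ x₁ ∧
      residualPoly 3 F s i j = cubicPoly x₁ x₂ (devCoeff F s 3) 0) ∨
    (i = 0 ∧ j = 3 ∧ ∃ (δ : ℕ) (x₀ x₁ x₂ : ℤ),
      devCoeff F s 0 = 3 ^ (3 * δ) * x₀ ∧ devCoeff F s 1 = 3 ^ (2 * δ) * x₁ ∧
      devCoeff F s 2 = 3 ^ δ * x₂ ∧ ¬ (3 : ℤ) ∣ x₀ ∧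
      residualPoly 3 F s i j = cubicPoly x₀ x₁ x₂ (devCoeff F s 3)) := by
  have hj := h.le_three hs
  have hij := hs.1.lt
  have hlt := hs.2
  have v₃ := h.devVal_three
  by_cases hd : sideDegree 3 F s i j = 1
  · exact Or.inl hd
  right
  have d₁ : ((sideDegree 3 F s i j : ℕ) : ℤ) ∣ (j : ℤ) - i := Int.gcd_dvd_left ..
  have d₂ : ((sideDegree 3 F s i j : ℕ) : ℤ) ∣ devVal 3 F s j - devVal 3 F s i :=
    Int.gcd_dvd_right ..
  have dvd_len : j - i ≠ 1 ∧ ((j : ℤ) - i) ∣ devVal 3 F s j - devVal 3 F s i := by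
    generalize sideDegree 3 F s i j = d at hd d₁ d₂
    have hd' : d ∣ j - i := by
      rw [← Int.natCast_dvd_natCast, Nat.cast_sub hij.le]; exact d₁
    have hle := Nat.le_of_dvd (by omega) hd'
    have hpos := Nat.pos_of_dvd_of_pos hd' (by omega)
    -- The length is at most 3, so its only divisor other than 1 is itself; hence the slope is an
    -- integer.
    have : d = j - i := by
      have : j - i ≤ 3 := by omega
      interval_cases hji : j - i <;> interval_cases d <;> simp_all
    refine ⟨by omega, ?_⟩
    rwa [this, Nat.cast_sub hij.le] at d₂
  obtain ⟨hne, q, hq⟩ := dvd_len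
  have hcase : i = 0 ∧ j = 2 ∨ i = 1 ∧ j = 3 ∨ i = 0 ∧ j = 3 := by omega
  have hnn : ∀ k, 0 ≤ devVal 3 F s k := fun k => Int.natCast_nonneg _
  rcases hcase with ⟨rfl, rfl⟩ | ⟨rfl, rfl⟩ | ⟨rfl, rfl⟩
  · refine Or.inl ⟨rfl, rfl, ?_⟩
    obtain ⟨m, hm⟩ := Int.eq_ofNat_of_zero_le (hnn 2)
    have hq0 : q < 0 := by push_cast at hq; linarith
    obtain ⟨δ, hδ⟩ := Int.eq_ofNat_of_zero_le (show 0 ≤ -q by omega)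
    have a₁ := hs.1.above 1
    have a₃ := hs.1.strictly_above 3 h.three_ne (Or.inr (by norm_num))
    push_cast at hq a₁ a₃
    obtain ⟨x₀, e₀, hx₀⟩ := exists_of_devVal (m := m + 2 * δ) hs.1.left_ne (by push_cast; linarith)
    obtain ⟨x₂, e₂, hx₂⟩ := exists_of_devVal hs.1.right_ne hm
    obtain ⟨x₁, e₁⟩ := exists_of_le_devVal (k := 1) (m := m + δ)
      (fun h0 => by have := a₁ h0; push_cast; linarith)
    exact ⟨m, δ, x₀, x₁, x₂, by zify; linarith, e₀, e₁, e₂, hx₀, hx₂,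
      residualPoly_zero_two e₀ e₁ e₂ hx₀ hx₂⟩
  · refine Or.inr (Or.inl ⟨rfl, rfl, ?_⟩)
    have hq0 : q < 0 := by push_cast at hq; linarith
    obtain ⟨δ, hδ⟩ := Int.eq_ofNat_of_zero_le (show 0 ≤ -q by omega)
    have a₀ := hs.1.strictly_above 0 h.ne_zero (Or.inl (by norm_num))
    have a₂ := hs.1.above 2
    push_cast at hq a₀ a₂
    obtain ⟨x₁, e₁, hx₁⟩ := exists_of_devVal (m := 2 * δ) hs.1.left_ne (by push_cast; linarith)
    obtain ⟨x₀, e₀⟩ := exists_of_le_devVal (k := 0) (m := 3 * δ + 1)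
      (fun h0 => by push_cast; linarith)
    obtain ⟨x₂, e₂⟩ := exists_of_le_devVal (k := 2) (m := δ)
      (fun h0 => by have := a₂ h0; linarith)
    exact ⟨δ, x₀, x₁, x₂, e₀, e₁, e₂, hx₁, residualPoly_one_three h e₁ e₂ hx₁⟩
  · refine Or.inr (Or.inr ⟨rfl, rfl, ?_⟩)
    have hq0 : q < 0 := by push_cast at hq; linarith
    obtain ⟨δ, hδ⟩ := Int.eq_ofNat_of_zero_le (show 0 ≤ -q by omega)
    have a₁ := hs.1.above 1
    have a₂ := hs.1.above 2
    push_cast at hq a₁ a₂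
    obtain ⟨x₀, e₀, hx₀⟩ := exists_of_devVal (m := 3 * δ) hs.1.left_ne (by push_cast; linarith)
    obtain ⟨x₁, e₁⟩ := exists_of_le_devVal (k := 1) (m := 2 * δ)
      (fun h0 => by have := a₁ h0; push_cast; linarith)
    obtain ⟨x₂, e₂⟩ := exists_of_le_devVal (k := 2) (m := δ)
      (fun h0 => by have := a₂ h0; linarith)
    exact ⟨δ, x₀, x₁, x₂, e₀, e₁, e₂, hx₀, residualPoly_zero_three h e₀ e₁ e₂ hx₀⟩

end IsCubicAt

/-- The integral parts of the ordinates of the points of abscissas `1` and `2` of the principal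
polygon are `ν₁` and `ν₂`. -/
def PolygonFloors (F : ℤ[X]) (s : ℤ) (ν₁ ν₂ : ℕ) : Prop :=
  ∃ y₁ y₂ : ℚ, OnPrincipalPolygon 3 F s 1 y₁ ∧ OnPrincipalPolygon 3 F s 2 y₂ ∧
    ⌊y₁⌋ = (ν₁ : ℤ) ∧ ⌊y₂⌋ = (ν₂ : ℤ)

theorem floor_ratCast_div {n d q : ℕ} (h : n / d = q) : ⌊(n : ℚ) / d⌋ = (q : ℤ) := by
  rw [Rat.floor_natCast_div_natCast, ← h, Int.natCast_div]

theorem not_three_dvd_of_devVal_lt {x y : ℤ} {m n : ℕ} (h : (3 : ℤ) ^ n * x = 3 ^ m * y)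
    (hlt : m < n) : (3 : ℤ) ∣ y := by
  obtain ⟨k, rfl⟩ := Nat.exists_eq_add_of_lt hlt
  refine ⟨3 ^ k * x, ?_⟩
  have h3 : (3 : ℤ) ^ m ≠ 0 := by positivity
  apply mul_left_cancel₀ h3
  rw [← h]; ring

/-- The working tool for comparing exponents: two factorizations of the same coefficient are
confronted, without naming its valuation. -/
theorem le_of_three_pow_mul_eq {x y : ℤ} {m n : ℕ} (h : (3 : ℤ) ^ n * x = 3 ^ m * y)
    (hy : ¬ (3 : ℤ) ∣ y) : n ≤ m := by
  by_contra! hlt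
  exact hy (not_three_dvd_of_devVal_lt h hlt)

namespace IsCubicAt

/-- The case of a vertex at the abscissa `1`. -/
theorem regular_of_vertex_one (h : IsCubicAt F s) {u₀ u₁ : ℕ} {x₀ x₁ x₂ : ℤ}
    (h₀ : devCoeff F s 0 = 3 ^ u₀ * x₀) (h₁ : devCoeff F s 1 = 3 ^ u₁ * x₁)
    (hx₁ : ¬ (3 : ℤ) ∣ x₁) (h₂ : devCoeff F s 2 = 3 ^ (u₁ / 2 + 1) * x₂)
    (hu : 3 * u₁ ≤ 2 * u₀) : IsRegularAt 3 F s := by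
  intro i j hs
  have h3 := zmod_three_ne_zero.mpr h.three
  rcases h.side_cases hs with hd | ⟨rfl, rfl, m, δ, y₀, y₁, y₂, hmδ, e₀, e₁, e₂, hy₀, hy₂, hr⟩ |
    ⟨rfl, rfl, δ, y₀, y₁, y₂, e₀, e₁, e₂, hy₁, hr⟩ | ⟨rfl, rfl, δ, y₀, y₁, y₂, e₀, e₁, e₂, hy₀, hr⟩
  · exact residualPoly_separable_of_sideDegree_eq_one hs hd
  -- A vertex at (2, m) with m < δ would put (1, u₁) strictly below the line once a₂ is as divisible
  -- as assumed.
  · exfalso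
    have l₀ := le_of_three_pow_mul_eq (h₀.symm.trans e₀) hy₀
    have l₁ := le_of_three_pow_mul_eq (e₁.symm.trans h₁) hx₁
    have l₂ := le_of_three_pow_mul_eq (h₂.symm.trans e₂) hy₂
    omega
  · have l₁ := le_of_three_pow_mul_eq (e₁.symm.trans h₁) hx₁
    have l₁' := le_of_three_pow_mul_eq (h₁.symm.trans e₁) hy₁
    have d₂ := zmod_three_eq_zero.mpr (not_three_dvd_of_devVal_lt (h₂.symm.trans e₂) (by omega))
    have d₁ := zmod_three_ne_zero.mpr hy₁
    -- The middle coefficient vanishes, leaving x₁ + a₃y² with both coefficients nonzero.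
    rw [hr, separable_cubicPoly_iff (Or.inl h3), d₂]
    simp [h3, d₁]
  · have l₁ := le_of_three_pow_mul_eq (e₁.symm.trans h₁) hx₁
    have l₀ := le_of_three_pow_mul_eq (h₀.symm.trans e₀) hy₀
    have d₂ := zmod_three_eq_zero.mpr (not_three_dvd_of_devVal_lt (h₂.symm.trans e₂) (by omega))
    have hu₁ : u₁ = 2 * δ := by omega
    have hy₁ : ¬ (3 : ℤ) ∣ y₁ := by
      intro hd
      obtain ⟨z, rfl⟩ := hd
      have := le_of_three_pow_mul_eq (n := 2 * δ + 1) (x := z)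
        (by rw [← h₁, e₁]; ring) hx₁
      omega
    have d₁ := zmod_three_ne_zero.mpr hy₁
    -- Here the quadratic term vanishes and the derivative is the nonzero constant x₁.
    rw [hr, separable_cubicPoly_iff (Or.inr h3), d₂]
    simp [h3, d₁]

theorem polygonFloors_of_vertex_one (h : IsCubicAt F s) {u₀ u₁ : ℕ} {x₀ x₁ x₂ : ℤ}
    (h₀ : devCoeff F s 0 = 3 ^ u₀ * x₀) (h₁ : devCoeff F s 1 = 3 ^ u₁ * x₁)
    (hx₁ : ¬ (3 : ℤ) ∣ x₁) (h₂ : devCoeff F s 2 = 3 ^ (u₁ / 2 + 1) * x₂)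
    (hu : 3 * u₁ ≤ 2 * u₀) : PolygonFloors F s u₁ (u₁ / 2) := by
  have v₃ := h.devVal_three
  have v₁ := devVal_eq h₁ hx₁
  have v₀ := le_devVal ⟨x₀, h₀⟩ h.ne_zero
  have v₂ := le_devVal ⟨x₂, h₂⟩
  have n₁ : devCoeff F s 1 ≠ 0 := by
    intro h0
    rw [h0, eq_comm, mul_eq_zero] at h₁
    rcases h₁ with h₁ | rfl
    · exact absurd h₁ (by positivity)
    · exact hx₁ (_root_.dvd_zero 3)
  have hu₁ : 0 < u₁ := by
    rcases Nat.eq_zero_or_pos u₁ with rfl | hpos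
    · exact absurd h.dvd_one (by rw [h₁]; simpa using hx₁)
    · exact hpos
  have hdiv : (u₁ : ℤ) < 2 * (u₁ / 2 + 1 : ℕ) := by push_cast; omega
  have f₂ := floor_ratCast_div (n := u₁) (d := 2) rfl
  -- Either (1, u₁) is a vertex, or it lies in the interior of a single side from 0 to 3; the
  -- ordinates over 1 and 2 are the same.
  rcases lt_or_ge (3 * devVal 3 F s 1) (2 * devVal 3 F s 0) with hlt | hge
  · have hside : IsPrincipalSide 3 F s 1 3 := by
      refine h.isPrincipalSide (by norm_num) le_rfl n₁ h.three_ne (by rw [v₁, v₃]; exact_mod_cast hu₁)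
        ?_ ?_
      · intro k hk hk' hk0
        obtain rfl : k = 2 := by omega
        have := v₂ hk0
        push_cast at *; linarith
      · intro k hk hk' hk0
        obtain rfl : k = 0 := by omega
        push_cast; linarith
    refine ⟨u₁, (u₁ : ℚ) / (2 : ℕ), ⟨1, 3, hside, by norm_num, by norm_num, ?_⟩,
      ⟨1, 3, hside, by norm_num, by norm_num, ?_⟩, Int.floor_natCast _, f₂⟩ <;>
    · rw [v₁, v₃]; push_cast; ring
  · have hu₀ : devVal 3 F s 0 = u₀ ∧ 3 * u₁ = 2 * u₀ := by zify at hu ⊢; omega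
    obtain ⟨v₀', huu⟩ := hu₀
    have hside : IsPrincipalSide 3 F s 0 3 := by
      refine h.isPrincipalSide (by norm_num) le_rfl h.ne_zero h.three_ne
        (by rw [v₀', v₃]; omega) ?_ (by omega)
      intro k hk hk' hk0
      have : k = 1 ∨ k = 2 := by omega
      rcases this with rfl | rfl
      · rw [v₀', v₁, v₃]; push_cast; linarith
      · have := v₂ hk0
        rw [v₀', v₃]; push_cast at *; linarith
    have huu' : (3 : ℚ) * u₁ = 2 * u₀ := by exact_mod_cast huu
    refine ⟨u₁, (u₁ : ℚ) / (2 : ℕ), ⟨0, 3, hside, by norm_num, by norm_num, ?_⟩,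
      ⟨0, 3, hside, by norm_num, by norm_num, ?_⟩, Int.floor_natCast _, f₂⟩ <;>
    · rw [v₀', v₃]; push_cast; linarith

theorem isPrincipalSide_zero_three (h : IsCubicAt F s) {u₀ : ℕ} {x₀ x₁ x₂ : ℤ}
    (h₀ : devCoeff F s 0 = 3 ^ u₀ * x₀) (hx₀ : ¬ (3 : ℤ) ∣ x₀)
    (h₁ : devCoeff F s 1 = 3 ^ (2 * u₀ / 3 + 1) * x₁)
    (h₂ : devCoeff F s 2 = 3 ^ (u₀ / 3 + 1) * x₂) : IsPrincipalSide 3 F s 0 3 := by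
  have v₃ := h.devVal_three
  have v₀ := devVal_eq h₀ hx₀
  have v₁ := le_devVal ⟨x₁, h₁⟩
  have v₂ := le_devVal ⟨x₂, h₂⟩
  have hu₀ : 0 < u₀ := by
    rcases Nat.eq_zero_or_pos u₀ with rfl | hpos
    · exact absurd h.dvd_zero (by rw [h₀]; simpa using hx₀)
    · exact hpos
  refine h.isPrincipalSide (by norm_num) le_rfl h.ne_zero h.three_ne
    (by rw [v₀, v₃]; omega) ?_ (by omega)
  intro k hk hk' hk0
  have : k = 1 ∨ k = 2 := by omega
  rcases this with rfl | rfl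
  · have := v₁ hk0
    rw [v₀, v₃]; push_cast at *; omega
  · have := v₂ hk0
    rw [v₀, v₃]; push_cast at *; omega

theorem polygonFloors_of_one_side (h : IsCubicAt F s) {u₀ : ℕ} {x₀ x₁ x₂ : ℤ}
    (h₀ : devCoeff F s 0 = 3 ^ u₀ * x₀) (hx₀ : ¬ (3 : ℤ) ∣ x₀)
    (h₁ : devCoeff F s 1 = 3 ^ (2 * u₀ / 3 + 1) * x₁)
    (h₂ : devCoeff F s 2 = 3 ^ (u₀ / 3 + 1) * x₂) : PolygonFloors F s (2 * u₀ / 3) (u₀ / 3) := by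
  have hside := h.isPrincipalSide_zero_three h₀ hx₀ h₁ h₂
  refine ⟨((2 * u₀ : ℕ) : ℚ) / (3 : ℕ), (u₀ : ℚ) / (3 : ℕ), ⟨0, 3, hside, by norm_num, by norm_num, ?_⟩,
    ⟨0, 3, hside, by norm_num, by norm_num, ?_⟩, floor_ratCast_div rfl,
    floor_ratCast_div rfl⟩ <;>
  · rw [devVal_eq h₀ hx₀, h.devVal_three]; push_cast; ring

/-- The only side runs from 0 to 3 and its height is prime to 3, so its degree is one. -/
theorem regular_of_one_side (h : IsCubicAt F s) {u₀ : ℕ} {x₀ x₁ x₂ : ℤ}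
    (h₀ : devCoeff F s 0 = 3 ^ u₀ * x₀) (hx₀ : ¬ (3 : ℤ) ∣ x₀)
    (h₁ : devCoeff F s 1 = 3 ^ (2 * u₀ / 3 + 1) * x₁)
    (h₂ : devCoeff F s 2 = 3 ^ (u₀ / 3 + 1) * x₂) (hu : ¬ 3 ∣ u₀) : IsRegularAt 3 F s := by
  intro i j hs
  rcases h.side_cases hs with hd | ⟨rfl, rfl, m, δ, y₀, y₁, y₂, hmδ, e₀, e₁, e₂, hy₀, hy₂, hr⟩ |
    ⟨rfl, rfl, δ, y₀, y₁, y₂, e₀, e₁, e₂, hy₁, hr⟩ | ⟨rfl, rfl, δ, y₀, y₁, y₂, e₀, e₁, e₂, hy₀, hr⟩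
  · exact residualPoly_separable_of_sideDegree_eq_one hs hd
  · have l₀ := le_of_three_pow_mul_eq (e₀.symm.trans h₀) hx₀
    have l₂ := le_of_three_pow_mul_eq (h₂.symm.trans e₂) hy₂
    omega
  · have l₀ := le_of_three_pow_mul_eq (e₀.symm.trans h₀) hx₀
    have l₁ := le_of_three_pow_mul_eq (h₁.symm.trans e₁) hy₁
    omega
  · have l₀ := le_of_three_pow_mul_eq (e₀.symm.trans h₀) hx₀
    have l₀' := le_of_three_pow_mul_eq (h₀.symm.trans e₀) hy₀
    omega

/-- The residual polynomial is x₀ + a₃y³, a cube in characteristic 3. -/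
theorem not_regular_of_one_side (h : IsCubicAt F s) {δ : ℕ} {x₀ x₁ x₂ : ℤ}
    (h₀ : devCoeff F s 0 = 3 ^ (3 * δ) * x₀) (hx₀ : ¬ (3 : ℤ) ∣ x₀)
    (h₁ : devCoeff F s 1 = 3 ^ (2 * δ + 1) * x₁) (h₂ : devCoeff F s 2 = 3 ^ (δ + 1) * x₂) :
    ¬ IsRegularAt 3 F s := by
  intro hreg
  have hside := h.isPrincipalSide_zero_three h₀ hx₀ (x₁ := x₁) (x₂ := x₂)
    (by rw [h₁]; congr 2; omega) (by rw [h₂]; congr 2; omega)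
  have hsep := hreg 0 3 hside
  rw [h.residualPoly_zero_three h₀ (x₁ := 3 * x₁) (x₂ := 3 * x₂) (by rw [h₁]; ring)
    (by rw [h₂]; ring) hx₀, separable_cubicPoly_iff (Or.inr (zmod_three_ne_zero.mpr h.three))] at hsep
  apply hsep
  push_cast
  rw [show (3 : ZMod 3) = 0 from rfl]
  ring

end IsCubicAt

end NewtonPolygon

/-! ### The development of the quartic polynomial -/

theorem taylor_quartic (a b c s : ℤ) : taylor s (quartic a b c) =
    X ^ 4 + C (4 * s) * X ^ 3 + C (6 * s ^ 2 + a) * X ^ 2 + C (4 * s ^ 3 + 2 * a * s + b) * X +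
      C (s ^ 4 + a * s ^ 2 + b * s + c) := by
  simp only [quartic, taylor_apply, add_comp, mul_comp, pow_comp, X_comp, C_comp, C_add, C_mul,
    C_pow, map_ofNat]
  ring

theorem devCoeff_quartic (a b c s : ℤ) (k : ℕ) : devCoeff (quartic a b c) s k =
    (if k = 4 then 1 else 0) + (if k = 3 then 4 * s else 0) + (if k = 2 then 6 * s ^ 2 + a else 0) +
      (if k = 1 then 4 * s ^ 3 + 2 * a * s + b else 0) +
      (if k = 0 then s ^ 4 + a * s ^ 2 + b * s + c else 0) := by
  rw [devCoeff, taylor_quartic]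
  simp only [coeff_add, coeff_C_mul, coeff_X_pow, coeff_C, coeff_X, mul_ite, mul_one, mul_zero,
    eq_comm (a := 1) (b := k)]

theorem devCoeff_quartic_zero (a b c s : ℤ) :
    devCoeff (quartic a b c) s 0 = s ^ 4 + a * s ^ 2 + b * s + c := by
  simp [devCoeff_quartic]

theorem devCoeff_quartic_one (a b c s : ℤ) :
    devCoeff (quartic a b c) s 1 = 4 * s ^ 3 + 2 * a * s + b := by
  simp [devCoeff_quartic]

theorem devCoeff_quartic_two (a b c s : ℤ) :
    devCoeff (quartic a b c) s 2 = 6 * s ^ 2 + a := by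
  simp [devCoeff_quartic]

theorem devCoeff_quartic_three (a b c s : ℤ) : devCoeff (quartic a b c) s 3 = 4 * s := by
  simp [devCoeff_quartic]

theorem devCoeff_quartic_four (a b c s : ℤ) : devCoeff (quartic a b c) s 4 = 1 := by
  simp [devCoeff_quartic]

theorem devCoeff_quartic_high (a b c s : ℤ) (k : ℕ) (hk : 4 < k) :
    devCoeff (quartic a b c) s k = 0 := by
  rw [devCoeff_quartic, if_neg, if_neg, if_neg, if_neg, if_neg] <;> omega

theorem devCoeff_shift_zero (a b c s h : ℤ) : devCoeff (quartic a b c) (s + h) 0 =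
    devCoeff (quartic a b c) s 0 + devCoeff (quartic a b c) s 1 * h +
      devCoeff (quartic a b c) s 2 * h ^ 2 + devCoeff (quartic a b c) s 3 * h ^ 3 + h ^ 4 := by
  simp only [devCoeff_quartic_zero, devCoeff_quartic_one, devCoeff_quartic_two,
    devCoeff_quartic_three]
  ring

theorem devCoeff_shift_one (a b c s h : ℤ) : devCoeff (quartic a b c) (s + h) 1 =
    devCoeff (quartic a b c) s 1 + 2 * devCoeff (quartic a b c) s 2 * h +
      3 * devCoeff (quartic a b c) s 3 * h ^ 2 + 4 * h ^ 3 := by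
  simp only [devCoeff_quartic_one, devCoeff_quartic_two, devCoeff_quartic_three]
  ring

theorem devCoeff_shift_two (a b c s h : ℤ) : devCoeff (quartic a b c) (s + h) 2 =
    devCoeff (quartic a b c) s 2 + 3 * devCoeff (quartic a b c) s 3 * h + 6 * h ^ 2 := by
  simp only [devCoeff_quartic_two, devCoeff_quartic_three]
  ring

theorem devCoeff_shift_three (a b c s h : ℤ) : devCoeff (quartic a b c) (s + h) 3 =
    devCoeff (quartic a b c) s 3 + 4 * h := by
  simp only [devCoeff_quartic_three]
  ring

/-! ### The discriminant in terms of the development -/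

/-- The terms of the discriminant of `X ^ 4 + b X ^ 3 + c X ^ 2 + d X + e` that do not contribute to
the discriminant of `b X ^ 3 + c X ^ 2 + d X + e` modulo `3`. -/
def discRest (e d c b : ℤ) : ℤ :=
  256 * e ^ 3 - 192 * b * d * e ^ 2 - 128 * c ^ 2 * e ^ 2 + 144 * c * d ^ 2 * e - 27 * d ^ 4 +
    144 * b ^ 2 * c * e ^ 2 - 6 * b ^ 2 * d ^ 2 * e - 80 * b * c ^ 2 * d * e + 18 * b * c * d ^ 3 +
    16 * c ^ 4 * e - 4 * c ^ 3 * d ^ 2 - 27 * b ^ 4 * e ^ 2 + 18 * b ^ 3 * c * d * e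

/-- The discriminant of `X ^ 4 + b X ^ 3 + c X ^ 2 + d X + e`. -/
def discPoly (e d c b : ℤ) : ℤ :=
  discRest e d c b + (b ^ 2 * c ^ 2 * d ^ 2 - 4 * b ^ 2 * c ^ 3 * e - 4 * b ^ 3 * d ^ 3)

/-- One inequality per monomial; the added constants 1, 2, 3 are the powers of 3 in the numerical
coefficients 192, 144, 27, 6 and 18. -/
theorem pow_dvd_discRest {e₀ e₁ e₂ N : ℕ} (e d c b : ℤ)
    (h₁ : N ≤ 3 * e₀) (h₂ : N ≤ 1 + e₁ + 2 * e₀) (h₃ : N ≤ 2 * e₂ + 2 * e₀)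
    (h₄ : N ≤ 2 + e₂ + 2 * e₁ + e₀) (h₅ : N ≤ 3 + 4 * e₁) (h₆ : N ≤ 2 + e₂ + 2 * e₀)
    (h₇ : N ≤ 1 + 2 * e₁ + e₀) (h₈ : N ≤ 2 * e₂ + e₁ + e₀) (h₉ : N ≤ 2 + e₂ + 3 * e₁)
    (h₁₀ : N ≤ 4 * e₂ + e₀) (h₁₁ : N ≤ 3 * e₂ + 2 * e₁) (h₁₂ : N ≤ 3 + 2 * e₀)
    (h₁₃ : N ≤ 2 + e₂ + e₁ + e₀) :
    (3 : ℤ) ^ N ∣ discRest (3 ^ e₀ * e) (3 ^ e₁ * d) (3 ^ e₂ * c) b := by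
  have key : ∀ {M : ℕ} (z : ℤ), N ≤ M → (3 : ℤ) ^ N ∣ 3 ^ M * z := fun z hM =>
    (pow_dvd_pow 3 hM).mul_right z
  have := dvd_add (dvd_sub (dvd_sub (dvd_add (dvd_add (dvd_sub (dvd_sub (dvd_add (dvd_sub (dvd_add
    (dvd_sub (dvd_sub (key (256 * e ^ 3) h₁) (key (64 * b * d * e ^ 2) h₂))
    (key (128 * c ^ 2 * e ^ 2) h₃)) (key (16 * c * d ^ 2 * e) h₄)) (key (d ^ 4) h₅))
    (key (16 * b ^ 2 * c * e ^ 2) h₆)) (key (2 * b ^ 2 * d ^ 2 * e) h₇))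
    (key (80 * b * c ^ 2 * d * e) h₈)) (key (2 * b * c * d ^ 3) h₉)) (key (16 * c ^ 4 * e) h₁₀))
    (key (4 * c ^ 3 * d ^ 2) h₁₁)) (key (b ^ 4 * e ^ 2) h₁₂)) (key (2 * b ^ 3 * c * d * e) h₁₃)
  refine this.trans (dvd_of_eq ?_)
  rw [discRest]
  ring

/-- Translation invariance of the discriminant, which lets it be computed from the development at
any integer. -/
theorem discPoly_quartic (a b c s : ℤ) :
    discPoly (devCoeff (quartic a b c) s 0) (devCoeff (quartic a b c) s 1)
      (devCoeff (quartic a b c) s 2) (devCoeff (quartic a b c) s 3) = discPoly c b a 0 := by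
  simp only [devCoeff_quartic_zero, devCoeff_quartic_one, devCoeff_quartic_two,
    devCoeff_quartic_three, discPoly, discRest]
  ring

/-! ### Integers at which the polygon has a vertex, or an interior lattice point, `(2, n)` -/

/-- The point `(2, n)` belongs to the polygon at `s`, and the polygon lies above the line of slope
`-n` through it; the parameter `m` measures how far above the left part is. -/
structure IsDoubleAt (a b c s : ℤ) (n m : ℕ) : Prop where
  cubic : IsCubicAt (quartic a b c) s
  pos : 0 < n
  zero : (3 : ℤ) ^ (3 * n + m) ∣ devCoeff (quartic a b c) s 0
  one : (3 : ℤ) ^ ((4 * n + m + 1) / 2) ∣ devCoeff (quartic a b c) s 1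
  two : ∃ x : ℤ, devCoeff (quartic a b c) s 2 = 3 ^ n * x ∧ ¬ (3 : ℤ) ∣ x

/-- An inseparable residual polynomial belongs to a side of integer slope and has a multiple root in
𝔽_3, so the iteration cannot get stuck. -/
theorem exists_iterStep_of_not_regular {F : ℤ[X]} {s : ℤ} (h : IsCubicAt F s)
    (hs : ¬ IsRegularAt 3 F s) : ∃ t, IterStep 3 F s t := by
  simp only [IsRegularAt, not_forall] at hs
  obtain ⟨i, j, hside, hsep⟩ := hs
  have key : ∀ (δ : ℕ) (x₀ x₁ x₂ x₃ : ZMod 3), (x₂ ≠ 0 ∨ x₃ ≠ 0) →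
      residualPoly 3 F s i j = cubicPoly x₀ x₁ x₂ x₃ →
      devVal 3 F s i - devVal 3 F s j = (δ : ℤ) * ((j : ℤ) - i) → ∃ t, IterStep 3 F s t := by
    intro δ x₀ x₁ x₂ x₃ hx hr hδ
    have hd := (not_iff_not.mpr (separable_cubicPoly_iff hx)).mp (hr ▸ hsep)
    obtain ⟨y, hy₀, hy₁⟩ := exists_common_root_of_disc_eq_zero x₀ x₁ x₂ x₃ hx (not_not.mp hd)
    obtain ⟨y, rfl⟩ := ZMod.intCast_surjective y
    exact ⟨_, i, j, δ, y, hside, hsep, hδ, hr ▸ sq_dvd_cubicPoly hy₀ hy₁, rfl⟩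
  have h3 := zmod_three_ne_zero.mpr h.three
  rcases h.side_cases hside with hd |
    ⟨rfl, rfl, m, δ, y₀, y₁, y₂, hmδ, e₀, e₁, e₂, hy₀, hy₂, hr⟩ |
    ⟨rfl, rfl, δ, y₀, y₁, y₂, e₀, e₁, e₂, hy₁, hr⟩ | ⟨rfl, rfl, δ, y₀, y₁, y₂, e₀, e₁, e₂, hy₀, hr⟩
  · exact absurd (residualPoly_separable_of_sideDegree_eq_one hside hd) hsep
  · refine key δ _ _ _ _ (Or.inl (zmod_three_ne_zero.mpr hy₂)) hr ?_
    rw [devVal_eq e₀ hy₀, devVal_eq e₂ hy₂]; push_cast; ring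
  · refine key δ _ _ _ _ (Or.inl h3) hr ?_
    rw [devVal_eq e₁ hy₁, h.devVal_three]; push_cast; ring
  · refine key δ _ _ _ _ (Or.inr h3) hr ?_
    rw [devVal_eq e₀ hy₀, h.devVal_three]; push_cast; ring

theorem not_iterStep_of_regular {F : ℤ[X]} {s t : ℤ} (h : IsRegularAt 3 F s) :
    ¬ IterStep 3 F s t := by
  rintro ⟨i, j, δ, y, hs, hsep, -⟩
  exact hsep (h i j hs)

namespace IsDoubleAt

variable {a b c s t : ℤ} {n m : ℕ}

/-- The shift changes a₂ by 3a₃h + 6h² with h divisible by 3^n. This is zero modulo 3^(n+1), so the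
exact value n of v₃(a₂) is preserved. -/
theorem of_shift {δ : ℕ} {y : ℤ} (h : IsDoubleAt a b c s n m) (ht : t = s + y * 3 ^ δ)
    (hne : devCoeff (quartic a b c) t 0 ≠ 0) (hδ : n ≤ δ) {m' : ℕ}
    (h₀ : (3 : ℤ) ^ (3 * n + m') ∣ devCoeff (quartic a b c) t 0)
    (h₁ : (3 : ℤ) ^ ((4 * n + m' + 1) / 2) ∣ devCoeff (quartic a b c) t 1) :
    IsDoubleAt a b c t n m' := by
  obtain ⟨hc, hn, z₀, z₁, x₂, e₂, hx₂⟩ := h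
  obtain ⟨d, rfl⟩ := Nat.exists_eq_add_of_le hδ
  have h2 : devCoeff (quartic a b c) t 2 = 3 ^ n *
      (x₂ + 3 * (devCoeff (quartic a b c) s 3 * y * 3 ^ d + 2 * y ^ 2 * 3 ^ (n + 2 * d))) := by
    rw [ht, devCoeff_shift_two, e₂]; ring
  refine ⟨⟨devCoeff_quartic_four .., devCoeff_quartic_high a b c t, ?_, hne, ?_, ?_, ?_⟩, hn, h₀, h₁,
    _, h2, ?_⟩
  · rw [ht, devCoeff_shift_three]
    intro hd
    apply hc.three
    have : (3 : ℤ) ∣ 4 * (y * 3 ^ (n + d)) :=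
      ((dvd_pow_self 3 (by omega)).mul_left y).mul_left 4
    exact (dvd_add_left this).mp hd
  · exact (dvd_pow_self 3 (by omega)).trans h₀
  · exact (dvd_pow_self 3 (by omega)).trans h₁
  · rw [h2]
    exact (dvd_pow_self 3 (by omega)).mul_right _
  · intro hd
    exact hx₂ ((dvd_add_left (dvd_mul_right 3 _)).mp hd)

/-- Up to higher powers of 3, the new a₀ and a₁ are, after scaling, the relevant residual polynomial
and its derivative at y. A double root makes both vanish, which gains one factor 3 in each. The
exponent for a₁ in `IsDoubleAt` is the height over 1 of the segment from (0, 3n+m) to (2, n),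
rounded up, and one gain is enough for m + 1. -/
theorem of_iterStep (h : IsDoubleAt a b c s n m) (hne : devCoeff (quartic a b c) t 0 ≠ 0)
    (hst : IterStep 3 (quartic a b c) s t) : IsDoubleAt a b c t n (m + 1) := by
  have hc := h.cubic
  obtain ⟨w₀, hw₀⟩ := h.zero
  obtain ⟨w₁, hw₁⟩ := h.one
  obtain ⟨w₂, hw₂, hw₂'⟩ := h.two
  obtain ⟨i, j, δ, y, hside, hsep, hδ, hdvd, ht⟩ := hst
  rcases hc.side_cases hside with hd |
    ⟨rfl, rfl, m', δ', x₀, x₁, x₂, hmδ, e₀, e₁, e₂, hx₀, hx₂, hr⟩ |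
    ⟨rfl, rfl, δ', x₀, x₁, x₂, e₀, e₁, e₂, hx₁, hr⟩ | ⟨rfl, rfl, δ', x₀, x₁, x₂, e₀, e₁, e₂, hx₀, hr⟩
  · exact absurd (residualPoly_separable_of_sideDegree_eq_one hside hd) hsep
  · have hmn : m' = n := le_antisymm (le_of_three_pow_mul_eq (e₂.symm.trans hw₂) hw₂')
      (le_of_three_pow_mul_eq (hw₂.symm.trans e₂) hx₂)
    subst hmn
    have l₀ := le_of_three_pow_mul_eq (hw₀.symm.trans e₀) hx₀
    have hδ' : δ' = δ := by
      rw [devVal_eq e₀ hx₀, devVal_eq e₂ hx₂] at hδ; push_cast at hδ; omega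
    subst hδ'
    rw [hr] at hdvd
    obtain ⟨r₀, r₁⟩ := eval_eq_zero_of_sq_dvd_cubicPoly hdvd
    obtain ⟨d, rfl⟩ := Nat.exists_eq_add_of_lt hmδ
    have q₀ : (3 : ℤ) ∣ x₀ + x₁ * y + x₂ * y ^ 2 := by
      rw [← zmod_three_eq_zero]; push_cast; linear_combination r₀
    have q₁ : (3 : ℤ) ∣ x₁ + 2 * x₂ * y := by
      rw [← zmod_three_eq_zero]; push_cast; linear_combination r₁
    obtain ⟨k₀, hk₀⟩ := q₀
    obtain ⟨k₁, hk₁⟩ := q₁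
    refine h.of_shift (y := y) ht hne (by omega) ?_ ?_
    · rw [ht, devCoeff_shift_zero, e₀, e₁, e₂]
      refine (pow_dvd_pow 3 (show 3 * m' + (m + 1) ≤ m' + 2 * (m' + d + 1) + 1 by omega)).trans
        ⟨k₀ + 3 ^ d * (devCoeff (quartic a b c) s 3 * y ^ 3) + 3 ^ (m' + 2 * d + 1) * y ^ 4, ?_⟩
      linear_combination 3 ^ (m' + 2 * (m' + d + 1)) * hk₀
    · rw [ht, devCoeff_shift_one, e₁, e₂]
      refine (pow_dvd_pow 3 (show (4 * m' + (m + 1) + 1) / 2 ≤ m' + (m' + d + 1) + 1 by omega)).trans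
        ⟨k₁ + 3 ^ (d + 1) * devCoeff (quartic a b c) s 3 * y ^ 2 +
          4 * y ^ 3 * 3 ^ (m' + 2 * d + 1), ?_⟩
      linear_combination 3 ^ (m' + (m' + d + 1)) * hk₁
  · have l₂ := le_of_three_pow_mul_eq (e₂.symm.trans hw₂) hw₂'
    have l₁ := le_of_three_pow_mul_eq (hw₁.symm.trans e₁) hx₁
    have hδ' : δ' = δ := by
      rw [devVal_eq e₁ hx₁, hc.devVal_three] at hδ; push_cast at hδ; omega
    -- The line of slope -n through (2, n) bounds the polygon from below, so a side ending at (3, 0)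
    -- has slope -n; this happens only for m = 0.
    have hδn : δ' = n := by omega
    subst hδ' hδn
    rw [hr] at hdvd
    obtain ⟨r₀, r₁⟩ := eval_eq_zero_of_sq_dvd_cubicPoly hdvd
    -- The point over 0 is above the side, so the cubic seen by the shift is y times the residual
    -- quadratic; its derivative vanishes too at a double root.
    have q₀ : (3 : ℤ) ∣ x₁ * y + x₂ * y ^ 2 + devCoeff (quartic a b c) s 3 * y ^ 3 := by
      rw [← zmod_three_eq_zero]; push_cast; linear_combination y * r₀
    have q₁ : (3 : ℤ) ∣ x₁ + 2 * x₂ * y + 3 * devCoeff (quartic a b c) s 3 * y ^ 2 := by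
      rw [← zmod_three_eq_zero]; push_cast; linear_combination r₀ + y * r₁
    obtain ⟨k₀, hk₀⟩ := q₀
    obtain ⟨k₁, hk₁⟩ := q₁
    -- A positive slope exponent is what makes the terms h⁴ and 4h³ of the shift negligible.
    obtain ⟨d, rfl⟩ : ∃ d, δ' = d + 1 := ⟨δ' - 1, by have := h.pos; omega⟩
    refine h.of_shift (y := y) ht hne le_rfl ?_ ?_
    · rw [ht, devCoeff_shift_zero, e₀, e₁, e₂]
      refine (pow_dvd_pow 3 (show 3 * (d + 1) + (m + 1) ≤ 3 * (d + 1) + 1 by omega)).trans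
        ⟨x₀ + k₀ + 3 ^ d * y ^ 4, ?_⟩
      linear_combination 3 ^ (3 * (d + 1)) * hk₀
    · rw [ht, devCoeff_shift_one, e₁, e₂]
      refine (pow_dvd_pow 3 (show (4 * (d + 1) + (m + 1) + 1) / 2 ≤ 2 * (d + 1) + 1 by omega)).trans
        ⟨k₁ + 3 ^ d * 4 * y ^ 3, ?_⟩
      linear_combination 3 ^ (2 * (d + 1)) * hk₁
  · have l₂ := le_of_three_pow_mul_eq (e₂.symm.trans hw₂) hw₂'
    have l₀ := le_of_three_pow_mul_eq (hw₀.symm.trans e₀) hx₀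
    have hδ' : δ' = δ := by
      rw [devVal_eq e₀ hx₀, hc.devVal_three] at hδ; push_cast at hδ; omega
    have hδn : δ' = n := by omega
    subst hδ' hδn
    rw [hr] at hdvd
    obtain ⟨r₀, r₁⟩ := eval_eq_zero_of_sq_dvd_cubicPoly hdvd
    have q₀ : (3 : ℤ) ∣ x₀ + x₁ * y + x₂ * y ^ 2 + devCoeff (quartic a b c) s 3 * y ^ 3 := by
      rw [← zmod_three_eq_zero]; push_cast; linear_combination r₀
    have q₁ : (3 : ℤ) ∣ x₁ + 2 * x₂ * y := by
      rw [← zmod_three_eq_zero]; push_cast; linear_combination r₁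
    obtain ⟨k₀, hk₀⟩ := q₀
    obtain ⟨k₁, hk₁⟩ := q₁
    obtain ⟨d, rfl⟩ : ∃ d, δ' = d + 1 := ⟨δ' - 1, by have := h.pos; omega⟩
    refine h.of_shift (y := y) ht hne le_rfl ?_ ?_
    · rw [ht, devCoeff_shift_zero, e₀, e₁, e₂]
      refine (pow_dvd_pow 3 (show 3 * (d + 1) + (m + 1) ≤ 3 * (d + 1) + 1 by omega)).trans
        ⟨k₀ + 3 ^ d * y ^ 4, ?_⟩
      linear_combination 3 ^ (3 * (d + 1)) * hk₀
    · rw [ht, devCoeff_shift_one, e₁, e₂]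
      refine (pow_dvd_pow 3 (show (4 * (d + 1) + (m + 1) + 1) / 2 ≤ 2 * (d + 1) + 1 by omega)).trans
        ⟨k₁ + devCoeff (quartic a b c) s 3 * y ^ 2 + 3 ^ d * 4 * y ^ 3, ?_⟩
      linear_combination 3 ^ (2 * (d + 1)) * hk₁

theorem of_iterReaches (h : IsDoubleAt a b c s n m)
    (hne : ∀ r, devCoeff (quartic a b c) r 0 ≠ 0) (hst : IterReaches 3 (quartic a b c) s t) :
    ∃ m', IsDoubleAt a b c t n m' := by
  induction hst with
  | refl => exact ⟨m, h⟩
  | tail _ hstep ih =>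
    obtain ⟨m', hm'⟩ := ih
    exact ⟨m' + 1, hm'.of_iterStep (hne _) hstep⟩

/-- Each monomial is bounded separately, with a₂² a₁² and a₂³ a₀ controlling the growth in m. As n
stays fixed, this bounds the number of steps. -/
theorem pow_dvd_discPoly (h : IsDoubleAt a b c s n m) :
    (3 : ℤ) ^ (6 * n + m) ∣ discPoly c b a 0 := by
  obtain ⟨w₀, hw₀⟩ := h.zero
  obtain ⟨w₁, hw₁⟩ := h.one
  obtain ⟨w₂, hw₂, -⟩ := h.two
  rw [← discPoly_quartic a b c s, discPoly, hw₀, hw₁, hw₂]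
  refine dvd_add (pow_dvd_discRest _ _ _ _ ?_ ?_ ?_ ?_ ?_ ?_ ?_ ?_ ?_ ?_ ?_ ?_ ?_)
    (dvd_sub (dvd_sub ?_ ?_) ?_)
  iterate 13 omega
  · refine (pow_dvd_pow 3 (show 6 * n + m ≤ 2 * n + 2 * ((4 * n + m + 1) / 2) by omega)).trans
      ⟨devCoeff (quartic a b c) s 3 ^ 2 * w₂ ^ 2 * w₁ ^ 2, by ring⟩
  · exact ⟨4 * devCoeff (quartic a b c) s 3 ^ 2 * w₂ ^ 3 * w₀, by ring⟩
  · refine (pow_dvd_pow 3 (show 6 * n + m ≤ 3 * ((4 * n + m + 1) / 2) by omega)).trans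
      ⟨4 * devCoeff (quartic a b c) s 3 ^ 3 * w₁ ^ 3, by ring⟩

theorem iterSucceeds (h : IsDoubleAt a b c s n m) (hne : ∀ r, devCoeff (quartic a b c) r 0 ≠ 0)
    (hd : discPoly c b a 0 ≠ 0) : IterSucceeds 3 (quartic a b c) s := by
  constructor
  · intro t hst hirr
    obtain ⟨m', hm'⟩ := h.of_iterReaches hne hst
    exact exists_iterStep_of_not_regular hm'.cubic hirr
  · rintro ⟨r, hr₀, hr⟩
    have key : ∀ k, IsDoubleAt a b c (r k) n (m + k) := by
      intro k
      induction k with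
      | zero => rw [hr₀]; exact h
      | succ k ih => exact ih.of_iterStep (hne _) (hr k)
    set N := padicValInt 3 (discPoly c b a 0)
    have := (key (N + 1)).pow_dvd_discPoly
    have := le_padicValInt_three this hd
    omega

end IsDoubleAt

theorem ne_zero_of_eq_three_pow_mul {x y : ℤ} {m : ℕ} (h : x = 3 ^ m * y) (hy : ¬ (3 : ℤ) ∣ y) :
    x ≠ 0 := by
  rintro rfl
  rcases mul_eq_zero.mp h.symm with h | rfl
  · exact absurd h (by positivity)
  · exact hy (dvd_zero 3)

/-- The two exponents, the divisibilities that they satisfy and the exact power of `3` in the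
discriminant. -/
structure DoubleData (a b c s : ℤ) (n μ : ℕ) : Prop where
  le : 4 * n ≤ μ
  floors : PolygonFloors (quartic a b c) s (μ / 2) n
  zero : (3 : ℤ) ^ (μ - n) ∣ devCoeff (quartic a b c) s 0
  one : (3 : ℤ) ^ ((μ + 1) / 2) ∣ devCoeff (quartic a b c) s 1
  disc : ∃ x, discPoly c b a 0 = 3 ^ (2 * n + μ) * x ∧ ¬ (3 : ℤ) ∣ x

namespace IsDoubleAt

variable {a b c s t : ℤ} {n m : ℕ}

/-- On a line of slope -n all three main terms have weight 6n, and the other terms have more. The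
quotient by 3^(6n) is, modulo 3, a₃² times the discriminant of the residual cubic. -/
theorem disc_of_eq {A B C : ℤ} (hn : 0 < n) (h₀ : devCoeff (quartic a b c) s 0 = 3 ^ (3 * n) * A)
    (h₁ : devCoeff (quartic a b c) s 1 = 3 ^ (2 * n) * B)
    (h₂ : devCoeff (quartic a b c) s 2 = 3 ^ n * C) (h₃ : ¬ (3 : ℤ) ∣ devCoeff (quartic a b c) s 3)
    (hd : (B : ZMod 3) ^ 2 * C ^ 2 - B ^ 3 * (devCoeff (quartic a b c) s 3 : ℤ) - A * C ^ 3 ≠ 0) :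
    ∃ x, discPoly c b a 0 = 3 ^ (2 * n + 4 * n) * x ∧ ¬ (3 : ℤ) ∣ x := by
  set D := devCoeff (quartic a b c) s 3 with hD
  obtain ⟨z, hz⟩ := pow_dvd_discRest (e₀ := 3 * n) (e₁ := 2 * n) (e₂ := n) (N := 6 * n + 1) A B C D
    (by omega) (by omega) (by omega) (by omega) (by omega) (by omega) (by omega) (by omega)
    (by omega) (by omega) (by omega) (by omega) (by omega)
  refine ⟨3 * z + D ^ 2 * (B ^ 2 * C ^ 2 - 4 * B ^ 3 * D - 4 * A * C ^ 3), ?_, ?_⟩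
  · rw [← discPoly_quartic a b c s, discPoly, h₀, h₁, h₂, ← hD, hz]
    ring
  · rw [← zmod_three_eq_zero]
    push_cast
    have h3 : (3 : ZMod 3) = 0 := rfl
    rw [show (3 : ZMod 3) * z + D ^ 2 * (B ^ 2 * C ^ 2 - 4 * B ^ 3 * D - 4 * A * C ^ 3) =
      D ^ 2 * (B ^ 2 * C ^ 2 - B ^ 3 * D - A * C ^ 3) by
        linear_combination (z - D ^ 2 * (B ^ 3 * D + A * C ^ 3)) * h3]
    exact mul_ne_zero (pow_ne_zero 2 (zmod_three_ne_zero.mpr h₃)) hd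

theorem data_of_zero_not_dvd {A : ℤ} (h : IsDoubleAt a b c s n m)
    (hreg : IsRegularAt 3 (quartic a b c) s)
    (h₀ : devCoeff (quartic a b c) s 0 = 3 ^ (3 * n) * A) (hA : ¬ (3 : ℤ) ∣ A) :
    DoubleData a b c s n (4 * n) := by
  obtain ⟨C, h₂, hC⟩ := h.two
  obtain ⟨B, h₁⟩ : (3 : ℤ) ^ (2 * n) ∣ devCoeff (quartic a b c) s 1 :=
    (pow_dvd_pow 3 (by omega)).trans h.one
  have hc := h.cubic
  have v₀ := devVal_eq h₀ hA
  have v₁ := le_devVal ⟨B, h₁⟩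
  have v₂ := devVal_eq h₂ hC
  have v₃ := hc.devVal_three
  have hside : IsPrincipalSide 3 (quartic a b c) s 0 3 := by
    refine hc.isPrincipalSide (by norm_num) le_rfl hc.ne_zero hc.three_ne
      (by have := h.pos; rw [v₀, v₃]; push_cast; omega) ?_ (by omega)
    intro k hk hk' hk0
    have : k = 1 ∨ k = 2 := by omega
    rcases this with rfl | rfl
    · have := v₁ hk0
      rw [v₀, v₃]; push_cast at *; linarith
    · rw [v₀, v₂, v₃]; push_cast; linarith
  have hsep := hreg 0 3 hside
  rw [hc.residualPoly_zero_three h₀ h₁ h₂ hA,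
    separable_cubicPoly_iff (Or.inr (zmod_three_ne_zero.mpr hc.three))] at hsep
  refine ⟨le_rfl, ⟨(2 * n : ℕ), n, ⟨0, 3, hside, by norm_num, by norm_num, ?_⟩,
    ⟨0, 3, hside, by norm_num, by norm_num, ?_⟩, ?_, Int.floor_natCast _⟩, ⟨A, ?_⟩, ⟨B, ?_⟩,
    disc_of_eq h.pos h₀ h₁ h₂ hc.three hsep⟩
  · rw [v₀, v₃]; push_cast; ring
  · rw [v₀, v₃]; push_cast; ring
  · rw [Int.floor_natCast]; congr 1; omega
  · rw [h₀]; congr 2; omega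
  · rw [h₁]; congr 2; omega

theorem data_of_one_not_dvd {A B : ℤ} (h : IsDoubleAt a b c s n m)
    (hreg : IsRegularAt 3 (quartic a b c) s)
    (h₀ : devCoeff (quartic a b c) s 0 = 3 ^ (3 * n + 1) * A)
    (h₁ : devCoeff (quartic a b c) s 1 = 3 ^ (2 * n) * B) (hB : ¬ (3 : ℤ) ∣ B) :
    DoubleData a b c s n (4 * n) := by
  obtain ⟨C, h₂, hC⟩ := h.two
  have hc := h.cubic
  have v₀ := le_devVal ⟨A, h₀⟩ hc.ne_zero
  have v₁ := devVal_eq h₁ hB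
  have v₂ := devVal_eq h₂ hC
  have v₃ := hc.devVal_three
  have hside : IsPrincipalSide 3 (quartic a b c) s 1 3 := by
    refine hc.isPrincipalSide (by norm_num) le_rfl (ne_zero_of_eq_three_pow_mul h₁ hB) hc.three_ne
      (by have := h.pos; rw [v₁, v₃]; push_cast; omega) ?_ ?_
    · intro k hk hk' hk0
      obtain rfl : k = 2 := by omega
      rw [v₁, v₂, v₃]; push_cast; linarith
    · intro k hk hk' hk0
      obtain rfl : k = 0 := by omega
      rw [v₁, v₃]; push_cast at *; linarith
  have hsep := hreg 1 3 hside
  have h3 := zmod_three_ne_zero.mpr hc.three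
  rw [hc.residualPoly_one_three h₁ h₂ hB, separable_cubicPoly_iff (Or.inl h3)] at hsep
  refine ⟨le_rfl, ⟨(2 * n : ℕ), n, ⟨1, 3, hside, by norm_num, by norm_num, ?_⟩,
    ⟨1, 3, hside, by norm_num, by norm_num, ?_⟩, ?_, Int.floor_natCast _⟩, ⟨3 * A, ?_⟩, ⟨B, ?_⟩,
    disc_of_eq (A := 3 * A) h.pos (by rw [h₀]; ring) h₁ h₂ hc.three fun hd => hsep ?_⟩
  · rw [v₁, v₃]; push_cast; ring
  · rw [v₁, v₃]; push_cast; ring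
  · rw [Int.floor_natCast]; congr 1; omega
  · rw [h₀, show 4 * n - n = 3 * n by omega]; ring
  · rw [h₁]; congr 2; omega
  -- With zero constant term the cubic discriminant is B²(C² - BD): a unit times the discriminant of
  -- the residual quadratic on the side from 1 to 3.
  · push_cast at hd
    have e3 : (3 : ZMod 3) = 0 := rfl
    have hB' := zmod_three_ne_zero.mpr hB
    have : (B : ZMod 3) ^ 2 * ((C : ZMod 3) ^ 2 - B * (devCoeff (quartic a b c) s 3 : ℤ)) = 0 := by
      linear_combination hd + A * C ^ 3 * e3
    have := (mul_eq_zero.mp this).resolve_left (pow_ne_zero 2 hB')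
    linear_combination (devCoeff (quartic a b c) s 3 : ZMod 3) ^ 2 * this

/-- Left of a break at (2, n) the term a₃a₁³ is negligible. What remains is a₃²a₂²(a₁² - 4a₂a₀),
governed by the discriminant of the quadratic that belongs to the steep part. -/
theorem disc_of_steep {e₀ e₁ μ : ℕ} {A B C : ℤ} (hn : 0 < n) (hμ : 4 * n < μ) (he₀ : μ ≤ e₀ + n)
    (he₁ : μ ≤ 2 * e₁)
    (h₀ : devCoeff (quartic a b c) s 0 = 3 ^ e₀ * A)
    (h₁ : devCoeff (quartic a b c) s 1 = 3 ^ e₁ * B)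
    (h₂ : devCoeff (quartic a b c) s 2 = 3 ^ n * C) (h₃ : ¬ (3 : ℤ) ∣ devCoeff (quartic a b c) s 3)
    (hC : ¬ (3 : ℤ) ∣ C)
    (hd : ¬ (3 : ℤ) ∣ 3 ^ (2 * e₁ - μ) * B ^ 2 - 4 * 3 ^ (e₀ + n - μ) * (C * A)) :
    ∃ x, discPoly c b a 0 = 3 ^ (2 * n + μ) * x ∧ ¬ (3 : ℤ) ∣ x := by
  set D := devCoeff (quartic a b c) s 3 with hD
  obtain ⟨z, hz⟩ := pow_dvd_discRest (e₀ := e₀) (e₁ := e₁) (e₂ := n) (N := 2 * n + μ + 1) A B C D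
    (by omega) (by omega) (by omega) (by omega) (by omega) (by omega) (by omega) (by omega)
    (by omega) (by omega) (by omega) (by omega) (by omega)
  obtain ⟨f₁, hf₁⟩ := Nat.exists_eq_add_of_le he₁
  obtain ⟨f₀, hf₀⟩ := Nat.exists_eq_add_of_le he₀
  obtain ⟨g, hg⟩ := Nat.exists_eq_add_of_le (show 2 * n + μ + 1 ≤ 3 * e₁ by omega)
  rw [hf₁, hf₀, Nat.add_sub_cancel_left, Nat.add_sub_cancel_left] at hd
  have p₁ : (3 : ℤ) ^ e₁ * 3 ^ e₁ = 3 ^ μ * 3 ^ f₁ := by rw [← pow_add, ← pow_add]; congr 1; omega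
  have p₀ : (3 : ℤ) ^ e₀ * 3 ^ n = 3 ^ μ * 3 ^ f₀ := by rw [← pow_add, ← pow_add]; congr 1
  have p₂ : ((3 : ℤ) ^ e₁) ^ 3 = 3 ^ (2 * n + μ + 1) * 3 ^ g := by
    rw [← pow_mul, ← pow_add]; congr 1; omega
  refine ⟨3 * (z - 4 * D ^ 3 * B ^ 3 * 3 ^ g) +
    D ^ 2 * C ^ 2 * (3 ^ f₁ * B ^ 2 - 4 * 3 ^ f₀ * (C * A)), ?_, ?_⟩
  · rw [← discPoly_quartic a b c s, discPoly, h₀, h₁, h₂, ← hD, hz]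
    linear_combination D ^ 2 * C ^ 2 * B ^ 2 * (3 ^ n) ^ 2 * p₁ -
      4 * D ^ 2 * C ^ 3 * A * (3 ^ n) ^ 2 * p₀ - 4 * D ^ 3 * B ^ 3 * p₂
  · intro hdvd
    have := (dvd_add_right (dvd_mul_right 3 _)).mp hdvd
    rcases Int.prime_three.dvd_or_dvd this with h' | h'
    · rcases Int.prime_three.dvd_or_dvd h' with h' | h'
      · exact h₃ (Int.prime_three.dvd_of_dvd_pow h')
      · exact hC (Int.prime_three.dvd_of_dvd_pow h')
    · exact hd h'

/-- The left part of the polygon is a side that ends in `(2, n)`. -/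
theorem isPrincipalSide_zero_two {u₀ e₁ : ℕ} {A B C : ℤ} (hc : IsCubicAt (quartic a b c) s)
    (hu₀ : 3 * n < u₀) (he₁ : u₀ + n ≤ 2 * e₁)
    (h₀ : devCoeff (quartic a b c) s 0 = 3 ^ u₀ * A) (hA : ¬ (3 : ℤ) ∣ A)
    (h₁ : devCoeff (quartic a b c) s 1 = 3 ^ e₁ * B)
    (h₂ : devCoeff (quartic a b c) s 2 = 3 ^ n * C) (hC : ¬ (3 : ℤ) ∣ C) :
    IsPrincipalSide 3 (quartic a b c) s 0 2 ∧
      OnPrincipalPolygon 3 (quartic a b c) s 1 (((u₀ + n : ℕ) : ℚ) / (2 : ℕ)) ∧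
      OnPrincipalPolygon 3 (quartic a b c) s 2 n := by
  have v₀ := devVal_eq h₀ hA
  have v₁ := le_devVal ⟨B, h₁⟩
  have v₂ := devVal_eq h₂ hC
  have v₃ := hc.devVal_three
  have hside : IsPrincipalSide 3 (quartic a b c) s 0 2 := by
    refine hc.isPrincipalSide (by norm_num) (by norm_num) hc.ne_zero
      (ne_zero_of_eq_three_pow_mul h₂ hC) (by rw [v₀, v₂]; omega) ?_ ?_
    · intro k hk hk' hk0
      obtain rfl : k = 1 := by omega
      have := v₁ hk0
      rw [v₀, v₂]; push_cast; omega
    · intro k hk hk' hk0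
      obtain rfl : k = 3 := by omega
      rw [v₀, v₂, v₃]; push_cast; omega
  refine ⟨hside, ⟨0, 2, hside, by norm_num, by norm_num, ?_⟩, ⟨0, 2, hside, by norm_num, by norm_num,
    ?_⟩⟩ <;>
  · rw [v₀, v₂]; push_cast; ring

/-- The value of μ is 4n when a side ends at (3, 0) after starting at 0 or 1, u₀ + n when a steeper
side joins 0 to 2, and 2u₁ when there are vertices at 1 and 2. In each case μ/2 is the ordinate over
1, and regularity yields the exact discriminant. -/
theorem exists_data (h : IsDoubleAt a b c s n m) (hreg : IsRegularAt 3 (quartic a b c) s) :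
    ∃ μ, DoubleData a b c s n μ := by
  have hc := h.cubic
  obtain ⟨C, h₂, hC⟩ := h.two
  obtain ⟨A, h₀, hA⟩ := exists_eq_three_pow_mul hc.ne_zero
  generalize padicValInt 3 (devCoeff (quartic a b c) s 0) = u₀ at h₀
  obtain ⟨z, hz⟩ : (3 : ℤ) ^ (3 * n) ∣ devCoeff (quartic a b c) s 0 :=
    (pow_dvd_pow 3 (by omega)).trans h.zero
  have hu₀ := le_of_three_pow_mul_eq (hz.symm.trans h₀) hA
  rcases hu₀.eq_or_lt with rfl | hu₀
  · exact ⟨_, h.data_of_zero_not_dvd hreg h₀ hA⟩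
  have hpos := h.pos
  by_cases hB : (3 : ℤ) ^ ((u₀ + n + 1) / 2) ∣ devCoeff (quartic a b c) s 1
  · obtain ⟨B, h₁⟩ := hB
    obtain ⟨hside, p₁, p₂⟩ := isPrincipalSide_zero_two hc hu₀ (by omega) h₀ hA h₁ h₂ hC
    refine ⟨u₀ + n, by omega, ⟨_, _, p₁, p₂, floor_ratCast_div rfl, Int.floor_natCast _⟩,
      ⟨A, by rw [h₀, Nat.add_sub_cancel]⟩, ⟨B, h₁⟩,
      disc_of_steep (e₀ := u₀) (e₁ := (u₀ + n + 1) / 2) hpos (by omega) le_rfl (by omega) h₀ h₁ h₂ hc.three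
        hC ?_⟩
    rw [Nat.sub_self]
    -- For even u₀ + n the quadratic discriminant is nonzero modulo 3 by separability; for odd u₀ +
    -- n the term in B² acquires a factor 3 and the unit CA decides.
    rcases Nat.even_or_odd' (u₀ + n) with ⟨w, hw | hw⟩
    · obtain ⟨δ, rfl⟩ : ∃ δ, w = n + δ := ⟨w - n, by omega⟩
      have hsep := hreg 0 2 hside
      rw [IsCubicAt.residualPoly_zero_two (m := n) (δ := δ) (x₁ := B)
        (by rw [h₀]; congr 2; omega) (by rw [h₁]; congr 2; omega) h₂ hA hC,
        separable_cubicPoly_iff (Or.inl (zmod_three_ne_zero.mpr hC))] at hsep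
      intro hd
      apply hsep
      rw [show 2 * ((u₀ + n + 1) / 2) - (u₀ + n) = 0 by omega, ← zmod_three_eq_zero] at hd
      push_cast at hd
      have h3 : (3 : ZMod 3) = 0 := rfl
      linear_combination (C : ZMod 3) ^ 2 * (hd + C * A * h3)
    · intro hd
      rw [show 2 * ((u₀ + n + 1) / 2) - (u₀ + n) = 1 by omega] at hd
      have h' : (3 : ℤ) ∣ C * A := by omega
      rcases Int.prime_three.dvd_or_dvd h' with h' | h'
      · exact hC h'
      · exact hA h'
  · have n₁ : devCoeff (quartic a b c) s 1 ≠ 0 := fun h0 => hB (h0 ▸ dvd_zero _)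
    obtain ⟨B, h₁, hB'⟩ := exists_eq_three_pow_mul n₁
    generalize padicValInt 3 (devCoeff (quartic a b c) s 1) = u₁ at h₁
    have hlt : u₁ < (u₀ + n + 1) / 2 := by
      by_contra! hle
      exact hB ((pow_dvd_pow 3 hle).trans ⟨B, h₁⟩)
    obtain ⟨z₁, hz₁⟩ : (3 : ℤ) ^ (2 * n) ∣ devCoeff (quartic a b c) s 1 :=
      (pow_dvd_pow 3 (by omega)).trans h.one
    have hu₁ := le_of_three_pow_mul_eq (hz₁.symm.trans h₁) hB'
    rcases hu₁.eq_or_lt with rfl | hu₁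
    · obtain ⟨k, rfl⟩ := Nat.exists_eq_add_of_lt hu₀
      exact ⟨_, h.data_of_one_not_dvd hreg (A := 3 ^ k * A) (by rw [h₀]; ring) h₁ hB'⟩
    have v₀ := devVal_eq h₀ hA
    have v₁ := devVal_eq h₁ hB'
    have v₂ := devVal_eq h₂ hC
    have v₃ := hc.devVal_three
    have hside : IsPrincipalSide 3 (quartic a b c) s 1 2 := by
      refine hc.isPrincipalSide (by norm_num) (by norm_num) n₁ (ne_zero_of_eq_three_pow_mul h₂ hC)
        (by rw [v₁, v₂]; omega) (by omega) ?_
      intro k hk hk' hk0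
      have : k = 0 ∨ k = 3 := by omega
      rcases this with rfl | rfl
      · rw [v₀, v₁, v₂]; push_cast; omega
      · rw [v₁, v₂, v₃]; push_cast; omega
    refine ⟨2 * u₁, by omega, ⟨u₁, n, ⟨1, 2, hside, by norm_num, by norm_num, ?_⟩,
      ⟨1, 2, hside, by norm_num, by norm_num, ?_⟩, ?_, Int.floor_natCast _⟩,
      (pow_dvd_pow 3 (by omega)).trans ⟨A, h₀⟩, ⟨B, ?_⟩,
      disc_of_steep (e₀ := u₀) (e₁ := u₁) hpos (by omega) (by omega) le_rfl h₀ h₁ h₂ hc.three hC ?_⟩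
    · rw [v₁, v₂]; push_cast; ring
    · rw [v₁, v₂]; push_cast; ring
    · rw [Int.floor_natCast]; congr 1; omega
    · rw [h₁]; congr 2; omega
    · obtain ⟨k, hk⟩ := Nat.exists_eq_add_of_lt (show 2 * u₁ < u₀ + n by omega)
      rw [Nat.sub_self, hk, show 2 * u₁ + k + 1 - 2 * u₁ = k + 1 by omega, pow_zero, one_mul]
      intro hd
      have := (dvd_sub_left (c := 4 * 3 ^ (k + 1) * (C * A)) ⟨4 * 3 ^ k * (C * A), by ring⟩).mp hd
      exact hB' (Int.prime_three.dvd_of_dvd_pow this)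

end IsDoubleAt

/-! ### The discriminant of the quartic as a Sylvester determinant -/

theorem quartic_coeffs (a b c : ℤ) : (quartic a b c).coeff 0 = c ∧ (quartic a b c).coeff 1 = b ∧
    (quartic a b c).coeff 2 = a ∧ (quartic a b c).coeff 3 = 0 ∧ (quartic a b c).coeff 4 = 1 := by
  simp only [quartic, coeff_add, coeff_C_mul, coeff_X_pow, coeff_C, coeff_X]
  norm_num

theorem natDegree_quartic (a b c : ℤ) : (quartic a b c).natDegree = 4 := by
  unfold quartic; compute_degree!

theorem monic_quartic (a b c : ℤ) : (quartic a b c).Monic := by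
  unfold quartic; monicity!

theorem sylvesterDeriv_of_natDegree_eq_four {f : ℤ[X]} (hf : f.natDegree = 4) {a b c : ℤ}
    (h0 : f.coeff 0 = c) (h1 : f.coeff 1 = b) (h2 : f.coeff 2 = a) (h3 : f.coeff 3 = 0)
    (h4 : f.coeff 4 = 1) :
    f.sylvesterDeriv.reindex (finCongr (by rw [hf])) (finCongr (by rw [hf])) =
    !![c, 0, 0, b, 0, 0, 0;
       b, c, 0, 2 * a, b, 0, 0;
       a, b, c, 0, 2 * a, b, 0;
       0, a, b, 4, 0, 2 * a, b;
       1, 0, a, 0, 4, 0, 2 * a;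
       0, 1, 0, 0, 0, 4, 0;
       0, 0, 1, 0, 0, 0, (4 : ℤ)] := by
  ext ⟨i, hi⟩ ⟨j, hj⟩
  simp only [sylvesterDeriv, hf, OfNat.ofNat_ne_zero, ↓reduceDIte, sylvester, Fin.addCases,
    Nat.add_one_sub_one, Fin.val_castLT, Set.mem_Icc, Fin.val_fin_le, Fin.val_subNat, Fin.val_cast,
    tsub_le_iff_right, coeff_derivative, eq_rec_constant, dite_eq_ite, Nat.reduceMul, Nat.reduceSub,
    Nat.cast_ofNat, Matrix.reindex_apply, finCongr_symm, Matrix.submatrix_apply, finCongr_apply,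
    Fin.cast_mk, Matrix.updateRow_apply, Fin.mk.injEq, Matrix.of_apply, Fin.mk_le_mk,
    Matrix.cons_val', Matrix.cons_val_fin_one]
  have hi' : i ∈ Finset.range 7 := Finset.mem_range.mpr hi
  have hj' : j ∈ Finset.range 7 := Finset.mem_range.mpr hj
  fin_cases hi' <;>
  · simp only [and_true, Fin.isValue, Fin.mk_one, Fin.reduceFinMk, Fin.zero_eta,
      le_add_iff_nonneg_left, Matrix.cons_val_one, Matrix.cons_val_zero, Matrix.cons_val,
      Nat.reduceAdd, Nat.reduceEqDiff, Nat.reduceLeDiff, nonpos_iff_eq_zero,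
      OfNat.one_ne_ofNat, ↓reduceIte, zero_add, zero_le]
    fin_cases hj' <;> simp [mul_comm, one_add_one_eq_two, h0, h1, h2, h3, h4]

theorem det_of_row_single {n : ℕ} (M : Matrix (Fin (n + 1)) (Fin (n + 1)) ℤ) (i j : Fin (n + 1))
    (h : ∀ k, M i k = if k = j then 1 else 0) (hij : Even ((i : ℕ) + j)) :
    M.det = (M.submatrix i.succAbove j.succAbove).det := by
  rw [Matrix.det_succ_row M i, Finset.sum_eq_single j]
  · rw [h, if_pos rfl, hij.neg_one_pow, one_mul, one_mul]
  · intro k _ hk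
    rw [h, if_neg hk, mul_zero, zero_mul]
  · simp

theorem sylvester_det (a b c : ℤ) : Matrix.det
    !![c, 0, 0, b, 0, 0, 0;
       b, c, 0, 2 * a, b, 0, 0;
       a, b, c, 0, 2 * a, b, 0;
       0, a, b, 4, 0, 2 * a, b;
       1, 0, a, 0, 4, 0, 2 * a;
       0, 1, 0, 0, 0, 4, 0;
       0, 0, 1, 0, 0, 0, (4 : ℤ)] = discPoly c b a 0 := by
  set M : Matrix (Fin 7) (Fin 7) ℤ :=
    !![c, 0, 0, b, 0, 0, 0;
       b, c, 0, 2 * a, b, 0, 0;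
       a, b, c, 0, 2 * a, b, 0;
       0, a, b, 4, 0, 2 * a, b;
       1, 0, a, 0, 4, 0, 2 * a;
       0, 1, 0, 0, 0, 4, 0;
       0, 0, 1, 0, 0, 0, 4] with hM
  -- A unipotent matrix of column operations: multiples of the first three columns clear the last
  -- three rows to unit vectors, and three expansions leave a 4 by 4 determinant.
  set T : Matrix (Fin 7) (Fin 7) ℤ :=
    !![1, 0, -a, 0, -4, 0, 2 * a;
       0, 1, 0, 0, 0, -4, 0;
       0, 0, 1, 0, 0, 0, -4;
       0, 0, 0, 1, 0, 0, 0;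
       0, 0, 0, 0, 1, 0, 0;
       0, 0, 0, 0, 0, 1, 0;
       0, 0, 0, 0, 0, 0, 1] with hT
  have hTdet : T.det = 1 := by
    rw [Matrix.det_of_isUpperTriangular]
    · simp [hT, Fin.prod_univ_succ]
    · intro i j hij
      fin_cases i <;> fin_cases j <;> first | rfl | exact absurd hij (by decide)
  have hMT : M * T =
    !![c, 0, -a * c, b, -4 * c, 0, 2 * a * c;
       b, c, -a * b, 2 * a, -3 * b, -4 * c, 2 * a * b;
       a, b, c - a * a, 0, -2 * a, -3 * b, 2 * a * a - 4 * c;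
       0, a, b, 4, 0, -2 * a, -3 * b;
       1, 0, 0, 0, 0, 0, 0;
       0, 1, 0, 0, 0, 0, 0;
       0, 0, 1, 0, 0, 0, 0] := by
    ext i j
    rw [Matrix.mul_apply]
    fin_cases i <;> fin_cases j <;> simp [hM, hT, Fin.sum_univ_succ] <;> ring
  rw [← mul_one M.det, ← hTdet, ← Matrix.det_mul, hMT,
    det_of_row_single (n := 6) _ 6 2 (fun k => by fin_cases k <;> rfl) (by decide),
    det_of_row_single (n := 5) _ 5 1 (fun k => by fin_cases k <;> rfl) (by decide),
    det_of_row_single (n := 4) _ 4 0 (fun k => by fin_cases k <;> rfl) (by decide)]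
  have : Matrix.submatrix (Matrix.submatrix (Matrix.submatrix
    !![c, 0, -a * c, b, -4 * c, 0, 2 * a * c;
       b, c, -a * b, 2 * a, -3 * b, -4 * c, 2 * a * b;
       a, b, c - a * a, 0, -2 * a, -3 * b, 2 * a * a - 4 * c;
       0, a, b, 4, 0, -2 * a, -3 * b;
       1, 0, 0, 0, 0, 0, 0;
       0, 1, 0, 0, 0, 0, 0;
       0, 0, 1, 0, 0, 0, 0] (Fin.succAbove 6) (Fin.succAbove 2)) (Fin.succAbove 5) (Fin.succAbove 1))
         (Fin.succAbove 4) (Fin.succAbove 0) =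
    !![b, -4 * c, 0, 2 * a * c;
       2 * a, -3 * b, -4 * c, 2 * a * b;
       0, -2 * a, -3 * b, 2 * a * a - 4 * c;
       4, 0, -2 * a, -3 * b] := by
    ext i j
    fin_cases i <;> fin_cases j <;> rfl
  rw [this, Matrix.det_succ_row_zero, discPoly, discRest]
  simp [Fin.sum_univ_succ, Matrix.det_fin_three, Fin.succAbove]
  ring

theorem discr_quartic (a b c : ℤ) : (quartic a b c).discr = discPoly c b a 0 := by
  let e : Fin ((quartic a b c).natDegree - 1 + (quartic a b c).natDegree) ≃ Fin 7 :=
    finCongr (by rw [natDegree_quartic])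
  obtain ⟨h0, h1, h2, h3, h4⟩ := quartic_coeffs a b c
  rw [discr, ← Matrix.det_reindex_self e,
    sylvesterDeriv_of_natDegree_eq_four (natDegree_quartic a b c) h0 h1 h2 h3 h4,
    natDegree_quartic, sylvester_det]
  norm_num

/-! ### Integrality of the quotients divided by powers of 3 -/

section Integrality

variable {K : Type*} [Field K]

theorem isIntegral_of_quartic {x : K} (d₁ d₂ d₃ d₄ : ℤ)
    (h : x ^ 4 + d₁ * x ^ 3 + d₂ * x ^ 2 + d₃ * x + d₄ = 0) : IsIntegral ℤ x := by
  refine ⟨X ^ 4 + C d₁ * X ^ 3 + C d₂ * X ^ 2 + C d₃ * X + C d₄, by monicity!, ?_⟩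
  simp only [eval₂_add, eval₂_mul, eval₂_pow, eval₂_X, eval₂_C]
  simpa using h

theorem isIntegral_div_pow [CharZero K] {q : K} {ν : ℕ} {e₁ e₂ e₃ e₄ : ℤ}
    (h : q ^ 4 + e₁ * q ^ 3 + e₂ * q ^ 2 + e₃ * q + e₄ = 0) (h₁ : (3 : ℤ) ^ ν ∣ e₁)
    (h₂ : (3 : ℤ) ^ (2 * ν) ∣ e₂) (h₃ : (3 : ℤ) ^ (3 * ν) ∣ e₃) (h₄ : (3 : ℤ) ^ (4 * ν) ∣ e₄) :
    IsIntegral ℤ (q / 3 ^ ν) := by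
  obtain ⟨d₁, rfl⟩ := h₁
  obtain ⟨d₂, rfl⟩ := h₂
  obtain ⟨d₃, rfl⟩ := h₃
  obtain ⟨d₄, rfl⟩ := h₄
  refine isIntegral_of_quartic d₁ d₂ d₃ d₄ ?_
  have h3 : (3 : K) ^ ν ≠ 0 := pow_ne_zero _ (by norm_num)
  set T := (3 : K) ^ ν with hT
  obtain ⟨w, rfl⟩ : ∃ w, q = w * T := ⟨q / T, by field_simp⟩
  push_cast at h
  simp only [mul_comm _ ν, pow_mul, ← hT] at h
  rw [mul_div_cancel_right₀ _ h3]
  have : T ^ 4 * (w ^ 4 + d₁ * w ^ 3 + d₂ * w ^ 2 + d₃ * w + d₄) = 0 := by linear_combination h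
  exact (mul_eq_zero.mp this).resolve_left (pow_ne_zero _ h3)

variable [CharZero K] {t : K} {a₀ a₁ a₂ a₃ : ℤ}

/-- The monic quartic used is the characteristic polynomial of t² + a₃t + a₂, and its i-th
coefficient is divisible by 3^(iν) under the hypotheses. -/
theorem isIntegral_second_quotient (ht : t ^ 4 + a₃ * t ^ 3 + a₂ * t ^ 2 + a₁ * t + a₀ = 0) {ν : ℕ}
    (h₂ : (3 : ℤ) ^ ν ∣ a₂) (h₁ : (3 : ℤ) ^ (2 * ν) ∣ a₁) (h₀ : (3 : ℤ) ^ (3 * ν) ∣ a₀) :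
    IsIntegral ℤ ((t ^ 2 + a₃ * t + a₂) / 3 ^ ν) := by
  obtain ⟨z₂, rfl⟩ := h₂
  obtain ⟨z₁, rfl⟩ := h₁
  obtain ⟨z₀, rfl⟩ := h₀
  generalize hA₀ : (3 : ℤ) ^ (3 * ν) * z₀ = a₀ at *
  generalize hA₁ : (3 : ℤ) ^ (2 * ν) * z₁ = a₁ at *
  generalize hA₂ : (3 : ℤ) ^ ν * z₂ = a₂ at *
  refine isIntegral_div_pow (e₁ := -(2 * a₂)) (e₂ := 2 * a₀ + a₁ * a₃ + a₂ ^ 2)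
    (e₃ := -(a₁ ^ 2 + 2 * a₀ * a₂ + a₁ * a₂ * a₃ - a₀ * a₃ ^ 2))
    (e₄ := a₁ ^ 2 * a₂ - a₀ * a₁ * a₃ + a₀ ^ 2) ?_ ?_ ?_ ?_ ?_
  · push_cast
    linear_combination (t ^ 4 + 3 * a₃ * t ^ 3 + a₂ * t ^ 2 + 3 * a₃ ^ 2 * t ^ 2 + 2 * a₂ * a₃ * t +
      a₃ ^ 3 * t - a₁ * t + a₂ * a₃ ^ 2 + a₀ - a₁ * a₃) * ht
  · exact ⟨-2 * z₂, by rw [← hA₂]; ring⟩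
  · exact ⟨2 * 3 ^ ν * z₀ + z₁ * a₃ + z₂ ^ 2, by rw [← hA₀, ← hA₁, ← hA₂]; ring⟩
  · exact ⟨-(3 ^ ν * z₁ ^ 2 + 2 * 3 ^ ν * z₀ * z₂ + z₁ * z₂ * a₃ - z₀ * a₃ ^ 2), by
      rw [← hA₀, ← hA₁, ← hA₂]; ring⟩
  · exact ⟨3 ^ ν * z₁ ^ 2 * z₂ - 3 ^ ν * z₀ * z₁ * a₃ + 3 ^ (2 * ν) * z₀ ^ 2, by
      rw [← hA₀, ← hA₁, ← hA₂]; ring⟩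

/-- The numerator times t is -a₀, so a monic equation for it comes from the reciprocal of that for
t: the coefficients are -a₁, a₀a₂, -a₀²a₃, a₀³. -/
theorem isIntegral_first_quotient (ht : t ^ 4 + a₃ * t ^ 3 + a₂ * t ^ 2 + a₁ * t + a₀ = 0) {ν : ℕ}
    (h₁ : (3 : ℤ) ^ ν ∣ a₁) (h₂ : (3 : ℤ) ^ (2 * ν) ∣ a₀ * a₂) (h₃ : (3 : ℤ) ^ (3 * ν) ∣ a₀ ^ 2) :
    IsIntegral ℤ ((t ^ 3 + a₃ * t ^ 2 + a₂ * t + a₁) / 3 ^ ν) := by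
  have h₄ : (3 : ℤ) ^ (4 * ν) ∣ a₀ ^ 3 := by
    -- After squaring, this follows from the cube of `h₃`, which gives even 3^(9ν) in a₀⁶.
    rw [← Int.pow_dvd_pow_iff (n := 2) (by norm_num), ← pow_mul, ← pow_mul]
    obtain ⟨z, hz⟩ := h₃
    exact ⟨3 ^ ν * z ^ 3, by rw [show 3 * 2 = 2 * 3 by rfl, pow_mul, hz]; ring⟩
  refine isIntegral_div_pow (e₁ := -a₁) (e₂ := a₀ * a₂) (e₃ := -(a₀ ^ 2 * a₃)) (e₄ := a₀ ^ 3)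
    ?_ (by simpa using h₁) h₂ ?_ h₄
  · have e : (a₀ : K) = -((t ^ 3 + a₃ * t ^ 2 + a₂ * t + a₁) * t) := by linear_combination ht
    push_cast
    rw [e]
    ring
  · exact (h₃.mul_right _).neg_right

end Integrality

/-! ### The power basis of the root: traces, norm and discriminant -/

section Field

variable {K : Type*} [Field K] {a b c : ℤ} {θ : K}

theorem isIntegral_root (hθ : aeval θ (quartic a b c) = 0) : IsIntegral ℤ θ :=
  ⟨quartic a b c, monic_quartic a b c, hθ⟩

theorem aeval_quartic (θ : K) :
    aeval θ (quartic a b c) = θ ^ 4 + a * θ ^ 2 + b * θ + c := by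
  simp [quartic]

variable [NumberField K]

theorem exists_basis (hirr : Irreducible (quartic a b c)) (hθ : aeval θ (quartic a b c) = 0)
    (hK : IntermediateField.adjoin ℚ {θ} = ⊤) :
    ∃ B : Module.Basis (Fin 4) ℚ K, ∀ i, B i = θ ^ (i : ℕ) := by
  have hint : IsIntegral ℚ θ := (isIntegral_root hθ).tower_top
  have htop : Algebra.adjoin ℚ {θ} = ⊤ := by
    rw [← IntermediateField.adjoin_simple_toSubalgebra_of_isAlgebraic hint.isAlgebraic, hK,
      IntermediateField.top_toSubalgebra]
  have hmin : minpoly ℚ θ = (quartic a b c).map (algebraMap ℤ ℚ) := by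
    refine (minpoly.eq_of_irreducible_of_monic ?_ ?_ ((monic_quartic a b c).map _)).symm
    · exact ((monic_quartic a b c).irreducible_iff_irreducible_map_fraction_map).mp hirr
    · rw [aeval_map_algebraMap, hθ]
  let pb := PowerBasis.ofAdjoinEqTop hint htop
  have hgen : pb.gen = θ := PowerBasis.ofAdjoinEqTop_gen hint htop
  have hdim : pb.dim = 4 := by
    rw [PowerBasis.ofAdjoinEqTop_dim hint htop, hmin, (monic_quartic a b c).natDegree_map,
      natDegree_quartic]
  refine ⟨pb.basis.reindex (finCongr hdim), fun i => ?_⟩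
  rw [Module.Basis.reindex_apply, pb.basis_eq_pow, hgen]
  rfl

theorem leftMulMatrix_root (B : Module.Basis (Fin 4) ℚ K) (hB : ∀ i, B i = θ ^ (i : ℕ))
    (hθ : aeval θ (quartic a b c) = 0) : Algebra.leftMulMatrix B θ =
    !![0, 0, 0, -(c : ℚ); 1, 0, 0, -(b : ℚ); 0, 1, 0, -(a : ℚ); 0, 0, 1, 0] := by
  rw [aeval_quartic] at hθ
  have h0 : θ * B 0 = B 1 := by rw [hB, hB]; norm_num
  have h1 : θ * B 1 = B 2 := by rw [hB, hB]; norm_num; ring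
  have h2 : θ * B 2 = B 3 := by rw [hB, hB]; norm_num; ring
  have h3 : θ * B 3 = (-(c : ℚ)) • B 0 + (-(b : ℚ)) • B 1 + (-(a : ℚ)) • B 2 := by
    simp only [hB, Algebra.smul_def]
    norm_num
    linear_combination hθ
  ext i j
  rw [Algebra.leftMulMatrix_eq_repr_mul]
  fin_cases j
  · simp only [Fin.zero_eta, h0]; fin_cases i <;> simp
  · simp only [Fin.mk_one, h1]; fin_cases i <;> simp
  · simp only [Fin.reduceFinMk, h2]; fin_cases i <;> simp
  · simp only [Fin.reduceFinMk, h3]; fin_cases i <;> simp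

theorem trace_root_pow (B : Module.Basis (Fin 4) ℚ K) (hB : ∀ i, B i = θ ^ (i : ℕ))
    (hθ : aeval θ (quartic a b c) = 0) : Algebra.trace ℚ K 1 = 4 ∧ Algebra.trace ℚ K θ = 0 ∧
    Algebra.trace ℚ K (θ ^ 2) = -2 * a ∧ Algebra.trace ℚ K (θ ^ 3) = -3 * b := by
  have hM := leftMulMatrix_root B hB hθ
  refine ⟨?_, ?_, ?_, ?_⟩ <;> rw [Algebra.trace_eq_matrix_trace B]
  · rw [map_one, Matrix.trace_one]; simp
  · rw [hM]; simp [Matrix.trace, Fin.sum_univ_succ]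
  · rw [map_pow, hM, pow_two, Matrix.trace]
    simp [Fin.sum_univ_succ]
    ring
  · rw [map_pow, hM, pow_succ, pow_two, Matrix.trace]
    simp [Fin.sum_univ_succ]
    ring

theorem norm_root_sub (B : Module.Basis (Fin 4) ℚ K) (hB : ∀ i, B i = θ ^ (i : ℕ))
    (hθ : aeval θ (quartic a b c) = 0) (s : ℤ) :
    Algebra.norm ℚ (θ - s) = (devCoeff (quartic a b c) s 0 : ℤ) := by
  have hM := leftMulMatrix_root B hB hθ
  have hs : Algebra.leftMulMatrix B (θ - s) = !![-(s : ℚ), 0, 0, -(c : ℚ); 1, -(s : ℚ), 0, -(b : ℚ);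
      0, 1, -(s : ℚ), -(a : ℚ); 0, 0, 1, -(s : ℚ)] := by
    rw [map_sub, hM, map_intCast, show ((s : ℤ) : Matrix (Fin 4) (Fin 4) ℚ) =
      Matrix.diagonal fun _ => (s : ℚ) from rfl]
    ext i j
    fin_cases i <;> fin_cases j <;> simp
  rw [Algebra.norm_eq_matrix_det B, hs, devCoeff_quartic_zero, Matrix.det_succ_row_zero]
  simp [Fin.sum_univ_succ, Matrix.det_fin_three, Fin.succAbove]
  ring

theorem discr_basis (B : Module.Basis (Fin 4) ℚ K) (hB : ∀ i, B i = θ ^ (i : ℕ))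
    (hθ : aeval θ (quartic a b c) = 0) : Algebra.discr ℚ B = (discPoly c b a 0 : ℤ) := by
  obtain ⟨t0, t1, t2, t3⟩ := trace_root_pow B hB hθ
  rw [aeval_quartic] at hθ
  -- The equation of θ gives a linear recurrence for the power sums, and these fill the trace
  -- matrix.
  have hrec : ∀ k, Algebra.trace ℚ K (θ ^ (k + 4)) = -a * Algebra.trace ℚ K (θ ^ (k + 2)) -
      b * Algebra.trace ℚ K (θ ^ (k + 1)) - c * Algebra.trace ℚ K (θ ^ k) := by
    intro k
    have : θ ^ (k + 4) = (-a : ℚ) • θ ^ (k + 2) + (-b : ℚ) • θ ^ (k + 1) + (-c : ℚ) • θ ^ k := by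
      simp only [Algebra.smul_def]
      norm_num
      linear_combination θ ^ k * hθ
    rw [this]
    simp only [map_add, map_smul, smul_eq_mul]
    ring
  have t4 := hrec 0
  have t5 := hrec 1
  have t6 := hrec 2
  simp only [zero_add, pow_zero, pow_one, Nat.reduceAdd] at t4 t5 t6
  rw [t4] at t6
  rw [t3] at t5 t6
  rw [t2] at t4 t5 t6
  rw [t1] at t4 t5
  rw [t0] at t4
  have hmat : Algebra.traceMatrix ℚ B = !![4, 0, -2 * (a : ℚ), -3 * b;
      0, -2 * a, -3 * b, 2 * a ^ 2 - 4 * c;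
      -2 * a, -3 * b, 2 * a ^ 2 - 4 * c, 5 * a * b;
      -3 * b, 2 * a ^ 2 - 4 * c, 5 * a * b, -2 * a ^ 3 + 6 * a * c + 3 * b ^ 2] := by
    ext i j
    rw [Algebra.traceMatrix_apply, Algebra.traceForm_apply, hB, hB, ← pow_add]
    fin_cases i <;> fin_cases j <;> simp [t0, t1, t2, t3, t4, t5, t6] <;> ring
  rw [Algebra.discr_def, hmat, Matrix.det_succ_row_zero, discPoly, discRest]
  simp [Fin.sum_univ_succ, Matrix.det_fin_three, Fin.succAbove]
  ring

end Field

/-! ### Criteria for a family to be a 3-integral basis -/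

section Field

variable {K : Type*} [Field K] [NumberField K] {a b c : ℤ} {θ : K}

/-- The transition matrix from the powers of θ is lower triangular with determinant 3^(-ν₁-ν₂). -/
theorem discr_tripleBasis (B : Module.Basis (Fin 4) ℚ K) (hB : ∀ i, B i = θ ^ (i : ℕ))
    (hθ : aeval θ (quartic a b c) = 0) (s : ℤ) (ν₁ ν₂ : ℕ) :
    Algebra.discr ℚ (tripleBasis 3 a b s θ ν₁ ν₂) =
      (discPoly c b a 0 : ℤ) / 3 ^ (2 * (ν₁ + ν₂)) := by
  have h3 : ∀ n, (3 : K) ^ n ≠ 0 := fun n => pow_ne_zero n (by norm_num)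
  have : tripleBasis 3 a b s θ ν₁ ν₂ = Matrix.mulVec (Matrix.map
      !![1, 0, 0, 0; 0, 1, 0, 0; (3 * (s : ℚ) ^ 2 + a) / 3 ^ ν₂, 2 * (s : ℚ) / 3 ^ ν₂, 1 / 3 ^ ν₂, 0;
        ((s : ℚ) ^ 3 + a * s + b) / 3 ^ ν₁, ((s : ℚ) ^ 2 + a) / 3 ^ ν₁, (s : ℚ) / 3 ^ ν₁, 1 / 3 ^ ν₁]
      (algebraMap ℚ K)) B := by
    funext i
    fin_cases i <;> simp [tripleBasis, Matrix.mulVec, dotProduct, Fin.sum_univ_succ, hB]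
    · field_simp [h3 ν₂]; ring
    · field_simp [h3 ν₁]; ring
  rw [this, Algebra.discr_of_matrix_mulVec, discr_basis B hB hθ, Matrix.det_succ_row_zero]
  simp [Fin.sum_univ_succ, Matrix.det_fin_three]
  field_simp
  ring

theorem isIntegral_tripleBasis (hθ : aeval θ (quartic a b c) = 0) {s : ℤ} {ν₁ ν₂ : ℕ}
    (h₁ : (3 : ℤ) ^ ν₁ ∣ devCoeff (quartic a b c) s 1)
    (h₂ : (3 : ℤ) ^ (2 * ν₁) ∣ devCoeff (quartic a b c) s 0 * devCoeff (quartic a b c) s 2)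
    (h₃ : (3 : ℤ) ^ (3 * ν₁) ∣ devCoeff (quartic a b c) s 0 ^ 2)
    (h₄ : (3 : ℤ) ^ ν₂ ∣ devCoeff (quartic a b c) s 2)
    (h₅ : (3 : ℤ) ^ (2 * ν₂) ∣ devCoeff (quartic a b c) s 1)
    (h₆ : (3 : ℤ) ^ (3 * ν₂) ∣ devCoeff (quartic a b c) s 0) (i : Fin 4) :
    IsIntegral ℤ (tripleBasis 3 a b s θ ν₁ ν₂ i) := by
  have ht : (θ - s) ^ 4 + (devCoeff (quartic a b c) s 3 : ℤ) * (θ - s) ^ 3 +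
      (devCoeff (quartic a b c) s 2 : ℤ) * (θ - s) ^ 2 +
      (devCoeff (quartic a b c) s 1 : ℤ) * (θ - s) + (devCoeff (quartic a b c) s 0 : ℤ) = 0 := by
    rw [devCoeff_quartic_zero, devCoeff_quartic_one, devCoeff_quartic_two, devCoeff_quartic_three]
    rw [aeval_quartic] at hθ
    push_cast
    linear_combination hθ
  fin_cases i
  · exact isIntegral_one
  · exact isIntegral_root hθ
  · convert isIntegral_second_quotient ht h₄ h₅ h₆ using 1
    rw [devCoeff_quartic_two, devCoeff_quartic_three]
    simp only [tripleBasis, Fin.reduceFinMk, Matrix.cons_val]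
    push_cast
    ring
  · convert isIntegral_first_quotient ht h₁ h₂ h₃ using 1
    rw [devCoeff_quartic_one, devCoeff_quartic_two, devCoeff_quartic_three]
    simp only [tripleBasis, Fin.reduceFinMk, Matrix.cons_val]
    push_cast
    ring

theorem linearIndependent_tripleBasis (B : Module.Basis (Fin 4) ℚ K) (hB : ∀ i, B i = θ ^ (i : ℕ))
    (hθ : aeval θ (quartic a b c) = 0) (hd : discPoly c b a 0 ≠ 0) (s : ℤ) (ν₁ ν₂ : ℕ) :
    LinearIndependent ℚ (tripleBasis 3 a b s θ ν₁ ν₂) := by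
  by_contra hli
  have h := Algebra.discr_zero_of_not_linearIndependent ℚ hli
  rw [discr_tripleBasis B hB hθ, div_eq_zero_iff] at h
  rcases h with h | h
  · exact hd (by exact_mod_cast h)
  · exact absurd h (by positivity)

theorem exists_coordinates (B : Module.Basis (Fin 4) ℚ K) {v : Fin 4 → K}
    (hv : LinearIndependent ℚ v) (z : K) : ∃ r : Fin 4 → ℚ, z = ∑ i, (r i : K) * v i := by
  let b := basisOfLinearIndependentOfCardEqFinrank hv (Module.finrank_eq_card_basis B).symm
  refine ⟨b.repr z, ?_⟩
  conv_lhs => rw [← b.sum_repr z]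
  refine Finset.sum_congr rfl fun i _ => ?_
  rw [Algebra.smul_def, coe_basisOfLinearIndependentOfCardEqFinrank, eq_ratCast]

/-- The transition matrix is the identity with one row replaced by the coordinates, so by Cramer its
determinant is the coordinate in question. -/
theorem discr_update {v : Fin 4 → K} (r : Fin 4 → ℚ) (i : Fin 4) :
    Algebra.discr ℚ (Function.update v i (∑ j, (r j : K) * v j)) =
      r i ^ 2 * Algebra.discr ℚ v := by
  have hdet : ((1 : Matrix (Fin 4) (Fin 4) ℚ).updateRow i r).det = r i := by
    rw [← Matrix.cramer_transpose_apply, Matrix.transpose_one, Matrix.cramer_one]; rfl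
  rw [← hdet, ← Algebra.discr_of_matrix_mulVec]
  congr 1
  funext k
  by_cases hk : k = i
  · subst hk
    simp [Matrix.mulVec, dotProduct, Matrix.updateRow_self]
  · simp [Matrix.mulVec, dotProduct, Matrix.updateRow_ne hk, Function.update_of_ne hk,
      Matrix.one_apply, apply_ite]

/-- A family of integers whose discriminant has `3`-adic value at most one is a `3`-integral basis. -/
theorem isPIntegralBasis_of_discr (B : Module.Basis (Fin 4) ℚ K) {v : Fin 4 → K}
    (hint : ∀ i, IsIntegral ℤ (v i)) (hv : LinearIndependent ℚ v) {M N : ℕ} {D x : ℤ}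
    (hd : Algebra.discr ℚ v = D / 3 ^ (2 * N)) (hD : D = 3 ^ M * x) (hx : ¬ (3 : ℤ) ∣ x)
    (hMN : M ≤ 2 * N + 1) : IsPIntegralBasis 3 v := by
  refine ⟨hint, hv, fun z hz => ?_⟩
  obtain ⟨r, rfl⟩ := exists_coordinates B hv z
  refine ⟨r, fun i hi => ?_, rfl⟩
  -- Exchanging one member for z keeps the family integral and multiplies its discriminant by the
  -- square of a coordinate. A 3 in the denominator would cost a factor 9, more than the
  -- discriminant contains.
  have hI : IsIntegral ℤ (Algebra.discr ℚ (Function.update v i (∑ j, (r j : K) * v j))) := by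
    refine Algebra.discr_isIntegral ℚ fun k => ?_
    by_cases hk : k = i
    · subst hk; rwa [Function.update_self]
    · rw [Function.update_of_ne hk]; exact hint k
  obtain ⟨n, hn⟩ := IsIntegrallyClosed.isIntegral_iff.mp hI
  rw [discr_update, hd, hD] at hn
  obtain ⟨d, hd'⟩ := hi
  have hden : ((r i).den : ℚ) ≠ 0 := by exact_mod_cast (r i).den_nz
  have hr : r i = (r i).num / (r i).den := (Rat.num_div_den (r i)).symm
  rw [hr] at hn
  have h3 : (3 : ℚ) ^ (2 * N) ≠ 0 := by positivity
  have key : (3 : ℤ) ^ (2 * N + 2) * (n * d ^ 2) = 3 ^ M * ((r i).num ^ 2 * x) := by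
    have : (n : ℚ) * (3 ^ (2 * N) * (r i).den ^ 2) = (r i).num ^ 2 * (3 ^ M * x) := by
      simp only [eq_intCast] at hn
      rw [hn]
      push_cast
      field_simp
    rw [hd'] at this
    have h' : (n : ℤ) * (3 ^ (2 * N) * ((3 * d : ℕ) : ℤ) ^ 2) = (r i).num ^ 2 * (3 ^ M * x) := by
      exact_mod_cast this
    push_cast at h'
    linear_combination h'
  have := le_of_three_pow_mul_eq key (by
    intro h
    rcases Int.prime_three.dvd_or_dvd h with h | h
    · have h1 : 3 ∣ (r i).num.natAbs := Int.natCast_dvd.mp (Int.prime_three.dvd_of_dvd_pow h)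
      have := Nat.dvd_gcd h1 (⟨d, hd'⟩ : 3 ∣ (r i).den)
      rw [(r i).reduced] at this
      norm_num at this
    · exact hx h)
  omega

/-- Descent on the power of 3 in a common denominator: the cleared coordinates give an integral
element divided by 3, so saturation removes one 3 from all of them. -/
theorem not_dvd_den_of_saturated {v : Fin 4 → K}
    (hsat : ∀ x : Fin 4 → ℤ, IsIntegral ℤ ((∑ i, (x i : K) * v i) / 3) → ∀ i, (3 : ℤ) ∣ x i)
    (k m : ℕ) (hm : ¬ 3 ∣ m) (r : Fin 4 → ℚ) (hz : IsIntegral ℤ (∑ i, (r i : K) * v i))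
    (hr : ∀ i, ∃ x : ℤ, (3 : ℚ) ^ k * m * r i = x) (i : Fin 4) : ¬ 3 ∣ (r i).den := by
  induction k with
  | zero =>
    obtain ⟨x, hx⟩ := hr i
    have hm0 : (m : ℚ) ≠ 0 := by
      rintro h
      exact hm (by rw [Nat.cast_eq_zero.mp h]; exact dvd_zero 3)
    have e : r i = (x : ℚ) / ((m : ℤ) : ℚ) := by
      rw [← hx]; push_cast; field_simp
    have := Rat.den_dvd x m
    rw [Rat.divInt_eq_div, ← e] at this
    intro h3
    exact hm (h3.trans (by exact_mod_cast this))
  | succ k ih =>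
    choose x hx using hr
    have hx3 := hsat x (by
      have : (∑ i, (x i : K) * v i) / 3 = (3 ^ k * m : ℤ) * ∑ i, (r i : K) * v i := by
        rw [Finset.sum_div, Finset.mul_sum]
        refine Finset.sum_congr rfl fun i _ => ?_
        have : ((x i : ℚ) : K) = ((3 : ℚ) ^ (k + 1) * m * r i : ℚ) := by rw [hx]
        push_cast at this ⊢
        rw [this]
        ring
      rw [this]
      exact (isIntegral_algebraMap (R := ℤ) (x := (3 ^ k * m : ℤ))).mul hz)
    refine ih fun i => ?_
    obtain ⟨y, hy⟩ := hx3 i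
    refine ⟨y, ?_⟩
    have := hx i
    rw [hy] at this
    push_cast at this
    linear_combination this / 3

theorem isPIntegralBasis_of_saturated (B : Module.Basis (Fin 4) ℚ K) {v : Fin 4 → K}
    (hint : ∀ i, IsIntegral ℤ (v i)) (hv : LinearIndependent ℚ v)
    (hsat : ∀ x : Fin 4 → ℤ, IsIntegral ℤ ((∑ i, (x i : K) * v i) / 3) → ∀ i, (3 : ℤ) ∣ x i) :
    IsPIntegralBasis 3 v := by
  refine ⟨hint, hv, fun z hz => ?_⟩
  obtain ⟨r, rfl⟩ := exists_coordinates B hv z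
  obtain ⟨k, m, hm, hkm⟩ := Nat.exists_eq_pow_mul_and_not_dvd (n := ∏ i, (r i).den)
    (Finset.prod_ne_zero_iff.mpr fun i _ => (r i).den_nz) 3 (by norm_num)
  refine ⟨r, fun i => not_dvd_den_of_saturated hsat k m hm r hz (fun j => ?_) i, rfl⟩
  obtain ⟨d, hd⟩ := Finset.dvd_prod_of_mem (fun i => (r i).den) (Finset.mem_univ j)
  have hd' : ((3 : ℚ) ^ k * m) = (r j).den * d := by exact_mod_cast hkm.symm.trans hd
  refine ⟨(r j).num * d, ?_⟩
  rw [hd']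
  have := Rat.mul_den_eq_num (r j)
  push_cast
  linear_combination (d : ℚ) * this

end Field

/-! ### Valuations above 3 -/

open scoped WithZero NumberField in
/-- A valuation above `3` that is positive on an integer whose norm is divisible by `3`. -/
theorem exists_valuation {K : Type*} [Field K] [NumberField K] {t : K} (ht : IsIntegral ℤ t) {n : ℤ}
    (hn : Algebra.norm ℚ t = n) (h3 : (3 : ℤ) ∣ n) :
    ∃ V : Valuation K ℤᵐ⁰, (∀ x, IsIntegral ℤ x → V x ≤ 1) ∧ V 3 < 1 ∧ V t < 1 := by
  let τ : 𝓞 K := ⟨t, ht⟩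
  have hτ : Algebra.norm ℤ τ = n := by
    have := Algebra.coe_norm_int τ
    rw [show ((τ : 𝓞 K) : K) = t from rfl, hn] at this
    exact_mod_cast this
  have hdvd : 3 ∣ (Ideal.span {τ}).absNorm := by
    rw [Ideal.absNorm_span_singleton, hτ]
    exact Int.natCast_dvd.mp h3
  obtain ⟨P, hP, hP3, hPt⟩ := Ideal.exists_isMaximal_dvd_of_dvd_absNorm' Nat.prime_three _ hdvd
  have h3P : (3 : 𝓞 K) ∈ P := by
    have : (3 : ℤ) ∈ P.under ℤ := by
      rw [hP3]; exact Ideal.mem_span_singleton_self _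
    simpa [Ideal.under, Ideal.mem_comap] using this
  have hbot : P ≠ ⊥ := by
    rintro rfl
    exact absurd ((Ideal.mem_bot).mp h3P) (by norm_num)
  let v : IsDedekindDomain.HeightOneSpectrum (𝓞 K) := ⟨P, hP.isPrime, hbot⟩
  refine ⟨v.valuation K, fun x hx => ?_, ?_, ?_⟩
  · exact v.valuation_le_one (K := K) (⟨x, hx⟩ : 𝓞 K)
  · rw [show (3 : K) = algebraMap (𝓞 K) K 3 from (map_ofNat _ 3).symm]
    exact (v.valuation_lt_one_iff_mem (K := K) (3 : 𝓞 K)).mpr h3P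
  · exact (v.valuation_lt_one_iff_mem (K := K) τ).mpr
      (Ideal.dvd_iff_le.mp hPt (Ideal.mem_span_singleton_self τ))

section Valuation

open scoped WithZero
open WithZero

variable {K : Type*} [Field K] {V : Valuation K ℤᵐ⁰}

theorem valuation_intCast_le_one (h1 : ∀ x, IsIntegral ℤ x → V x ≤ 1) (n : ℤ) : V n ≤ 1 :=
  h1 n (by simpa using isIntegral_algebraMap (R := ℤ) (A := K) (x := n))

theorem valuation_intCast_eq_one (h1 : ∀ x, IsIntegral ℤ x → V x ≤ 1) (h3 : V 3 < 1) {n : ℤ}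
    (hn : ¬ (3 : ℤ) ∣ n) : V n = 1 := by
  refine le_antisymm (valuation_intCast_le_one h1 n) ?_
  by_contra! hlt
  obtain ⟨u, w, huw⟩ := (Int.prime_three.coprime_iff_not_dvd).mpr hn
  have e : (1 : K) = u * 3 + w * n := by
    have := congrArg (Int.cast : ℤ → K) huw.symm
    push_cast at this
    exact this
  have : V 1 < 1 := by
    rw [e]
    refine V.map_add_lt ?_ ?_
    · rw [map_mul]
      exact (mul_le_of_le_one_left zero_le (valuation_intCast_le_one h1 u)).trans_lt h3
    · rw [map_mul]
      exact (mul_le_of_le_one_left zero_le (valuation_intCast_le_one h1 w)).trans_lt hlt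
  rw [map_one] at this
  exact lt_irrefl _ this

theorem three_dvd_of_valuation_lt_one (h1 : ∀ x, IsIntegral ℤ x → V x ≤ 1) (h3 : V 3 < 1) {n : ℤ}
    (hn : V n < 1) : (3 : ℤ) ∣ n := by
  by_contra h
  exact hn.ne (valuation_intCast_eq_one h1 h3 h)

theorem exists_valuation_eq_exp {x : K} (hx : x ≠ 0) (hlt : V x < 1) :
    ∃ n : ℤ, 0 < n ∧ V x = exp (-n) := by
  have h0 : V x ≠ 0 := (V.ne_zero_iff).mpr hx
  refine ⟨-log (V x), ?_, by rw [neg_neg, exp_log h0]⟩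
  have := (log_lt_log h0 one_ne_zero).mpr hlt
  rw [log_one] at this
  omega

/-- The valuation of a root, when the polygon at zero is one side from `(0, u₀)` to `(3, 0)`. -/
theorem valuation_root_of_one_side (h1 : ∀ x, IsIntegral ℤ x → V x ≤ 1) {e τ : ℤ}
    (he : 0 < e) (hτ : 0 < τ) {t : K} (hVt : V t = exp (-τ)) (hV3 : V 3 = exp (-e))
    {u₀ : ℕ} {x₀ x₁ x₂ a₃ : ℤ} (hx₀ : ¬ (3 : ℤ) ∣ x₀) (h₃ : ¬ (3 : ℤ) ∣ a₃)
    (ht : t ^ 4 + a₃ * t ^ 3 + (3 ^ (u₀ / 3 + 1) * x₂ : ℤ) * t ^ 2 +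
      (3 ^ (2 * u₀ / 3 + 1) * x₁ : ℤ) * t + (3 ^ u₀ * x₀ : ℤ) = 0) :
    3 * τ = e * u₀ ∧ V (t + a₃) = 1 := by
  have hlt3 : V 3 < 1 := by rw [hV3, ← exp_zero]; exact exp_lt_exp.mpr (by omega)
  have hltt : V t < 1 := by rw [hVt, ← exp_zero]; exact exp_lt_exp.mpr (by omega)
  have hpow : ∀ (k : ℕ) (x : ℤ), V ((3 ^ k * x : ℤ) : K) = exp (-(e * k)) * V (x : K) := by
    intro k x
    push_cast
    rw [map_mul, map_pow, hV3, ← exp_nsmul]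
    congr 2
    simp [mul_comm]
  have hVa : V (t + a₃) = 1 := by
    have := valuation_intCast_eq_one h1 hlt3 h₃
    rw [V.map_add_eq_of_lt_right (by rwa [this]), this]
  refine ⟨?_, hVa⟩
  have hV0 : V ((3 ^ u₀ * x₀ : ℤ) : K) = exp (-(e * u₀)) := by
    rw [hpow, valuation_intCast_eq_one h1 hlt3 hx₀, mul_one]
  -- A lower bound for the additive valuation of the middle terms a₁t + a₂t².
  set n : ℤ := min (e * ((2 * u₀ / 3 + 1 : ℕ) : ℤ) + τ) (e * ((u₀ / 3 + 1 : ℕ) : ℤ) + 2 * τ) with hn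
  set w := (3 ^ (2 * u₀ / 3 + 1) * x₁ : ℤ) * t + (3 ^ (u₀ / 3 + 1) * x₂ : ℤ) * t ^ 2 with hw
  have hVw : V w ≤ exp (-n) := by
    refine V.map_add_le ?_ ?_
    · rw [map_mul, hpow, hVt]
      calc _ ≤ exp (-(e * ((2 * u₀ / 3 + 1 : ℕ) : ℤ))) * 1 * exp (-τ) := by
            gcongr; exact valuation_intCast_le_one h1 _
        _ = exp (-(e * ((2 * u₀ / 3 + 1 : ℕ) : ℤ) + τ)) := by
            rw [mul_one, ← exp_add]; congr 1; ring
        _ ≤ _ := exp_le_exp.mpr (neg_le_neg (min_le_left _ _))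
    · rw [map_mul, hpow, map_pow, hVt]
      calc _ ≤ exp (-(e * ((u₀ / 3 + 1 : ℕ) : ℤ))) * 1 * exp (-τ) ^ 2 := by
            gcongr; exact valuation_intCast_le_one h1 _
        _ = exp (-(e * ((u₀ / 3 + 1 : ℕ) : ℤ) + 2 * τ)) := by
            rw [mul_one, ← exp_nsmul, ← exp_add]; congr 1; simp; ring
        _ ≤ _ := exp_le_exp.mpr (neg_le_neg (min_le_right _ _))
  have heq : V ((3 ^ u₀ * x₀ : ℤ) + w) = exp (-(3 * τ)) := by
    have : (3 ^ u₀ * x₀ : ℤ) + w = -(t ^ 3 * (t + a₃)) := by rw [hw]; linear_combination ht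
    rw [this, V.map_neg, map_mul, map_pow, hVt, hVa, mul_one, ← exp_nsmul]
    congr 1; simp
  have b₁ : 2 * (e * u₀) < 3 * (e * ((2 * u₀ / 3 + 1 : ℕ) : ℤ)) := by
    have : (2 * u₀ : ℤ) < 3 * ((2 * u₀ / 3 + 1 : ℕ) : ℤ) := by push_cast; omega
    nlinarith
  have b₂ : e * u₀ < 3 * (e * ((u₀ / 3 + 1 : ℕ) : ℤ)) := by
    have : (u₀ : ℤ) < 3 * ((u₀ / 3 + 1 : ℕ) : ℤ) := by push_cast; omega
    nlinarith
  generalize e * ((2 * u₀ / 3 + 1 : ℕ) : ℤ) = m₁ at *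
  generalize e * ((u₀ / 3 + 1 : ℕ) : ℤ) = m₂ at *
  generalize e * (u₀ : ℤ) = m₀ at *
  -- If the constant term dominates, it balances t³(t + a₃), which gives 3τ = e u₀. Otherwise 3τ ≥
  -- n, and the strict inequalities `b₁`, `b₂` contradict this.
  rcases lt_or_ge m₀ n with hlt | hge
  · have hlt' : V w < V ((3 ^ u₀ * x₀ : ℤ) : K) := by
      rw [hV0]; exact hVw.trans_lt (exp_lt_exp.mpr (by omega))
    rw [V.map_add_eq_of_lt_left hlt', hV0] at heq
    have := exp_injective heq
    omega
  · have : exp (-(3 * τ)) ≤ exp (-n) := by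
      rw [← heq]
      refine V.map_add_le ?_ hVw
      rw [hV0]; exact exp_le_exp.mpr (by omega)
    have := exp_le_exp.mp this
    omega

/-- With α, β distinct, positive and α < e, the two terms cannot cancel when x is prime to 3: a y
divisible by 3 pushes its term beyond e, and a unit y leaves the valuations different. -/
theorem three_dvd_of_valuation_add_le (h1 : ∀ x, IsIntegral ℤ x → V x ≤ 1) (h3 : V 3 < 1)
    {e α β : ℤ} (hV3 : V 3 = exp (-e)) (hαe : α < e) (hβ : 0 < β) (hne : α ≠ β) {A B : K}
    (hA : V A = exp (-α)) (hB : V B = exp (-β)) {x y : ℤ}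
    (h : V (x * A + y * B) ≤ exp (-e)) : (3 : ℤ) ∣ x := by
  by_contra hx
  have hxA : V (x * A) = exp (-α) := by
    rw [map_mul, valuation_intCast_eq_one h1 h3 hx, one_mul, hA]
  have hd : V (x * A) ≠ V (y * B) := by
    rw [hxA, map_mul, hB]
    by_cases hy : (3 : ℤ) ∣ y
    · obtain ⟨z, rfl⟩ := hy
      intro heq
      have : exp (-α) ≤ exp (-e) := by
        rw [heq]
        push_cast
        rw [map_mul, hV3]
        calc exp (-e) * V (z : K) * exp (-β) ≤ exp (-e) * 1 * 1 := by
              gcongr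
              · exact valuation_intCast_le_one h1 z
              · rw [← exp_zero]; exact exp_le_exp.mpr (by omega)
          _ = exp (-e) := by rw [mul_one, mul_one]
      have := exp_le_exp.mp this
      omega
    · rw [valuation_intCast_eq_one h1 h3 hy, one_mul]
      intro heq
      have := exp_injective heq
      omega
  rw [V.map_add_of_distinct_val hd, hxA] at h
  have := exp_le_exp.mp ((le_max_left _ _).trans h)
  omega

end Valuation

/-! ### Saturation when the cubic factor is totally ramified -/

section Field

open scoped WithZero
open WithZero

variable {K : Type*} [Field K] [NumberField K] {a b c : ℤ} {θ : K}

/-- The traces of the two quotients are 2a₂/3^ν₂ and a₁/3^ν₁, both divisible by 3 here, while Tr θ =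
0 and Tr 1 = 4. This supplies the condition that a valuation of the cubic factor alone cannot see.
-/
theorem three_dvd_of_trace (B : Module.Basis (Fin 4) ℚ K) (hB : ∀ i, B i = θ ^ (i : ℕ))
    (hθ : aeval θ (quartic a b c) = 0) {s z₁ z₂ : ℤ} {ν₁ ν₂ : ℕ}
    (h₁ : devCoeff (quartic a b c) s 1 = 3 ^ (ν₁ + 1) * z₁)
    (h₂ : devCoeff (quartic a b c) s 2 = 3 ^ (ν₂ + 1) * z₂) {x : Fin 4 → ℤ}
    (hx : IsIntegral ℤ ((∑ i, (x i : K) * tripleBasis 3 a b s θ ν₁ ν₂ i) / 3)) : (3 : ℤ) ∣ x 0 := by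
  obtain ⟨t0, t1, t2, t3⟩ := trace_root_pow B hB hθ
  obtain ⟨n, hn⟩ := IsIntegrallyClosed.isIntegral_iff.mp (Algebra.isIntegral_trace (L := ℚ) hx)
  rw [devCoeff_quartic_one] at h₁
  rw [devCoeff_quartic_two] at h₂
  have e₂ : Algebra.trace ℚ K (tripleBasis 3 a b s θ ν₁ ν₂ 2) = 2 * 3 * z₂ := by
    have : tripleBasis 3 a b s θ ν₁ ν₂ 2 = (1 / 3 ^ ν₂ : ℚ) • (θ ^ 2 + (2 * s : ℚ) • θ +
        (3 * s ^ 2 + a : ℚ) • (1 : K)) := by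
      simp only [tripleBasis, Matrix.cons_val, Algebra.smul_def, eq_ratCast]
      push_cast
      ring
    rw [this]
    simp only [map_add, map_smul, smul_eq_mul, t0, t1, t2]
    have h₂' : (6 * s ^ 2 + a : ℚ) = 3 ^ (ν₂ + 1) * z₂ := by exact_mod_cast h₂
    field_simp
    linear_combination 2 * h₂'
  have e₁ : Algebra.trace ℚ K (tripleBasis 3 a b s θ ν₁ ν₂ 3) = 3 * z₁ := by
    have : tripleBasis 3 a b s θ ν₁ ν₂ 3 = (1 / 3 ^ ν₁ : ℚ) • (θ ^ 3 + (s : ℚ) • θ ^ 2 +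
        (s ^ 2 + a : ℚ) • θ + (s ^ 3 + a * s + b : ℚ) • (1 : K)) := by
      simp only [tripleBasis, Matrix.cons_val, Algebra.smul_def, eq_ratCast]
      push_cast
      ring
    rw [this]
    simp only [map_add, map_smul, smul_eq_mul, t0, t1, t2, t3]
    have h₁' : (4 * s ^ 3 + 2 * a * s + b : ℚ) = 3 ^ (ν₁ + 1) * z₁ := by exact_mod_cast h₁
    field_simp
    linear_combination h₁'
  have hsum : (∑ i, (x i : K) * tripleBasis 3 a b s θ ν₁ ν₂ i) / 3 = (1 / 3 : ℚ) •
      ((x 0 : ℚ) • (1 : K) + (x 1 : ℚ) • θ + (x 2 : ℚ) • tripleBasis 3 a b s θ ν₁ ν₂ 2 +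
        (x 3 : ℚ) • tripleBasis 3 a b s θ ν₁ ν₂ 3) := by
    simp only [Fin.sum_univ_four, Algebra.smul_def, eq_ratCast]
    rw [show tripleBasis 3 a b s θ ν₁ ν₂ 0 = 1 from rfl,
      show tripleBasis 3 a b s θ ν₁ ν₂ 1 = θ from rfl]
    push_cast
    ring
  rw [hsum] at hn
  simp only [map_add, map_smul, smul_eq_mul, t0, t1, e₁, e₂, eq_intCast] at hn
  have : 3 * n = 4 * x 0 + 6 * (x 2 * z₂) + 3 * (x 3 * z₁) := by
    have : (3 * n : ℚ) = 4 * x 0 + 6 * (x 2 * z₂) + 3 * (x 3 * z₁) := by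
      rw [hn]; ring
    exact_mod_cast this
  omega

/-- The trace gives 3 ∣ x 0, reduction modulo the prime gives 3 ∣ x 1, and the last two coordinates
separate because the valuations of their members are different fractions of e. -/
theorem saturated_of_one_side (B : Module.Basis (Fin 4) ℚ K) (hB : ∀ i, B i = θ ^ (i : ℕ))
    (hθ : aeval θ (quartic a b c) = 0) {s : ℤ} (hc : IsCubicAt (quartic a b c) s)
    {u₀ : ℕ} {x₀ x₁ x₂ : ℤ} (hu : ¬ 3 ∣ u₀)
    (h₀ : devCoeff (quartic a b c) s 0 = 3 ^ u₀ * x₀) (hx₀ : ¬ (3 : ℤ) ∣ x₀)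
    (h₁ : devCoeff (quartic a b c) s 1 = 3 ^ (2 * u₀ / 3 + 1) * x₁)
    (h₂ : devCoeff (quartic a b c) s 2 = 3 ^ (u₀ / 3 + 1) * x₂)
    (x : Fin 4 → ℤ)
    (hx : IsIntegral ℤ ((∑ i, (x i : K) * tripleBasis 3 a b s θ (2 * u₀ / 3) (u₀ / 3) i) / 3))
    (i : Fin 4) : (3 : ℤ) ∣ x i := by
  have hd₀ := three_dvd_of_trace B hB hθ h₁ h₂ hx
  have ht_int : IsIntegral ℤ (θ - s) :=
    (isIntegral_root hθ).sub (by simpa using isIntegral_algebraMap (R := ℤ) (A := K) (x := s))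
  obtain ⟨V, h1, h3, hVlt⟩ := exists_valuation ht_int (norm_root_sub B hB hθ s) hc.dvd_zero
  have ht : (θ - s) ^ 4 + (devCoeff (quartic a b c) s 3 : ℤ) * (θ - s) ^ 3 +
      (devCoeff (quartic a b c) s 2 : ℤ) * (θ - s) ^ 2 +
      (devCoeff (quartic a b c) s 1 : ℤ) * (θ - s) + (devCoeff (quartic a b c) s 0 : ℤ) = 0 := by
    rw [devCoeff_quartic_zero, devCoeff_quartic_one, devCoeff_quartic_two, devCoeff_quartic_three]
    rw [aeval_quartic] at hθ
    push_cast
    linear_combination hθ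
  have ht0 : θ - s ≠ 0 := by
    intro h0
    rw [h0] at ht
    apply hc.ne_zero
    have : ((devCoeff (quartic a b c) s 0 : ℤ) : K) = 0 := by linear_combination ht
    exact_mod_cast this
  obtain ⟨τ, hτ, hVt⟩ := exists_valuation_eq_exp ht0 hVlt
  obtain ⟨e, he, hV3⟩ := exists_valuation_eq_exp (by norm_num) h3
  have ht' := ht
  rw [h₀, h₁, h₂] at ht'
  obtain ⟨h3τ, hVa⟩ := valuation_root_of_one_side h1 he hτ hVt hV3 hx₀ hc.three ht'
  set ν₁ := 2 * u₀ / 3 with hν₁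
  set ν₂ := u₀ / 3 with hν₂
  have hpow : ∀ (k : ℕ) (x : ℤ), V ((3 ^ k * x : ℤ) : K) = exp (-(e * k)) * V (x : K) := by
    intro k x
    push_cast
    rw [map_mul, map_pow, hV3, ← exp_nsmul]
    congr 2
    simp [mul_comm]
  have hdiv : ∀ (q : K) (k : ℕ) (m : ℤ), V q = exp (-m) → V (q / 3 ^ k) = exp (-(m - e * k)) := by
    intro q k m hq
    rw [map_div₀, hq, map_pow, hV3, ← exp_nsmul, ← exp_sub]
    congr 1
    simp; ring
  have hV2 : V (tripleBasis 3 a b s θ ν₁ ν₂ 2) = exp (-(τ - e * ν₂)) := by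
    have hlt : V ((3 ^ (ν₂ + 1) * x₂ : ℤ) : K) < V ((θ - s) * ((θ - s) +
        (devCoeff (quartic a b c) s 3 : ℤ))) := by
      rw [map_mul, hVt, hVa, hpow, mul_one]
      calc _ ≤ exp (-(e * (ν₂ + 1 : ℕ))) * 1 := by
            gcongr; exact valuation_intCast_le_one h1 _
        _ < _ := by
            rw [mul_one]
            refine exp_lt_exp.mpr ?_
            have : (u₀ : ℤ) < 3 * ((ν₂ + 1 : ℕ) : ℤ) := by push_cast; omega
            nlinarith
    have hq : V ((θ - s) * ((θ - s) + (devCoeff (quartic a b c) s 3 : ℤ)) +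
        (3 ^ (ν₂ + 1) * x₂ : ℤ)) = exp (-τ) := by
      rw [V.map_add_eq_of_lt_left hlt, map_mul, hVt, hVa, mul_one]
    rw [← hdiv _ _ _ hq, ← h₂, devCoeff_quartic_two, devCoeff_quartic_three]
    congr 1
    simp only [tripleBasis, Matrix.cons_val]
    push_cast
    ring
  have hV1 : V (tripleBasis 3 a b s θ ν₁ ν₂ 3) = exp (-(2 * τ - e * ν₁)) := by
    have hq : V (-((3 ^ u₀ * x₀ : ℤ) : K) / (θ - s)) = exp (-(2 * τ)) := by
      rw [map_div₀, V.map_neg, hpow, valuation_intCast_eq_one h1 h3 hx₀, mul_one, hVt, ← exp_sub]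
      congr 1
      linarith
    rw [← hdiv _ _ _ hq, ← h₀]
    congr 1
    rw [show -((devCoeff (quartic a b c) s 0 : ℤ) : K) / (θ - s) = (θ - s) ^ 3 +
      (devCoeff (quartic a b c) s 3 : ℤ) * (θ - s) ^ 2 + (devCoeff (quartic a b c) s 2 : ℤ) * (θ - s) +
      (devCoeff (quartic a b c) s 1 : ℤ) by rw [div_eq_iff ht0]; linear_combination -ht,
      devCoeff_quartic_one, devCoeff_quartic_two, devCoeff_quartic_three]
    simp only [tripleBasis, Matrix.cons_val]
    push_cast
    ring
  -- The fractional parts of u₀/3 and 2u₀/3 are 1/3 and 2/3 in some order.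
  have hmod : 3 * (τ - e * ν₂) = e ∧ 3 * (2 * τ - e * ν₁) = 2 * e ∨
      3 * (τ - e * ν₂) = 2 * e ∧ 3 * (2 * τ - e * ν₁) = e := by
    have : u₀ = 3 * ν₂ + 1 ∧ 2 * u₀ = 3 * ν₁ + 2 ∨ u₀ = 3 * ν₂ + 2 ∧ 2 * u₀ = 3 * ν₁ + 1 := by omega
    rcases this with ⟨e₁, e₂⟩ | ⟨e₁, e₂⟩
    · left
      zify at e₁ e₂
      constructor
      · linear_combination h3τ + e * e₁
      · linear_combination 2 * h3τ + e * e₂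
    · right
      zify at e₁ e₂
      constructor
      · linear_combination h3τ + e * e₁
      · linear_combination 2 * h3τ + e * e₂
  generalize τ - e * ν₂ = α at hV2 hmod
  generalize 2 * τ - e * ν₁ = β at hV1 hmod
  have hsum : ∑ i, (x i : K) * tripleBasis 3 a b s θ ν₁ ν₂ i = x 0 + x 1 * θ +
      (x 2 * tripleBasis 3 a b s θ ν₁ ν₂ 2 + x 3 * tripleBasis 3 a b s θ ν₁ ν₂ 3) := by
    rw [Fin.sum_univ_four, show tripleBasis 3 a b s θ ν₁ ν₂ 0 = 1 from rfl,
      show tripleBasis 3 a b s θ ν₁ ν₂ 1 = θ from rfl]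
    ring
  have hVsum : V (∑ i, (x i : K) * tripleBasis 3 a b s θ ν₁ ν₂ i) ≤ exp (-e) := by
    have := h1 _ hx
    rw [map_div₀, hV3] at this
    rwa [div_le_one₀ exp_pos] at this
  have hlt_one : ∀ {m : ℤ}, 0 < m → exp (-m) < 1 := fun hm => by
    rw [← exp_zero]; exact exp_lt_exp.mpr (by omega)
  have hmul : ∀ (n : ℤ) (q : K) (m : ℤ), V q = exp (-m) → V (n * q) ≤ exp (-m) := by
    intro n q m hq
    rw [map_mul, hq]
    exact mul_le_of_le_one_left zero_le (valuation_intCast_le_one h1 n)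
  have hd₁ : (3 : ℤ) ∣ x 1 := by
    -- Modulo the prime θ becomes s and the last two members vanish; a₃ = 4s being a unit then
    -- isolates x 1.
    have hlt : V ((x 0 + s * x 1 : ℤ) : K) < 1 := by
      have e' : ((x 0 + s * x 1 : ℤ) : K) = ∑ i, (x i : K) * tripleBasis 3 a b s θ ν₁ ν₂ i -
          (x 1 * (θ - s) + (x 2 * tripleBasis 3 a b s θ ν₁ ν₂ 2 +
            x 3 * tripleBasis 3 a b s θ ν₁ ν₂ 3)) := by
        rw [hsum]; push_cast; ring
      rw [e']
      refine V.map_sub_lt (hVsum.trans_lt (hlt_one he)) (V.map_add_lt ?_ (V.map_add_lt ?_ ?_))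
      · exact (hmul _ _ _ hVt).trans_lt (hlt_one hτ)
      · exact (hmul _ _ _ hV2).trans_lt (hlt_one (by omega))
      · exact (hmul _ _ _ hV1).trans_lt (hlt_one (by omega))
    have hd := (dvd_add_right hd₀).mp (three_dvd_of_valuation_lt_one h1 h3 hlt)
    refine (Int.prime_three.dvd_or_dvd hd).resolve_left fun hs => hc.three ?_
    rw [devCoeff_quartic_three]
    exact hs.mul_left 4
  have hV23 : V (x 2 * tripleBasis 3 a b s θ ν₁ ν₂ 2 + x 3 * tripleBasis 3 a b s θ ν₁ ν₂ 3) ≤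
      exp (-e) := by
    have e' : x 2 * tripleBasis 3 a b s θ ν₁ ν₂ 2 + x 3 * tripleBasis 3 a b s θ ν₁ ν₂ 3 =
        ∑ i, (x i : K) * tripleBasis 3 a b s θ ν₁ ν₂ i - (x 0 + x 1 * θ) := by
      rw [hsum]; ring
    have hmul3 : ∀ q : K, V q ≤ 1 → V (3 * q) ≤ exp (-e) := by
      intro q hq
      rw [map_mul, hV3]
      exact mul_le_of_le_one_right zero_le hq
    obtain ⟨y₀, hy₀⟩ := hd₀
    obtain ⟨y₁, hy₁⟩ := hd₁
    rw [e']
    refine V.map_sub_le hVsum (V.map_add_le ?_ ?_)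
    · rw [hy₀]; push_cast; exact hmul3 _ (valuation_intCast_le_one h1 _)
    · rw [hy₁]
      push_cast
      rw [mul_assoc]
      refine hmul3 _ ?_
      rw [map_mul]
      exact mul_le_one' (valuation_intCast_le_one h1 _) (h1 _ (isIntegral_root hθ))
  fin_cases i
  · exact hd₀
  · exact hd₁
  · exact three_dvd_of_valuation_add_le h1 h3 hV3 (by omega) (by omega) (by omega) hV2 hV1 hV23
  · rw [add_comm] at hV23
    exact three_dvd_of_valuation_add_le h1 h3 hV3 (by omega) (by omega) (by omega) hV1 hV2 hV23

end Field

/-! ### From values and `vp` to divisibility of Taylor coefficients -/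

theorem devCoeff_zero_eq_eval (F : ℤ[X]) (s : ℤ) : devCoeff F s 0 = F.eval s :=
  taylor_coeff_zero ..

theorem devCoeff_one_eq_eval (F : ℤ[X]) (s : ℤ) : devCoeff F s 1 = (derivative F).eval s :=
  taylor_coeff_one ..

section Valuation

theorem three_pow_dvd_iff {m : ℕ} {n : ℤ} : (3 : ℤ) ^ m ∣ n ↔ (m : ℕ∞) ≤ vp 3 n := by
  rw [vp, ← pow_dvd_iff_le_emultiplicity]; rfl

theorem vp_three_eq_iff {m : ℕ} {n : ℤ} :
    vp 3 n = m ↔ ∃ x, n = 3 ^ m * x ∧ ¬ (3 : ℤ) ∣ x := by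
  rw [vp, emultiplicity_eq_coe]
  constructor
  · rintro ⟨⟨x, hx⟩, h⟩
    refine ⟨x, hx, ?_⟩
    rintro ⟨y, rfl⟩
    exact h ⟨y, by rw [hx]; push_cast; ring⟩
  · rintro ⟨x, rfl, hx⟩
    refine ⟨⟨x, rfl⟩, ?_⟩
    rintro ⟨y, hy⟩
    exact absurd (le_of_three_pow_mul_eq (n := m + 1) (x := y) (by rw [hy]; rfl) hx) (by omega)

theorem vp_three_eq_of_dvd {m : ℕ} {n : ℤ} (h : (3 : ℤ) ^ m ∣ n) (h' : ¬ (3 : ℤ) ^ (m + 1) ∣ n) :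
    vp 3 n = m := by
  rw [three_pow_dvd_iff, not_le] at h'
  rw [three_pow_dvd_iff] at h
  exact le_antisymm (by exact_mod_cast Order.le_of_lt_add_one h') h

theorem two_mul_lt_three_mul_iff {u : ℕ} {v : ℕ∞} :
    2 * (u : ℕ∞) < 3 * v ↔ ((2 * u / 3 + 1 : ℕ) : ℕ∞) ≤ v := by
  cases v with
  | top =>
    simp only [le_top, iff_true]
    rw [ENat.mul_top (by norm_num)]
    exact_mod_cast ENat.natCast_lt_top (2 * u)
  | coe v =>
    norm_cast
    omega

theorem le_of_lt_six_mul {Δ m : ℕ} {v : ℕ∞} (h : (Δ : ℕ∞) < 6 * v) (hm : 6 * m ≤ Δ + 6) :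
    (m : ℕ∞) ≤ v := by
  cases v with
  | top => exact le_top
  | coe v =>
    norm_cast at h ⊢
    omega

end Valuation

/-! ### The iteration at a regular integer -/

section Iteration

variable {F : ℤ[X]} {s t : ℤ}

theorem iterReaches_eq_of_regular (h : IsRegularAt 3 F s) (hst : IterReaches 3 F s t) : t = s := by
  rcases Relation.ReflTransGen.cases_head hst with rfl | ⟨r, hr, -⟩
  · rfl
  · exact absurd hr (not_iterStep_of_regular h)

theorem iterSucceeds_of_regular (h : IsRegularAt 3 F s) : IterSucceeds 3 F s := by
  refine ⟨fun t hst ht => absurd h ?_, ?_⟩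
  · rwa [← iterReaches_eq_of_regular h hst]
  · rintro ⟨r, rfl, hr⟩
    exact not_iterStep_of_regular h (hr 0)

end Iteration

/-! ### Bounds and exact values of the discriminant -/

section Discriminant

variable {a b c s : ℤ}

theorem devCoeff_zero_ne (hirr : Irreducible (quartic a b c)) (r : ℤ) :
    devCoeff (quartic a b c) r 0 ≠ 0 := by
  rw [devCoeff_zero_eq_eval]
  intro h0
  have hd := dvd_iff_isRoot.mpr h0
  have := hirr.dvd_iff.mp hd
  have hdeg := natDegree_quartic a b c
  rcases this with h | h
  · exact not_isUnit_X_sub_C r h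
  · have := natDegree_eq_of_degree_eq (degree_eq_degree_of_associated h)
    rw [natDegree_X_sub_C] at this
    omega

theorem isCubicAt_of_dvd (hne : ∀ r, devCoeff (quartic a b c) r 0 ≠ 0) (hs : ¬ (3 : ℤ) ∣ s)
    {e₀ e₁ e₂ : ℕ} (he₀ : 0 < e₀) (he₁ : 0 < e₁) (he₂ : 0 < e₂)
    (h₀ : (3 : ℤ) ^ e₀ ∣ devCoeff (quartic a b c) s 0)
    (h₁ : (3 : ℤ) ^ e₁ ∣ devCoeff (quartic a b c) s 1)
    (h₂ : (3 : ℤ) ^ e₂ ∣ devCoeff (quartic a b c) s 2) : IsCubicAt (quartic a b c) s := by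
  refine ⟨devCoeff_quartic_four .., devCoeff_quartic_high a b c s, ?_, hne s,
    (dvd_pow_self 3 he₀.ne').trans h₀, (dvd_pow_self 3 he₁.ne').trans h₁,
    (dvd_pow_self 3 he₂.ne').trans h₂⟩
  rw [devCoeff_quartic_three]
  omega

/-- A crude lower bound for Δ, usable before the exact shape of the polygon is known. -/
theorem three_pow_dvd_discPoly {e₀ e₁ e₂ N : ℕ} (he₀ : 0 < e₀) (he₁ : 0 < e₁) (he₂ : 1 < e₂)
    (h₀ : (3 : ℤ) ^ e₀ ∣ devCoeff (quartic a b c) s 0)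
    (h₁ : (3 : ℤ) ^ e₁ ∣ devCoeff (quartic a b c) s 1)
    (h₂ : (3 : ℤ) ^ e₂ ∣ devCoeff (quartic a b c) s 2)
    (hN₀ : N ≤ 2 * e₀ + 1) (hN₁ : N ≤ 3 * e₁) (hN₂ : N ≤ 6 * e₂) :
    (3 : ℤ) ^ N ∣ discPoly c b a 0 := by
  obtain ⟨A, h₀⟩ := h₀
  obtain ⟨B, h₁⟩ := h₁
  obtain ⟨C, h₂⟩ := h₂
  rw [← discPoly_quartic a b c s, discPoly, h₀, h₁, h₂]
  set D := devCoeff (quartic a b c) s 3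
  refine dvd_add (pow_dvd_discRest A B C D (by omega) (by omega) (by omega) (by omega) (by omega)
    (by omega) (by omega) (by omega) (by omega) (by omega) (by omega) (by omega) (by omega))
    (dvd_sub (dvd_sub ?_ ?_) ?_)
  · exact (pow_dvd_pow 3 (show N ≤ 2 * e₂ + 2 * e₁ by omega)).trans
      ⟨D ^ 2 * C ^ 2 * B ^ 2, by ring⟩
  · exact (pow_dvd_pow 3 (show N ≤ 3 * e₂ + e₀ by omega)).trans ⟨4 * D ^ 2 * C ^ 3 * A, by ring⟩
  · exact (pow_dvd_pow 3 hN₁).trans ⟨4 * D ^ 3 * B ^ 3, by ring⟩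

/-- The value of the discriminant if the polygon has a vertex at the abscissa `1`. -/
theorem disc_of_vertex_one (h : IsCubicAt (quartic a b c) s) {u₀ u₁ : ℕ} {x₀ x₁ x₂ : ℤ}
    (h₀ : devCoeff (quartic a b c) s 0 = 3 ^ u₀ * x₀)
    (h₁ : devCoeff (quartic a b c) s 1 = 3 ^ u₁ * x₁) (hx₁ : ¬ (3 : ℤ) ∣ x₁)
    (h₂ : devCoeff (quartic a b c) s 2 = 3 ^ (u₁ / 2 + 1) * x₂) (hu : 3 * u₁ ≤ 2 * u₀) :
    ∃ x, discPoly c b a 0 = 3 ^ (3 * u₁) * x ∧ ¬ (3 : ℤ) ∣ x := by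
  have hu₁ : 0 < u₁ := by
    by_contra! h0
    obtain rfl : u₁ = 0 := by omega
    have := h.dvd_one
    rw [h₁] at this
    exact hx₁ (by simpa using this)
  set D := devCoeff (quartic a b c) s 3 with hD
  obtain ⟨z, hz⟩ := pow_dvd_discRest (e₀ := u₀) (e₁ := u₁) (e₂ := u₁ / 2 + 1) (N := 3 * u₁ + 1)
    x₀ x₁ x₂ D (by omega) (by omega) (by omega) (by omega) (by omega) (by omega) (by omega)
    (by omega) (by omega) (by omega) (by omega) (by omega) (by omega)
  obtain ⟨f, hf⟩ := Nat.exists_eq_add_of_le (show 3 * u₁ + 1 ≤ 2 * (u₁ / 2 + 1) + 2 * u₁ by omega)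
  obtain ⟨g, hg⟩ := Nat.exists_eq_add_of_le (show 3 * u₁ + 1 ≤ 3 * (u₁ / 2 + 1) + u₀ by omega)
  have pf : ((3 : ℤ) ^ (u₁ / 2 + 1)) ^ 2 * (3 ^ u₁) ^ 2 = 3 ^ (3 * u₁ + 1) * 3 ^ f := by
    rw [← pow_add, ← hf]; ring
  have pg : ((3 : ℤ) ^ (u₁ / 2 + 1)) ^ 3 * 3 ^ u₀ = 3 ^ (3 * u₁ + 1) * 3 ^ g := by
    rw [← pow_add, ← hg]; ring
  -- Only -4a₃³a₁³ has value exactly 3u₁; -4 is split as -3 - 1 so that the unit part is visible.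
  refine ⟨3 * (z + D ^ 2 * x₂ ^ 2 * x₁ ^ 2 * 3 ^ f - 4 * D ^ 2 * x₂ ^ 3 * x₀ * 3 ^ g -
    D ^ 3 * x₁ ^ 3) - D ^ 3 * x₁ ^ 3, ?_, ?_⟩
  · rw [← discPoly_quartic a b c s, discPoly, h₀, h₁, h₂, ← hD, hz]
    linear_combination D ^ 2 * x₂ ^ 2 * x₁ ^ 2 * pf - 4 * D ^ 2 * x₂ ^ 3 * x₀ * pg
  · intro hdvd
    rcases Int.prime_three.dvd_or_dvd ((dvd_sub_right (dvd_mul_right 3 _)).mp hdvd) with h' | h'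
    · exact h.three (Int.prime_three.dvd_of_dvd_pow h')
    · exact hx₁ (Int.prime_three.dvd_of_dvd_pow h')

end Discriminant

/-! ### The 3-integral basis in each of the three shapes -/

section Bases

variable {K : Type*} [Field K] [NumberField K] {a b c s : ℤ} {θ : K}

/-- The discriminant of the family has value 3u₁ - 2(u₁ + ⌊u₁/2⌋), which is the parity of u₁. -/
theorem isPIntegralBasis_of_vertex_one (B : Module.Basis (Fin 4) ℚ K)
    (hB : ∀ i, B i = θ ^ (i : ℕ)) (hθ : aeval θ (quartic a b c) = 0)
    (h : IsCubicAt (quartic a b c) s) {u₀ u₁ : ℕ} {x₀ x₁ x₂ : ℤ}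
    (h₀ : devCoeff (quartic a b c) s 0 = 3 ^ u₀ * x₀)
    (h₁ : devCoeff (quartic a b c) s 1 = 3 ^ u₁ * x₁) (hx₁ : ¬ (3 : ℤ) ∣ x₁)
    (h₂ : devCoeff (quartic a b c) s 2 = 3 ^ (u₁ / 2 + 1) * x₂) (hu : 3 * u₁ ≤ 2 * u₀) :
    IsPIntegralBasis 3 (tripleBasis 3 a b s θ u₁ (u₁ / 2)) := by
  obtain ⟨x, hD, hx⟩ := disc_of_vertex_one h h₀ h₁ hx₁ h₂ hu
  have hd := ne_zero_of_eq_three_pow_mul hD hx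
  refine isPIntegralBasis_of_discr B (isIntegral_tripleBasis hθ ?_ ?_ ?_ ?_ ?_ ?_)
    (linearIndependent_tripleBasis B hB hθ hd _ _ _) (discr_tripleBasis B hB hθ _ _ _) hD hx
    (by omega)
  · exact ⟨_, h₁⟩
  · rw [h₀, h₂]
    exact (pow_dvd_pow 3 (show 2 * u₁ ≤ u₀ + (u₁ / 2 + 1) by omega)).trans ⟨x₀ * x₂, by ring⟩
  · rw [h₀]
    exact (pow_dvd_pow 3 (show 3 * u₁ ≤ 2 * u₀ by omega)).trans ⟨x₀ ^ 2, by ring⟩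
  · exact (pow_dvd_pow 3 (by omega)).trans ⟨_, h₂⟩
  · exact (pow_dvd_pow 3 (by omega)).trans ⟨_, h₁⟩
  · exact (pow_dvd_pow 3 (by omega)).trans ⟨_, h₀⟩

theorem isPIntegralBasis_of_one_side (B : Module.Basis (Fin 4) ℚ K)
    (hB : ∀ i, B i = θ ^ (i : ℕ)) (hθ : aeval θ (quartic a b c) = 0) (hd : discPoly c b a 0 ≠ 0)
    (h : IsCubicAt (quartic a b c) s) {u₀ : ℕ} {x₀ x₁ x₂ : ℤ} (hu : ¬ 3 ∣ u₀)
    (h₀ : devCoeff (quartic a b c) s 0 = 3 ^ u₀ * x₀) (hx₀ : ¬ (3 : ℤ) ∣ x₀)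
    (h₁ : devCoeff (quartic a b c) s 1 = 3 ^ (2 * u₀ / 3 + 1) * x₁)
    (h₂ : devCoeff (quartic a b c) s 2 = 3 ^ (u₀ / 3 + 1) * x₂) :
    IsPIntegralBasis 3 (tripleBasis 3 a b s θ (2 * u₀ / 3) (u₀ / 3)) := by
  have hint := isIntegral_tripleBasis hθ (s := s) (ν₁ := 2 * u₀ / 3) (ν₂ := u₀ / 3)
    ((pow_dvd_pow 3 (by omega)).trans ⟨_, h₁⟩)
    (by
      rw [h₀, h₂]
      exact (pow_dvd_pow 3 (show 2 * (2 * u₀ / 3) ≤ u₀ + (u₀ / 3 + 1) by omega)).trans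
        ⟨x₀ * x₂, by ring⟩)
    (by
      rw [h₀]
      exact (pow_dvd_pow 3 (show 3 * (2 * u₀ / 3) ≤ 2 * u₀ by omega)).trans ⟨x₀ ^ 2, by ring⟩)
    ((pow_dvd_pow 3 (by omega)).trans ⟨_, h₂⟩) ((pow_dvd_pow 3 (by omega)).trans ⟨_, h₁⟩)
    ((pow_dvd_pow 3 (by omega)).trans ⟨_, h₀⟩)
  exact isPIntegralBasis_of_saturated B hint (linearIndependent_tripleBasis B hB hθ hd _ _ _)
    (saturated_of_one_side B hB hθ h hu h₀ hx₀ h₁ h₂)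

/-- The discriminant of the family has value 2n + μ - 2(⌊μ/2⌋ + n), the parity of μ. -/
theorem isPIntegralBasis_of_doubleData (B : Module.Basis (Fin 4) ℚ K)
    (hB : ∀ i, B i = θ ^ (i : ℕ)) (hθ : aeval θ (quartic a b c) = 0) {n m μ : ℕ}
    (hs : IsDoubleAt a b c s n m) (h : DoubleData a b c s n μ) :
    IsPIntegralBasis 3 (tripleBasis 3 a b s θ (μ / 2) n) := by
  obtain ⟨x, hD, hx⟩ := h.disc
  obtain ⟨x₂, h₂, -⟩ := hs.two
  obtain ⟨x₀, h₀⟩ := h.zero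
  have hle := h.le
  have hd := ne_zero_of_eq_three_pow_mul hD hx
  refine isPIntegralBasis_of_discr B (isIntegral_tripleBasis hθ ?_ ?_ ?_ ?_ ?_ ?_)
    (linearIndependent_tripleBasis B hB hθ hd _ _ _) (discr_tripleBasis B hB hθ _ _ _) hD hx
    (by omega)
  · exact (pow_dvd_pow 3 (by omega)).trans h.one
  · rw [h₀, h₂]
    exact (pow_dvd_pow 3 (show 2 * (μ / 2) ≤ μ - n + n by omega)).trans ⟨x₀ * x₂, by ring⟩
  · rw [h₀]
    exact (pow_dvd_pow 3 (show 3 * (μ / 2) ≤ 2 * (μ - n) by omega)).trans ⟨x₀ ^ 2, by ring⟩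
  · exact ⟨_, h₂⟩
  · exact (pow_dvd_pow 3 (by omega)).trans h.one
  · exact (pow_dvd_pow 3 (by omega)).trans h.zero

end Bases

/-! ### The starting point and the first shift -/

section Start

variable {a b c s₀ s₁ : ℤ} {Δ u₀ k : ℕ}

/-- The situation of an irregular starting point `s₀`: one side of slope `-k`. The integer `y` is
the triple root of the residual polynomial modulo `3`. -/
structure IsTripleAt (a b c s₀ : ℤ) (k : ℕ) (σ y : ℤ) : Prop where
  pos : 0 < k
  ndvd : ¬ (3 : ℤ) ∣ s₀
  zero : devCoeff (quartic a b c) s₀ 0 = 3 ^ (3 * k) * σ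
  one : (3 : ℤ) ^ (2 * k + 1) ∣ devCoeff (quartic a b c) s₀ 1
  two : (3 : ℤ) ^ (k + 1) ∣ devCoeff (quartic a b c) s₀ 2
  sq : y ^ 2 = 1
  root : (3 : ℤ) ∣ σ + devCoeff (quartic a b c) s₀ 3 * y

namespace IsTripleAt

variable {σ y : ℤ}

theorem shift_ndvd (h : IsTripleAt a b c s₀ k σ y) : ¬ (3 : ℤ) ∣ s₀ + y * 3 ^ k :=
  fun hd => h.ndvd ((dvd_add_left ((dvd_pow_self 3 h.pos.ne').mul_left y)).mp hd)

theorem shift_zero (h : IsTripleAt a b c s₀ k σ y) :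
    (3 : ℤ) ^ (3 * k + 1) ∣ devCoeff (quartic a b c) (s₀ + y * 3 ^ k) 0 := by
  obtain ⟨j, rfl⟩ := Nat.exists_eq_add_of_lt h.pos
  obtain ⟨x₁, h₁⟩ := h.one
  obtain ⟨x₂, h₂⟩ := h.two
  obtain ⟨z, hz⟩ := h.root
  rw [devCoeff_shift_zero, h.zero, h₁, h₂]
  refine ⟨x₁ * y + x₂ + z + 3 ^ j, ?_⟩
  have hy := h.sq
  have hσ : σ = 3 * z - devCoeff (quartic a b c) s₀ 3 * y := by linear_combination hz
  rw [hσ]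
  linear_combination (3 ^ (3 * (0 + j + 1) + 1) * x₂ + devCoeff (quartic a b c) s₀ 3 * y *
    3 ^ (3 * (0 + j + 1)) + (y ^ 2 + 1) * 3 ^ (4 * (0 + j + 1))) * hy

theorem shift_one (h : IsTripleAt a b c s₀ k σ y) :
    (3 : ℤ) ^ (2 * k + 1) ∣ devCoeff (quartic a b c) (s₀ + y * 3 ^ k) 1 := by
  obtain ⟨j, rfl⟩ := Nat.exists_eq_add_of_lt h.pos
  obtain ⟨x₁, h₁⟩ := h.one
  obtain ⟨x₂, h₂⟩ := h.two
  rw [devCoeff_shift_one, h₁, h₂]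
  exact ⟨x₁ + 2 * x₂ * y + devCoeff (quartic a b c) s₀ 3 * y ^ 2 + 4 * y ^ 3 * 3 ^ j, by ring⟩

theorem shift_two (h : IsTripleAt a b c s₀ k σ y) :
    (3 : ℤ) ^ (k + 1) ∣ devCoeff (quartic a b c) (s₀ + y * 3 ^ k) 2 := by
  obtain ⟨x₂, h₂⟩ := h.two
  rw [devCoeff_shift_two, h₂]
  exact ⟨x₂ + devCoeff (quartic a b c) s₀ 3 * y + 2 * y ^ 2 * 3 ^ k, by ring⟩

theorem isCubicAt_shift (h : IsTripleAt a b c s₀ k σ y)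
    (hne : ∀ r, devCoeff (quartic a b c) r 0 ≠ 0) : IsCubicAt (quartic a b c) (s₀ + y * 3 ^ k) :=
  isCubicAt_of_dvd hne h.shift_ndvd (Nat.succ_pos _) (Nat.succ_pos _) (Nat.succ_pos _)
    h.shift_zero h.shift_one h.shift_two

/-- High divisibility of a₀ and a₁ at s₁ forces Δ ≥ 6k + 6, hence 3^(k+2) divides a₂ at s₀. The
shift adds 3a₃y3^k, whose value is exactly k + 1, so the point (2, k+1) appears. -/
theorem isDoubleAt_shift (h : IsTripleAt a b c s₀ k σ y)
    (hne : ∀ r, devCoeff (quartic a b c) r 0 ≠ 0) {x : ℤ}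
    (hD : discPoly c b a 0 = 3 ^ Δ * x) (hx : ¬ (3 : ℤ) ∣ x)
    (h₂ : (3 : ℤ) ^ (Δ / 6 + 1) ∣ devCoeff (quartic a b c) s₀ 2)
    (h₀ : (3 : ℤ) ^ (3 * k + 3) ∣ devCoeff (quartic a b c) (s₀ + y * 3 ^ k) 0)
    (h₁ : (3 : ℤ) ^ (2 * k + 2) ∣ devCoeff (quartic a b c) (s₀ + y * 3 ^ k) 1) :
    IsDoubleAt a b c (s₀ + y * 3 ^ k) (k + 1) 0 := by
  have hk := h.pos
  obtain ⟨w, hw⟩ := three_pow_dvd_discPoly (N := 6 * k + 6) (Nat.succ_pos _) (Nat.succ_pos _)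
    (by omega) h₀ h₁ h.shift_two (by omega) (by omega) (by omega)
  have hΔ := le_of_three_pow_mul_eq (hw.symm.trans hD) hx
  obtain ⟨x₂, h₂⟩ := (pow_dvd_pow 3 (show k + 2 ≤ Δ / 6 + 1 by omega)).trans h₂
  obtain ⟨j, rfl⟩ := Nat.exists_eq_add_of_lt hk
  refine ⟨h.isCubicAt_shift hne, Nat.succ_pos _, h₀, (pow_dvd_pow 3 (by omega)).trans h₁,
    3 * (x₂ + 2 * y ^ 2 * 3 ^ j) + devCoeff (quartic a b c) s₀ 3 * y, ?_, ?_⟩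
  · rw [devCoeff_shift_two, h₂]
    ring
  · rw [dvd_add_right (dvd_mul_right 3 _), devCoeff_quartic_three]
    intro hd
    rcases Int.prime_three.dvd_or_dvd hd with hd | hd
    · have := h.ndvd
      omega
    · have : (3 : ℤ) ∣ y ^ 2 := dvd_pow hd two_ne_zero
      rw [h.sq] at this
      omega

end IsTripleAt

variable {x : ℤ}

/-- If 3u₁ exceeded Δ, the crude bound would put 3^(Δ+1) into the discriminant; so u₁/2 ≤ Δ/6 and
the hypothesis on a₂ is strong enough. -/
theorem dvd_two_of_vertex_one (hD : discPoly c b a 0 = 3 ^ Δ * x) (hx : ¬ (3 : ℤ) ∣ x)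
    (h₂ : (3 : ℤ) ^ (Δ / 6 + 1) ∣ devCoeff (quartic a b c) s₀ 2)
    (h₂' : (3 : ℤ) ^ 2 ∣ devCoeff (quartic a b c) s₀ 2) {u₁ : ℕ} (hu₀ : 0 < u₀) (hu₁ : 0 < u₁)
    (h₀ : (3 : ℤ) ^ u₀ ∣ devCoeff (quartic a b c) s₀ 0)
    (h₁ : (3 : ℤ) ^ u₁ ∣ devCoeff (quartic a b c) s₀ 1) (hu : 3 * u₁ ≤ 2 * u₀) :
    (3 : ℤ) ^ (u₁ / 2 + 1) ∣ devCoeff (quartic a b c) s₀ 2 := by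
  -- The crude bound requires an exponent of at least 2 for a₂, which Δ/6 + 1 alone does not
  -- guarantee for small Δ.
  have h₂'' : (3 : ℤ) ^ (max 2 (Δ / 6 + 1)) ∣ devCoeff (quartic a b c) s₀ 2 := by
    rcases max_choice 2 (Δ / 6 + 1) with h | h <;> rw [h] <;> assumption
  have hΔ : 3 * u₁ ≤ Δ := by
    by_contra! hlt
    obtain ⟨w, hw⟩ := three_pow_dvd_discPoly (N := Δ + 1) hu₀ hu₁ (by omega) h₀ h₁ h₂''
      (by omega) (by omega) (by omega)
    exact absurd (le_of_three_pow_mul_eq (hw.symm.trans hD) hx) (by omega)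
  exact (pow_dvd_pow 3 (by omega)).trans h₂

/-- The same bootstrap with 2u₀ in the place of 3u₁. -/
theorem dvd_two_of_one_side (hD : discPoly c b a 0 = 3 ^ Δ * x) (hx : ¬ (3 : ℤ) ∣ x)
    (h₂ : (3 : ℤ) ^ (Δ / 6 + 1) ∣ devCoeff (quartic a b c) s₀ 2)
    (h₂' : (3 : ℤ) ^ 2 ∣ devCoeff (quartic a b c) s₀ 2) (hu₀ : 0 < u₀)
    (h₀ : (3 : ℤ) ^ u₀ ∣ devCoeff (quartic a b c) s₀ 0)
    (h₁ : (3 : ℤ) ^ (2 * u₀ / 3 + 1) ∣ devCoeff (quartic a b c) s₀ 1) :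
    (3 : ℤ) ^ (u₀ / 3 + 1) ∣ devCoeff (quartic a b c) s₀ 2 := by
  have h₂'' : (3 : ℤ) ^ (max 2 (Δ / 6 + 1)) ∣ devCoeff (quartic a b c) s₀ 2 := by
    rcases max_choice 2 (Δ / 6 + 1) with h | h <;> rw [h] <;> assumption
  have hΔ : 2 * u₀ < Δ := by
    by_contra! hlt
    obtain ⟨w, hw⟩ := three_pow_dvd_discPoly (N := Δ + 1) hu₀ (Nat.succ_pos _) (by omega) h₀ h₁ h₂''
      (by omega) (by omega) (by omega)
    exact absurd (le_of_three_pow_mul_eq (hw.symm.trans hD) hx) (by omega)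
  exact (pow_dvd_pow 3 (by omega)).trans h₂

end Start

/-! ### The rows of the table and the final assembly -/

section Table

variable {K : Type*} [Field K] [NumberField K] {a b c s₀ σ y : ℤ} {θ : K} {k : ℕ}

/-- The iteration started at the integer that follows an irregular starting point, and the
exponents that it yields. -/
theorem IsTripleAt.table (h : IsTripleAt a b c s₀ k σ y) (hirr : Irreducible (quartic a b c))
    (hθ : aeval θ (quartic a b c) = 0) (hK : IntermediateField.adjoin ℚ {θ} = ⊤) {Δ : ℕ} {x : ℤ}
    (hD : discPoly c b a 0 = 3 ^ Δ * x) (hx : ¬ (3 : ℤ) ∣ x)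
    (h₂ : (3 : ℤ) ^ (Δ / 6 + 1) ∣ devCoeff (quartic a b c) s₀ 2) {s₁ : ℤ}
    (hs₁ : s₁ = s₀ + y * 3 ^ k) :
    IterSucceeds 3 (quartic a b c) s₁ ∧ ∀ s, IterReaches 3 (quartic a b c) s₁ s →
      IsRegularAt 3 (quartic a b c) s → ∃ ν₁ ν₂ : ℕ,
        (vp 3 (devCoeff (quartic a b c) s₁ 0) = (3 * k + 1 : ℕ) ∧ ν₁ = 2 * k ∧ ν₂ = k ∨
          ((3 * k + 2 : ℕ) : ℕ∞) ≤ vp 3 (devCoeff (quartic a b c) s₁ 0) ∧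
            vp 3 (devCoeff (quartic a b c) s₁ 1) = (2 * k + 1 : ℕ) ∧ ν₁ = 2 * k + 1 ∧ ν₂ = k ∨
          vp 3 (devCoeff (quartic a b c) s₁ 0) = (3 * k + 2 : ℕ) ∧
            ((2 * k + 2 : ℕ) : ℕ∞) ≤ vp 3 (devCoeff (quartic a b c) s₁ 1) ∧
            ν₁ = 2 * k + 1 ∧ ν₂ = k ∨
          ((3 * k + 3 : ℕ) : ℕ∞) ≤ vp 3 (devCoeff (quartic a b c) s₁ 0) ∧
            ((2 * k + 2 : ℕ) : ℕ∞) ≤ vp 3 (devCoeff (quartic a b c) s₁ 1) ∧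
            Δ / 2 = ν₁ + k + 1 ∧ ν₂ = k + 1) ∧
        PolygonFloors (quartic a b c) s ν₁ ν₂ ∧
        IsPIntegralBasis 3 (tripleBasis 3 a b s θ ν₁ ν₂) := by
  obtain ⟨B, hB⟩ := exists_basis hirr hθ hK
  have hne := devCoeff_zero_ne hirr
  have hd := ne_zero_of_eq_three_pow_mul hD hx
  have hc := h.isCubicAt_shift hne
  have e₀ := h.shift_zero
  have e₁ := h.shift_one
  obtain ⟨x₂, e₂⟩ := h.shift_two
  have hdouble := h.isDoubleAt_shift hne hD hx h₂
  rw [← hs₁] at hc e₀ e₁ e₂ hdouble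
  -- Serves the two rows in which s₁ has a single side, of height 3k + 1 or 3k + 2.
  have side : ∀ {u : ℕ} {x₀ : ℤ}, devCoeff (quartic a b c) s₁ 0 = 3 ^ u * x₀ → ¬ (3 : ℤ) ∣ x₀ →
      (3 : ℤ) ^ (2 * u / 3 + 1) ∣ devCoeff (quartic a b c) s₁ 1 → ¬ 3 ∣ u → u / 3 = k →
      IsRegularAt 3 (quartic a b c) s₁ ∧ PolygonFloors (quartic a b c) s₁ (2 * u / 3) k ∧
        IsPIntegralBasis 3 (tripleBasis 3 a b s₁ θ (2 * u / 3) k) := by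
    rintro u x₀ f₀ hx₀ ⟨x₁, f₁⟩ hu rfl
    exact ⟨hc.regular_of_one_side f₀ hx₀ f₁ e₂ hu, hc.polygonFloors_of_one_side f₀ hx₀ f₁ e₂,
      isPIntegralBasis_of_one_side B hB hθ hd hc hu f₀ hx₀ f₁ e₂⟩
  by_cases c₀ : (3 : ℤ) ^ (3 * k + 2) ∣ devCoeff (quartic a b c) s₁ 0
  · by_cases c₁ : (3 : ℤ) ^ (2 * k + 2) ∣ devCoeff (quartic a b c) s₁ 1
    · by_cases c₀' : (3 : ℤ) ^ (3 * k + 3) ∣ devCoeff (quartic a b c) s₁ 0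
      · have hs := hdouble c₀' c₁
        refine ⟨hs.iterSucceeds hne hd, fun s hst hreg => ?_⟩
        obtain ⟨m, hm⟩ := hs.of_iterReaches hne hst
        obtain ⟨μ, hμ⟩ := hm.exists_data hreg
        obtain ⟨w, hw, hw'⟩ := hμ.disc
        -- Thus Δ = 2(k+1) + μ, and ν₁ = ⌊μ/2⌋ can be read off from Δ whatever choices the iteration
        -- made.
        have hΔ := le_antisymm (le_of_three_pow_mul_eq (hw.symm.trans hD) hx)
          (le_of_three_pow_mul_eq (hD.symm.trans hw) hw')
        exact ⟨μ / 2, k + 1, Or.inr <| Or.inr <| Or.inr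
          ⟨three_pow_dvd_iff.mp c₀', three_pow_dvd_iff.mp c₁, by omega, rfl⟩, hμ.floors,
          isPIntegralBasis_of_doubleData B hB hθ hm hμ⟩
      · have hv := vp_three_eq_of_dvd c₀ c₀'
        obtain ⟨x₀, f₀, hx₀⟩ := vp_three_eq_iff.mp hv
        obtain ⟨hreg, hf, hi⟩ := side f₀ hx₀ ((pow_dvd_pow 3 (by omega)).trans c₁) (by omega)
          (by omega)
        refine ⟨iterSucceeds_of_regular hreg, fun s hst _ => ?_⟩
        rw [iterReaches_eq_of_regular hreg hst]
        exact ⟨_, k, Or.inr <| Or.inr <| Or.inl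
          ⟨hv, three_pow_dvd_iff.mp c₁, by omega, rfl⟩, hf, hi⟩
    · have hv := vp_three_eq_of_dvd e₁ c₁
      obtain ⟨x₁, f₁, hx₁⟩ := vp_three_eq_iff.mp hv
      obtain ⟨x₀, f₀⟩ := c₀
      have f₂ : devCoeff (quartic a b c) s₁ 2 = 3 ^ ((2 * k + 1) / 2 + 1) * x₂ := by
        rw [e₂]; congr 2; omega
      have hreg := hc.regular_of_vertex_one f₀ f₁ hx₁ f₂ (by omega)
      refine ⟨iterSucceeds_of_regular hreg, fun s hst _ => ?_⟩
      rw [iterReaches_eq_of_regular hreg hst]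
      exact ⟨2 * k + 1, _, Or.inr <| Or.inl
        ⟨three_pow_dvd_iff.mp ⟨x₀, f₀⟩, hv, rfl, by omega⟩,
        hc.polygonFloors_of_vertex_one f₀ f₁ hx₁ f₂ (by omega),
        isPIntegralBasis_of_vertex_one B hB hθ hc f₀ f₁ hx₁ f₂ (by omega)⟩
  · have hv := vp_three_eq_of_dvd e₀ c₀
    obtain ⟨x₀, f₀, hx₀⟩ := vp_three_eq_iff.mp hv
    obtain ⟨hreg, hf, hi⟩ := side f₀ hx₀ ((pow_dvd_pow 3 (by omega)).trans e₁) (by omega)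
      (by omega)
    refine ⟨iterSucceeds_of_regular hreg, fun s hst _ => ?_⟩
    rw [iterReaches_eq_of_regular hreg hst]
    exact ⟨_, k, Or.inl ⟨hv, by omega, rfl⟩, hf, hi⟩

end Table

theorem lemma4p3 {K : Type*} [Field K] [NumberField K]
    (a b c : ℤ) (hirr : Irreducible (quartic a b c))
    (θ : K) (hθ : aeval θ (quartic a b c) = 0) (hK : IntermediateField.adjoin ℚ {θ} = ⊤)
    (ha : a ≡ 3 [ZMOD 9]) (hb : ¬ (3 : ℤ) ∣ b) (hc : (3 : ℤ) ∣ c)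
    -- the 3-adic value of the discriminant of the quartic
    (Δ : ℕ) (hΔ : vp 3 (quartic a b c).discr = Δ)
    (s₀ : ℤ) (hs₀ : s₀ ≡ -b [ZMOD 3]) (hu₂ : (Δ : ℕ∞) < 6 * vp 3 (a + 6 * s₀ ^ 2))
    (u₀ : ℕ) (hu₀ : vp 3 ((quartic a b c).eval s₀) = u₀)
    (u₁ : ℕ∞) (hu₁ : vp 3 ((derivative (quartic a b c)).eval s₀) = u₁)
    (σ₀ : ℤ) (hσ₀ : (quartic a b c).eval s₀ = σ₀ * 3 ^ u₀)
    (s₁ : ℤ) (hs₁ : s₁ = s₀ + (if σ₀ ≡ b [ZMOD 3] then 1 else -1) * 3 ^ (u₀ / 3)) :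
    (¬ IsRegularAt 3 (quartic a b c) s₀ ↔ 2 * (u₀ : ℕ∞) < 3 * u₁ ∧ 3 ∣ u₀) ∧
    (¬ IsRegularAt 3 (quartic a b c) s₀ → IterSucceeds 3 (quartic a b c) s₁) ∧
    (∀ s : ℤ,
      (IsRegularAt 3 (quartic a b c) s₀ ∧ s = s₀ ∨
        ¬ IsRegularAt 3 (quartic a b c) s₀ ∧ IterReaches 3 (quartic a b c) s₁ s ∧
          IsRegularAt 3 (quartic a b c) s) →
      ∃ ν₁ ν₂ : ℕ,
        -- the rows of the table
        (3 * u₁ ≤ 2 * (u₀ : ℕ∞) ∧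
            (ν₁ : ℕ∞) = u₁ ∧ ν₂ = ν₁ / 2 ∨
          2 * (u₀ : ℕ∞) < 3 * u₁ ∧ ¬ 3 ∣ u₀ ∧
            ν₁ = 2 * u₀ / 3 ∧ ν₂ = u₀ / 3 ∨
          2 * (u₀ : ℕ∞) < 3 * u₁ ∧ 3 ∣ u₀ ∧
            vp 3 ((quartic a b c).eval s₁) = u₀ + 1 ∧
            ν₁ = 2 * u₀ / 3 ∧ ν₂ = u₀ / 3 ∨
          2 * (u₀ : ℕ∞) < 3 * u₁ ∧ 3 ∣ u₀ ∧
            u₀ + 1 < vp 3 ((quartic a b c).eval s₁) ∧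
            vp 3 ((derivative (quartic a b c)).eval s₁) = (2 * u₀ / 3 + 1 : ℕ) ∧
            ν₁ = 2 * u₀ / 3 + 1 ∧ ν₂ = u₀ / 3 ∨
          2 * (u₀ : ℕ∞) < 3 * u₁ ∧ 3 ∣ u₀ ∧
            vp 3 ((quartic a b c).eval s₁) = u₀ + 2 ∧
            (2 * u₀ / 3 + 1 : ℕ) < vp 3 ((derivative (quartic a b c)).eval s₁) ∧
            ν₁ = 2 * u₀ / 3 + 1 ∧ ν₂ = u₀ / 3 ∨
          2 * (u₀ : ℕ∞) < 3 * u₁ ∧ 3 ∣ u₀ ∧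
            u₀ + 2 < vp 3 ((quartic a b c).eval s₁) ∧
            (2 * u₀ / 3 + 1 : ℕ) < vp 3 ((derivative (quartic a b c)).eval s₁) ∧
            (ν₁ : ℤ) = (Δ / 2 : ℕ) - (u₀ / 3 : ℕ) - 1 ∧ ν₂ = u₀ / 3 + 1) ∧
        -- the exponents are the integral parts of the ordinates of the polygon
        (∃ y₁ y₂ : ℚ, OnPrincipalPolygon 3 (quartic a b c) s 1 y₁ ∧
          OnPrincipalPolygon 3 (quartic a b c) s 2 y₂ ∧
          ⌊y₁⌋ = (ν₁ : ℤ) ∧ ⌊y₂⌋ = (ν₂ : ℤ)) ∧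
        IsPIntegralBasis 3 (tripleBasis 3 a b s θ ν₁ ν₂)) := by
  rw [discr_quartic] at hΔ
  obtain ⟨x, hD, hx⟩ := vp_three_eq_iff.mp hΔ
  have hd := ne_zero_of_eq_three_pow_mul hD hx
  have hne := devCoeff_zero_ne hirr
  obtain ⟨B, hB⟩ := exists_basis hirr hθ hK
  simp only [← devCoeff_one_eq_eval] at hu₁ ⊢
  simp only [← devCoeff_zero_eq_eval] at hu₀ hσ₀ ⊢
  have hs3 : ¬ (3 : ℤ) ∣ s₀ := by
    unfold Int.ModEq at hs₀
    omega
  have hsq : (3 : ℤ) ∣ s₀ ^ 2 - 1 := by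
    have : (3 : ℤ) ∣ (s₀ - 1) * (s₀ + 1) := by
      rcases (by omega : (3 : ℤ) ∣ s₀ - 1 ∨ (3 : ℤ) ∣ s₀ + 1) with h | h
      · exact h.mul_right _
      · exact h.mul_left _
    convert this using 1; ring
  obtain ⟨q, hq⟩ := hsq
  obtain ⟨a', ha'⟩ := ha.symm.dvd
  obtain ⟨c', rfl⟩ := hc
  obtain ⟨t, ht⟩ := hs₀.symm.dvd
  -- Since s₀² is 1 modulo 3, the congruence of a modulo 9 gives a second factor 3.
  have d₂' : (3 : ℤ) ^ 2 ∣ devCoeff (quartic a b (3 * c')) s₀ 2 := by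
    rw [devCoeff_quartic_two]
    exact ⟨2 * q + a' + 1, by linear_combination 6 * hq + ha'⟩
  have d₁ : (3 : ℤ) ^ 1 ∣ devCoeff (quartic a b (3 * c')) s₀ 1 := by
    rw [devCoeff_quartic_one]
    exact ⟨4 * s₀ * q + 6 * a' * s₀ + 2 * s₀ + s₀ + t, by
      linear_combination 4 * s₀ * hq + 2 * s₀ * ha' + ht⟩
  have d₀ : (3 : ℤ) ^ 1 ∣ devCoeff (quartic a b (3 * c')) s₀ 0 := by
    rw [devCoeff_quartic_zero]
    exact ⟨s₀ ^ 2 * q + 3 * a' * s₀ ^ 2 + s₀ ^ 2 + s₀ * t + c', by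
      linear_combination s₀ ^ 2 * hq + s₀ ^ 2 * ha' + s₀ * ht⟩
  have d₂ : (3 : ℤ) ^ (Δ / 6 + 1) ∣ devCoeff (quartic a b (3 * c')) s₀ 2 := by
    rw [three_pow_dvd_iff, devCoeff_quartic_two, add_comm (6 * s₀ ^ 2)]
    exact le_of_lt_six_mul (m := Δ / 6 + 1) hu₂ (by omega)
  have hcub := isCubicAt_of_dvd hne hs3 one_pos one_pos two_pos d₀ d₁ d₂'
  have h₀ : devCoeff (quartic a b (3 * c')) s₀ 0 = 3 ^ u₀ * σ₀ := by rw [hσ₀, mul_comm]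
  have hσ : ¬ (3 : ℤ) ∣ σ₀ := by
    obtain ⟨z, hz, hz'⟩ := vp_three_eq_iff.mp hu₀
    rwa [mul_left_cancel₀ (pow_ne_zero u₀ three_ne_zero) (h₀.symm.trans hz)]
  have hu₀pos : 0 < u₀ := by
    by_contra! h0
    obtain rfl : u₀ = 0 := by omega
    exact hσ (by simpa [h₀] using d₀)
  rcases le_or_gt (3 * u₁) (2 * (u₀ : ℕ∞)) with hcase | hcase
  · obtain ⟨n, rfl⟩ : ∃ n : ℕ, u₁ = n := by
      refine ENat.ne_top_iff_exists.mp ?_ |>.imp fun _ => Eq.symm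
      rintro rfl
      rw [ENat.mul_top (by norm_num), top_le_iff] at hcase
      exact absurd hcase (by exact_mod_cast ENat.natCast_ne_top (2 * u₀))
    obtain ⟨x₁, h₁, hx₁⟩ := vp_three_eq_iff.mp hu₁
    have hcase' : 3 * n ≤ 2 * u₀ := by exact_mod_cast hcase
    have hn : 0 < n := by
      by_contra! h0
      obtain rfl : n = 0 := by omega
      exact hx₁ (by simpa [h₁] using d₁)
    obtain ⟨x₂, h₂⟩ := dvd_two_of_vertex_one hD hx d₂ d₂' hu₀pos hn ⟨_, h₀⟩ ⟨_, h₁⟩ hcase'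
    have hreg := hcub.regular_of_vertex_one h₀ h₁ hx₁ h₂ hcase'
    refine ⟨⟨fun h => absurd hreg h, fun h => absurd h.1 hcase.not_gt⟩, fun h => absurd hreg h, ?_⟩
    rintro s (⟨-, rfl⟩ | ⟨h, -⟩)
    · exact ⟨n, n / 2, Or.inl ⟨hcase, rfl, rfl⟩,
        hcub.polygonFloors_of_vertex_one h₀ h₁ hx₁ h₂ hcase',
        isPIntegralBasis_of_vertex_one B hB hθ hcub h₀ h₁ hx₁ h₂ hcase'⟩
    · exact absurd hreg h
  · have hdvd : (3 : ℤ) ^ (2 * u₀ / 3 + 1) ∣ devCoeff (quartic a b (3 * c')) s₀ 1 := by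
      rw [three_pow_dvd_iff, hu₁]
      exact two_mul_lt_three_mul_iff.mp hcase
    obtain ⟨x₁, h₁⟩ := hdvd
    obtain ⟨x₂, h₂⟩ := dvd_two_of_one_side hD hx d₂ d₂' hu₀pos ⟨_, h₀⟩ ⟨_, h₁⟩
    by_cases h3 : 3 ∣ u₀
    · obtain ⟨k, rfl⟩ := h3
      have k₁ : 3 * k / 3 = k := by omega
      have k₂ : 2 * (3 * k) / 3 = 2 * k := by omega
      simp only [k₁, k₂] at *
      have hirreg := hcub.not_regular_of_one_side h₀ hσ h₁ h₂
      set y : ℤ := if σ₀ ≡ b [ZMOD 3] then 1 else -1 with hy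
      have htriple : IsTripleAt a b (3 * c') s₀ k σ₀ y := by
        refine ⟨by omega, hs3, h₀, ⟨_, h₁⟩, ⟨_, h₂⟩, ?_, ?_⟩
        · rw [hy]; split_ifs <;> norm_num
        -- As 4s₀ is -b modulo 3, the triple root of σ₀ - by³ is σ₀/b, that is, 1 or -1 according to
        -- whether σ₀ and b agree.
        · rw [devCoeff_quartic_three, hy]
          have hb' : b % 3 = 1 ∨ b % 3 = 2 := by omega
          have hσ' : σ₀ % 3 = 1 ∨ σ₀ % 3 = 2 := by omega
          split_ifs with hσb <;> unfold Int.ModEq at hσb <;> rcases hb' with hb' | hb' <;>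
            rcases hσ' with hσ' | hσ' <;> omega
      obtain ⟨hit, htab⟩ := htriple.table hirr hθ hK hD hx d₂ hs₁
      refine ⟨⟨fun _ => ⟨hcase, dvd_mul_right 3 k⟩, fun _ => hirreg⟩, fun _ => hit, ?_⟩
      rintro s (⟨h, -⟩ | ⟨-, hst, hreg⟩)
      · exact absurd h hirreg
      obtain ⟨ν₁, ν₂, hrow, hrest⟩ := htab s hst hreg
      refine ⟨ν₁, ν₂, ?_, hrest⟩
      have lt_iff : ∀ {m : ℕ} {v : ℕ∞}, (m : ℕ∞) < v ↔ ((m + 1 : ℕ) : ℕ∞) ≤ v := fun {m v} => by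
        rw [Nat.cast_add, Nat.cast_one, ENat.add_one_le_iff (ENat.natCast_ne_top m)]
      rcases hrow with ⟨e₀, r₁, r₂⟩ | ⟨e₀, e₁, r₁, r₂⟩ | ⟨e₀, e₁, r₁, r₂⟩ | ⟨e₀, e₁, r₁, r₂⟩
      · exact Or.inr <| Or.inr <| Or.inl
          ⟨hcase, dvd_mul_right 3 k, by exact_mod_cast e₀, r₁, r₂⟩
      · exact Or.inr <| Or.inr <| Or.inr <| Or.inl
          ⟨hcase, dvd_mul_right 3 k, by exact_mod_cast lt_iff.mpr e₀, e₁, r₁, r₂⟩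
      · exact Or.inr <| Or.inr <| Or.inr <| Or.inr <| Or.inl
          ⟨hcase, dvd_mul_right 3 k, by exact_mod_cast e₀, lt_iff.mpr e₁, r₁, r₂⟩
      · exact Or.inr <| Or.inr <| Or.inr <| Or.inr <| Or.inr
          ⟨hcase, dvd_mul_right 3 k, by exact_mod_cast lt_iff.mpr e₀, lt_iff.mpr e₁, by omega, r₂⟩
    · have hreg := hcub.regular_of_one_side h₀ hσ h₁ h₂ h3
      refine ⟨⟨fun h => absurd hreg h, fun h => absurd h.2 h3⟩, fun h => absurd hreg h, ?_⟩
      rintro s (⟨-, rfl⟩ | ⟨h, -⟩)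
      · exact ⟨_, _, Or.inr <| Or.inl ⟨hcase, h3, rfl, rfl⟩,
          hcub.polygonFloors_of_one_side h₀ hσ h₁ h₂,
          isPIntegralBasis_of_one_side B hB hθ hd hcub h3 h₀ hσ h₁ h₂⟩
      · exact absurd hreg h
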